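/- **Setting.** For a finite directed acyclic graph (DAG) $G$ let $\mathbb C[\Sigma]=\mathbb C[\sigma_{ij}: i,j\in V(G)]$ with $\sigma_{ij}=\sigma_{ji}$, and let $\Sigma=(\sigma_{ij})$. * A *trek* between $i$ and $j$ is a simple path (edges in any direction) without colliders; equivalently, a vertex $\mathrm{top}$ with directed paths $\mathrm{top}\to\cdots\to i$ (its $i$-side) and $\mathrm{top}\to\cdots\to j$ (its $j$-side) that meet only in $\mathrm{top}$. * If any two vertices of $G$ are joined by a unique shortest trek or by no trek, the shortest trek map $\psi_G:\mathbb C[\Sigma]\to\mathbb C[a_i,\lambda_{kl}: i\in V(G),\ k\to l\in E(G)]$ is defined; it sends $\sigma_{ij}$ to $a_{\mathrm{top}}\prod\lambda_{kl}$, the product being over the edges $k\to l$ of the shortest trek between $i$ and $j$, and to $0$ if there is no trek. Then $ST_G=\ker\psi_G$. * $CI_G$ is generated by the $(\#S+1)$-minors of $\Sigma_{A\cup S,B\cup S}$ for all disjoint $A,B,S\subseteq V(G)$ such that $S$ d-separates $A$ from $B$ in $G$. * $I_G$ is the ideal of all $f\in\mathbb C[\Sigma]$ that vanish at $(I-L)^{-T}\,\mathrm{diag}(\omega)\,(I-L)^{-1}$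 for all real $L=(\lambda_{ij})$ supported on the edges $i\to j$ of $G$ and all $\omega_i>0$. * An ideal is *toric* if it is the kernel of a monomial map, i.e. of a $\mathbb C$-algebra homomorphism to a Laurent polynomial ring that sends each indeterminate to a Laurent monomial or to $0$. * Let $G$ be the clique sum of DAGs $G_1,G_2$ at their set of common vertices $C=\{c\}\sqcup D$: $V(G)=V(G_1)\cup V(G_2)$, $E(G)=E(G_1)\cup E(G_2)$, and $G_1$ and $G_2$ induce on $C$ the same complete DAG. It is a *safe gluing* if, with $A_i=V(G_i)\setminus D$ (so $c\in A_1\cap A_2$), (i) $c$ is a choke point between $A_1$ and $A_2$, i.e. every trek of $G$ from a vertex of $A_1$ to a vertex of $A_2$ contains $c$, and either $c$ is on the $A_1$-side of all these treks or $c$ is on the $A_2$-side of all of them, and (ii) none of these treks contains a vertex of $D$. Gluing $G_1$ and $G_2$ at a single common vertex $c$ (so $D=\emptyset$) that is a sink of both $G_1$ and $G_2$ is also called a safe gluing. **Theorem.** Let $G_1$ and $G_2$ be finite DAGs for which the shortest trek map is defined, with $ST_{G_1}=CI_{G_1}$ and $ST_{G_2}=CI_{G_2}$, and let $G$ be a safe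 gluing of $G_1$ and $G_2$ at a clique $C$ of any size $N\ge 1$. Then the shortest trek map of $G$ is defined and $ST_G=CI_G=I_G$. Hence $I_G$ is toric. Moreover $I_G$ is generated by the indeterminates $\sigma_{ij}$ for which there is no trek between $i$ and $j$ in $G$, together with the quadratic binomials $$\sigma_{ik}\sigma_{jl}-\sigma_{il}\sigma_{jk},\qquad i\ne j\in A\cup\{c'\},\quad k\ne l\in B\cup\{c'\},$$ i.e. the $2\times2$ minors of $\Sigma_{A\cup\{c'\},B\cup\{c'\}}$, for all disjoint $A,B\subseteq V(G)$ and all vertices $c'\notin A\cup B$ such that $\{c'\}$ d-separates $A$ from $B$. -/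

import Mathlib

open MvPolynomial

noncomputable section

/-- A directed acyclic graph on the vertex type `V`; `G.edge i j` is the edge `i → j`. -/
structure DAG (V : Type*) where
  edge : V → V → Prop
  acyclic : ∀ v, ¬ Relation.TransGen edge v v

namespace DAG

variable {V : Type*}

/-! ### Treks -/

/-- A (simple) trek between `i` and `j`, i.e. a simple path without colliders, given as the pair of
directed paths `top → ⋯ → i` (the vertices of `top :: left`) and `top → ⋯ → j` (the vertices of
`top :: right`), which share no vertex except `top`. -/
@[ext]
structure Trek (G : DAG V) (i j : V) where
  top : V
  left : List V
  right : List V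
  left_chain : (top :: left).IsChain G.edge
  right_chain : (top :: right).IsChain G.edge
  left_end : (top :: left).getLast (List.cons_ne_nil _ _) = i
  right_end : (top :: right).getLast (List.cons_ne_nil _ _) = j
  nodup : (top :: (left ++ right)).Nodup

/-- The product of the indeterminates `λ_{kl}` over the consecutive pairs `k, l` of a list. The
parameter ring has indeterminates `a_v = X (inl v)` and `λ_{kl} = X (inr (k, l))`; only those
`λ_{kl}` with `k → l` an edge ever occur. -/
def edgeMonomial (l : List V) : MvPolynomial (V ⊕ V × V) ℂ :=
  ((l.zip l.tail).map fun e => X (Sum.inr e)).prod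

namespace Trek

variable {G : DAG V} {i j : V}

/-- The number of edges. -/
def length (T : G.Trek i j) : ℕ := T.left.length + T.right.length

/-- The vertices on the `i`-side of the trek (including the top). -/
def leftSide (T : G.Trek i j) : List V := T.top :: T.left

/-- The vertices on the `j`-side of the trek (including the top). -/
def rightSide (T : G.Trek i j) : List V := T.top :: T.right

/-- All vertices of the trek. -/
def verts (T : G.Trek i j) : List V := T.top :: (T.left ++ T.right)

/-- `a_top ∏ λ_{kl}`, the product over the edges `k → l` of the trek. -/
def monomial (T : G.Trek i j) : MvPolynomial (V ⊕ V × V) ℂ :=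
  X (Sum.inl T.top) * edgeMonomial T.leftSide * edgeMonomial T.rightSide

/-- `T` has the least length among the treks between `i` and `j`. -/
def IsShortest (T : G.Trek i j) : Prop := ∀ T' : G.Trek i j, T.length ≤ T'.length

/-- The same trek, read from `j` to `i`. -/
def symm (T : G.Trek i j) : G.Trek j i where
  top := T.top
  left := T.right
  right := T.left
  left_chain := T.right_chain
  right_chain := T.left_chain
  left_end := T.right_end
  right_end := T.left_end
  nodup := (List.Perm.cons _ List.perm_append_comm).nodup T.nodup

theorem length_symm (T : G.Trek i j) : T.symm.length = T.length := Nat.add_comm _ _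

theorem monomial_symm (T : G.Trek i j) : T.symm.monomial = T.monomial :=
  mul_right_comm _ _ _

theorem IsShortest.symm {T : G.Trek i j} (h : T.IsShortest) : T.symm.IsShortest := fun T' => by
  rw [length_symm, ← T'.length_symm]
  exact h _

end Trek

/-! ### The shortest trek ideal -/

/-- Any two vertices are joined by a unique shortest trek, or by no trek at all: the condition under
which the shortest trek map of `G` is defined. -/
def HasUniqueShortestTreks (G : DAG V) : Prop :=
  ∀ i j : V, Nonempty (G.Trek i j) → ∃! T : G.Trek i j, T.IsShortest

open Classical in
/-- The monomial of the shortest trek between the two vertices of `z`, or `0` without a trek. -/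
def shortestTrekMonomial (G : DAG V) (z : Sym2 V) : MvPolynomial (V ⊕ V × V) ℂ :=
  if h : ∃ m, ∃ (i j : V) (T : G.Trek i j), s(i, j) = z ∧ T.IsShortest ∧ m = T.monomial
  then h.choose else 0

theorem shortestTrekMonomial_of_isShortest {G : DAG V} (hG : G.HasUniqueShortestTreks) {i j : V}
    (T : G.Trek i j) (hT : T.IsShortest) : G.shortestTrekMonomial s(i, j) = T.monomial := by
  have h : ∃ m, ∃ (i' j' : V) (T : G.Trek i' j'), s(i', j') = s(i, j) ∧ T.IsShortest ∧
      m = T.monomial := ⟨_, i, j, T, rfl, hT, rfl⟩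
  rw [shortestTrekMonomial, dif_pos h]
  obtain ⟨i', j', T', hz, hT', hm⟩ := h.choose_spec
  rw [hm]
  rcases Sym2.eq_iff.1 hz with ⟨rfl, rfl⟩ | ⟨rfl, rfl⟩
  · rw [(hG _ _ ⟨T⟩).unique hT hT']
  · rw [(hG _ _ ⟨T⟩).unique hT hT'.symm, Trek.monomial_symm]

theorem shortestTrekMonomial_of_isEmpty {G : DAG V} {i j : V} (h : IsEmpty (G.Trek i j)) :
    G.shortestTrekMonomial s(i, j) = 0 := by
  rw [shortestTrekMonomial, dif_neg]
  rintro ⟨m, i', j', T, hz, -, -⟩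
  rcases Sym2.eq_iff.1 hz with ⟨rfl, rfl⟩ | ⟨rfl, rfl⟩
  · exact h.false T
  · exact h.false T.symm

/-- The shortest trek map `ψ_G`. The indeterminate `σ_{ij} = σ_{ji}` is `X s(i, j)`. -/
def shortestTrekMap (G : DAG V) :
    MvPolynomial (Sym2 V) ℂ →ₐ[ℂ] MvPolynomial (V ⊕ V × V) ℂ :=
  aeval G.shortestTrekMonomial

/-- The shortest trek ideal `ST_G`, meaningful for graphs with unique shortest treks. -/
def shortestTrekIdeal (G : DAG V) : Ideal (MvPolynomial (Sym2 V) ℂ) :=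
  RingHom.ker G.shortestTrekMap

/-! ### The vanishing ideal -/

section Vanishing

variable [Fintype V] [DecidableEq V]

/-- The covariance matrix `(I - L)⁻ᵀ D (I - L)⁻¹` with `D = diag(ω)`. -/
def covariance (L : Matrix V V ℝ) (ω : V → ℝ) : Matrix V V ℝ :=
  ((1 - L)⁻¹).transpose * Matrix.diagonal ω * (1 - L)⁻¹

theorem covariance_symm (L : Matrix V V ℝ) (ω : V → ℝ) (i j : V) :
    covariance L ω i j = covariance L ω j i := by
  have h : (covariance L ω).transpose = covariance L ω := by
    simp [covariance, Matrix.transpose_mul, Matrix.mul_assoc]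
  exact (congrFun (congrFun h j) i)

/-- The point of affine space whose coordinate `σ_{ij}` is the `(i, j)` entry of the covariance
matrix. -/
def covariancePoint (L : Matrix V V ℝ) (ω : V → ℝ) : Sym2 V → ℂ :=
  Sym2.lift ⟨fun i j => (covariance L ω i j : ℂ), fun i j =>
    congrArg (fun t : ℝ => (t : ℂ)) (covariance_symm L ω i j)⟩

/-- The vanishing ideal `I_G` of the Gaussian model of `G`: all polynomials that vanish at the
covariance matrices of all parameters `λ_{ij} ∈ ℝ` (one for each edge `i → j`) and `ω_i > 0`. -/
def vanishingIdeal (G : DAG V) : Ideal (MvPolynomial (Sym2 V) ℂ) :=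
  MvPolynomial.vanishingIdeal ℂ
    {x : Sym2 V → ℂ | ∃ (L : Matrix V V ℝ) (ω : V → ℝ),
      (∀ i j, ¬ G.edge i j → L i j = 0) ∧ (∀ i, 0 < ω i) ∧ x = covariancePoint L ω}

end Vanishing

/-! ### The conditional independence ideal -/

/-- A simple path (edges in any direction), as the nonempty list of its vertices. -/
def IsPath (G : DAG V) (p : List V) : Prop :=
  p ≠ [] ∧ p.Nodup ∧ p.IsChain fun a b => G.edge a b ∨ G.edge b a

/-- `k` is a collider vertex within `p`: its two neighbours on `p` both point to it. -/
def IsColliderOn (G : DAG V) (p : List V) (k : V) : Prop :=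
  ∃ a b, [a, k, b] <:+: p ∧ G.edge a k ∧ G.edge b k

/-- `C` d-separates `A` and `B`. (Each vertex counts here among its own descendants.) -/
def DSeparates (G : DAG V) (C A B : Finset V) : Prop :=
  ∀ p : List V, G.IsPath p → (∃ i ∈ A, p.head? = some i) → (∃ j ∈ B, p.getLast? = some j) →
    ∃ k ∈ p, (¬ G.IsColliderOn p k ∧ k ∈ C) ∨
      (G.IsColliderOn p k ∧ ∀ m, Relation.ReflTransGen G.edge k m → m ∉ C)

/-- The symmetric matrix of indeterminates `σ_{ij}`. -/
def sigmaMatrix (V : Type*) : Matrix V V (MvPolynomial (Sym2 V) ℂ) :=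
  fun i j => X s(i, j)

/-- The conditional independence ideal `CI_G`, generated by the `(#C + 1)`-minors of
`Σ_{A ∪ C, B ∪ C}` for all disjoint `A`, `B`, `C` such that `C` d-separates `A` and `B`. -/
def ciIdeal [DecidableEq V] (G : DAG V) : Ideal (MvPolynomial (Sym2 V) ℂ) :=
  Ideal.span {f | ∃ A B C : Finset V, Disjoint A B ∧ Disjoint A C ∧ Disjoint B C ∧
    G.DSeparates C A B ∧ ∃ r s : Fin (C.card + 1) → V,
      Function.Injective r ∧ Function.Injective s ∧ (∀ a, r a ∈ A ∪ C) ∧ (∀ a, s a ∈ B ∪ C) ∧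
      f = ((sigmaMatrix V).submatrix r s).det}

/-- The indeterminates `σ_{ij}` for which there is no trek between `i` and `j`. -/
def noTrekVariables (G : DAG V) : Set (MvPolynomial (Sym2 V) ℂ) :=
  {f | ∃ i j : V, IsEmpty (G.Trek i j) ∧ f = X s(i, j)}

/-- The quadratic binomials that are the `2 × 2` minors of `Σ_{A ∪ {c}, B ∪ {c}}`, for all
d-separations of `A` and `B` by a single vertex `c`. -/
def singleVertexMinors [DecidableEq V] (G : DAG V) : Set (MvPolynomial (Sym2 V) ℂ) :=
  {f | ∃ (A B : Finset V) (c : V), Disjoint A B ∧ c ∉ A ∧ c ∉ B ∧ G.DSeparates {c} A B ∧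
    ∃ i ∈ insert c A, ∃ j ∈ insert c A, ∃ k ∈ insert c B, ∃ l ∈ insert c B, i ≠ j ∧ k ≠ l ∧
      f = X s(i, k) * X s(j, l) - X s(i, l) * X s(j, k)}

/-! ### Safe gluing -/

/-- `c` is a choke point between `I` and `J`: every trek from `I` to `J` contains `c`, and `c` is on
the `I`-side of all these treks or on the `J`-side of all of them. -/
def IsChokePoint (G : DAG V) (c : V) (I J : Set V) : Prop :=
  (∀ i ∈ I, ∀ j ∈ J, ∀ T : G.Trek i j, c ∈ T.verts) ∧
    ((∀ i ∈ I, ∀ j ∈ J, ∀ T : G.Trek i j, c ∈ T.leftSide) ∨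
      (∀ i ∈ I, ∀ j ∈ J, ∀ T : G.Trek i j, c ∈ T.rightSide))

/-- All edges at `s` are directed towards `s`. -/
def IsSink (G : DAG V) (s : V) : Prop := ∀ v, ¬ G.edge s v

/-- `G` is the clique sum of `G₁` and `G₂`, whose vertex sets are identified with subsets of `V`
along `f₁` and `f₂`: these subsets cover `V`, the edges of `G` are those of `G₁` and `G₂`, and on
the common vertices `G₁` and `G₂` induce the same complete DAG. -/
structure IsCliqueSum {V₁ V₂ : Type*} (G₁ : DAG V₁) (G₂ : DAG V₂) (G : DAG V)
    (f₁ : V₁ ↪ V) (f₂ : V₂ ↪ V) : Prop where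
  cover : Set.range f₁ ∪ Set.range f₂ = Set.univ
  edge_iff : ∀ x y, G.edge x y ↔
    (∃ a b, f₁ a = x ∧ f₁ b = y ∧ G₁.edge a b) ∨ (∃ a b, f₂ a = x ∧ f₂ b = y ∧ G₂.edge a b)
  same : ∀ a b a' b', f₁ a = f₂ a' → f₁ b = f₂ b' → (G₁.edge a b ↔ G₂.edge a' b')
  complete : ∀ x ∈ Set.range f₁ ∩ Set.range f₂, ∀ y ∈ Set.range f₁ ∩ Set.range f₂, x ≠ y →
    G.edge x y ∨ G.edge y x

/-- `G` is a safe gluing of `G₁` and `G₂` at the clique `C = {c} ∪ D` of their common vertices: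
`c` is a choke point between `V(G₁) \ D` and `V(G₂) \ D`, and no trek between these sets contains a
vertex of `D`. Gluing two graphs at a single common vertex `c` that is a sink of both also counts
as a safe gluing. -/
structure IsSafeGluing {V₁ V₂ : Type*} (G₁ : DAG V₁) (G₂ : DAG V₂) (G : DAG V)
    (f₁ : V₁ ↪ V) (f₂ : V₂ ↪ V) (c : V) (D : Set V) : Prop where
  cliqueSum : IsCliqueSum G₁ G₂ G f₁ f₂
  clique_eq : Set.range f₁ ∩ Set.range f₂ = insert c D
  notMem : c ∉ D
  safe :
    (G.IsChokePoint c (Set.range f₁ \ D) (Set.range f₂ \ D) ∧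
      ∀ i ∈ Set.range f₁ \ D, ∀ j ∈ Set.range f₂ \ D, ∀ T : G.Trek i j, ∀ d ∈ D, d ∉ T.verts) ∨
    (D = ∅ ∧ ∀ c₁ c₂, f₁ c₁ = c → f₂ c₂ = c → G₁.IsSink c₁ ∧ G₂.IsSink c₂)

end DAG

/-- An ideal of a polynomial ring over `ℂ` is toric if it is the kernel of a monomial map, which
sends each indeterminate to a Laurent monomial `t ^ a`, `a ∈ ℤ ^ d`, or (as the shortest trek map
may do) to `0`. -/
def IsToricIdeal {τ : Type*} (I : Ideal (MvPolynomial τ ℂ)) : Prop :=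
  ∃ (d : ℕ) (A : τ → Option (Fin d → ℤ)),
    I = RingHom.ker (aeval (R := ℂ) fun x : τ =>
      (A x).elim (0 : AddMonoidAlgebra ℂ (Fin d → ℤ)) fun a => AddMonoidAlgebra.single a 1)

end

noncomputable section

namespace DAG

variable {V : Type*} {G : DAG V}

/-! Let `Q` be the ideal generated by the no-trek indeterminates and the single-vertex minors
(`quadraticIdeal`). Everything follows from the cycle of inclusions ST ⊆ Q ⊆ CI ⊆ I ⊆ ST for the
glued graph; toricity comes from ST being the kernel of a monomial map.

The inclusion ST ⊆ Q is the combinatorial core. What passes from the parts to the glued graph is not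
the equality ST = CI itself but the weaker `StepProperty`: the shortest trek from `i` into a
nondescendant `j` arrives from a parent `s` of `j` through which all shortest treks from `i` to the
parents of `j` run. It follows from CI ⊆ ST by Cramer's rule applied to the minor for the separation
of `i` from `j` by the parents of `j` (`stepProperty_of_ciIdeal_le`). Safe gluing preserves it,
because shortest treks between the parts factor through `c` (`IsSafeGluing.stepProperty`).

With the step property, "lying on the shortest trek" behaves like betweenness in a tree-like
geometry (`Btw.trans`, `Btw.linear`, `Btw.glue`). In particular, whether `u` lies between `x` and
`y` depends only on the branches at `u` towards `x` and `y`. The pairs of branches that cannot be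
joined through `u` form a graph without induced path or cycle on four vertices (`passes_quadruple`),
so collections of joinable pairs with the same ends are connected by switches (`switch_connected`).
Carrying this out at one vertex after another connects any two products of shortest treks with equal
image by exchanges of ends at a common vertex (`moves_of_totalExp_eq`). Such an exchange at `u` is a
generator of `Q`, since `u` then d-separates the ends concerned (`Btw.not_isActive`).

Q ⊆ CI holds because the generators of `Q` are minors of sizes 1 and 2. CI ⊆ I is the global Markov
property of Gaussian models (`covariance_minor_eq_zero`), proved with the moral graph and the
concentration matrix. For I ⊆ ST, scale `L` by `t`: the lowest order term of each covariance is the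
shortest trek monomial, so the lowest weighted component of an element of I lies in ST. As ST ⊆ I is
already known, this component can be subtracted and the argument repeated. -/

theorem edge_irrefl (v : V) : ¬ G.edge v v := fun h => G.acyclic v (.single h)

theorem ne_of_edge {a b : V} (h : G.edge a b) : a ≠ b := by
  rintro rfl; exact edge_irrefl a h

theorem ne_of_transGen {a b : V} (h : Relation.TransGen G.edge a b) : a ≠ b := by
  rintro rfl; exact G.acyclic a h

/-! ### Directed paths -/

/-- `a :: l` lists the vertices of a directed path from `a` to `b`. -/
def IsDPath (G : DAG V) : V → List V → V → Prop
  | a, [], b => a = b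
  | a, x :: l, b => G.edge a x ∧ G.IsDPath x l b

@[simp] theorem isDPath_nil {a b : V} : G.IsDPath a [] b ↔ a = b := Iff.rfl

@[simp] theorem isDPath_cons {a b x : V} {l : List V} :
    G.IsDPath a (x :: l) b ↔ G.edge a x ∧ G.IsDPath x l b := Iff.rfl

theorem isDPath_iff {a b : V} {l : List V} :
    G.IsDPath a l b ↔ (a :: l).IsChain G.edge ∧ (a :: l).getLast (List.cons_ne_nil _ _) = b := by
  induction l generalizing a with
  | nil => simp
  | cons x l ih => simp [ih, List.isChain_cons_cons, and_assoc]

theorem isDPath_append {a b : V} {l₁ l₂ : List V} :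
    G.IsDPath a (l₁ ++ l₂) b ↔ ∃ x, G.IsDPath a l₁ x ∧ G.IsDPath x l₂ b := by
  induction l₁ generalizing a with
  | nil => simp
  | cons y l ih => simp [ih, and_assoc]

theorem IsDPath.append {a b c : V} {l₁ l₂ : List V} (h₁ : G.IsDPath a l₁ b)
    (h₂ : G.IsDPath b l₂ c) : G.IsDPath a (l₁ ++ l₂) c :=
  isDPath_append.2 ⟨b, h₁, h₂⟩

theorem IsDPath.reflTransGen {a b : V} {l : List V} (h : G.IsDPath a l b) :
    Relation.ReflTransGen G.edge a b := by
  induction l generalizing a with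
  | nil => rw [isDPath_nil.1 h]
  | cons x l ih => exact .head h.1 (ih h.2)

theorem IsDPath.mem_split {a b x : V} {l : List V} (h : G.IsDPath a l b) (hx : x ∈ a :: l) :
    ∃ l₁ l₂, l = l₁ ++ l₂ ∧ G.IsDPath a l₁ x ∧ G.IsDPath x l₂ b := by
  induction l generalizing a with
  | nil => exact ⟨[], [], rfl, by simpa [eq_comm] using hx, by simp_all⟩
  | cons y l ih =>
    rcases List.mem_cons.1 hx with rfl | hx
    · exact ⟨[], y :: l, rfl, rfl, h⟩
    · obtain ⟨l₁, l₂, rfl, h₁, h₂⟩ := ih h.2 hx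
      exact ⟨y :: l₁, l₂, rfl, ⟨h.1, h₁⟩, h₂⟩

theorem exists_isDPath {a b : V} (h : Relation.ReflTransGen G.edge a b) :
    ∃ l, G.IsDPath a l b := by
  obtain ⟨l, h₁, h₂⟩ := List.exists_isChain_cons_of_relationReflTransGen h
  exact ⟨l, isDPath_iff.2 ⟨h₁, h₂⟩⟩

theorem IsDPath.transGen_of_mem {a b x : V} {l : List V} (h : G.IsDPath a l b) (hx : x ∈ l) :
    Relation.TransGen G.edge a x := by
  cases l with
  | nil => simp at hx
  | cons y l =>
    obtain ⟨l₁, l₂, -, h₁, -⟩ := h.2.mem_split hx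
    exact .head' h.1 h₁.reflTransGen

theorem IsDPath.reflTransGen_of_mem {a b x : V} {l : List V} (h : G.IsDPath a l b)
    (hx : x ∈ a :: l) : Relation.ReflTransGen G.edge x b := by
  obtain ⟨l₁, l₂, -, -, h₂⟩ := h.mem_split hx
  exact h₂.reflTransGen

theorem IsDPath.end_mem {a b : V} {l : List V} (h : G.IsDPath a l b) : b ∈ a :: l := by
  induction l generalizing a with
  | nil => simp [isDPath_nil.1 h]
  | cons x l ih => exact List.mem_cons_of_mem _ (ih h.2)

theorem IsDPath.eq_nil {a : V} {l : List V} (h : G.IsDPath a l a) : l = [] := by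
  cases l with
  | nil => rfl
  | cons x l => exact absurd (.head' h.1 h.2.reflTransGen) (G.acyclic a)

theorem IsDPath.nodup {a b : V} {l : List V} (h : G.IsDPath a l b) : (a :: l).Nodup := by
  induction l generalizing a with
  | nil => simp
  | cons x l ih =>
    refine List.nodup_cons.2 ⟨fun hm => ?_, ih h.2⟩
    exact G.acyclic a (h.transGen_of_mem hm)

/-! ### Treks and common ancestors -/

theorem Trek.isDPath_left {i j : V} (T : G.Trek i j) : G.IsDPath T.top T.left i :=
  isDPath_iff.2 ⟨T.left_chain, T.left_end⟩

theorem Trek.isDPath_right {i j : V} (T : G.Trek i j) : G.IsDPath T.top T.right j :=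
  isDPath_iff.2 ⟨T.right_chain, T.right_end⟩

/-- A pair of directed paths from `t` to `i` and to `j` can be shortened to a trek. -/
theorem exists_trek_of_isDPath {i j t : V} {l r : List V} (hl : G.IsDPath t l i)
    (hr : G.IsDPath t r j) :
    ∃ T : G.Trek i j, T.length ≤ l.length + r.length ∧
      (l.length + r.length ≤ T.length → T.top = t ∧ T.left = l ∧ T.right = r) := by
  induction hn : l.length + r.length using Nat.strong_induction_on generalizing t l r with
  | _ n ih =>
  by_cases hd : List.Disjoint l r
  · have h1 := List.nodup_cons.1 hl.nodup
    have h2 := List.nodup_cons.1 hr.nodup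
    refine ⟨⟨t, l, r, (isDPath_iff.1 hl).1, (isDPath_iff.1 hr).1, (isDPath_iff.1 hl).2,
      (isDPath_iff.1 hr).2, ?_⟩, ?_, fun _ => ⟨rfl, rfl, rfl⟩⟩
    · simp only [List.nodup_cons, List.mem_append, not_or, List.nodup_append']
      exact ⟨⟨h1.1, h2.1⟩, h1.2, h2.2, hd⟩
    · exact hn.le
  -- The two paths meet again below the top. Restarting both at `x` removes a nonempty piece, so the
  -- resulting trek is strictly shorter and the equality clause is vacuous.
  · obtain ⟨x, hxl, hxr⟩ : ∃ x, x ∈ l ∧ x ∈ r := by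
      simpa [List.Disjoint] using hd
    obtain ⟨l₁, l₂, rfl, h₁, h₂⟩ := hl.mem_split (List.mem_cons_of_mem _ hxl)
    obtain ⟨r₁, r₂, rfl, h₁', h₂'⟩ := hr.mem_split (List.mem_cons_of_mem _ hxr)
    have hne : l₁ ≠ [] := by
      rintro rfl
      rw [isDPath_nil] at h₁
      subst h₁
      exact (List.nodup_cons.1 hl.nodup).1 hxl
    have : 0 < l₁.length := List.length_pos_iff.2 hne
    simp only [List.length_append] at hn
    obtain ⟨T, hT, -⟩ := ih (l₂.length + r₂.length) (by omega) h₂ h₂' rfl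
    exact ⟨T, by omega, fun h => by omega⟩

/-- `i` and `j` have a common ancestor (each vertex being an ancestor of itself). -/
def CommonAncestor (G : DAG V) (i j : V) : Prop :=
  ∃ t, Relation.ReflTransGen G.edge t i ∧ Relation.ReflTransGen G.edge t j

theorem CommonAncestor.symm {i j : V} (h : G.CommonAncestor i j) : G.CommonAncestor j i := by
  obtain ⟨t, h₁, h₂⟩ := h; exact ⟨t, h₂, h₁⟩

theorem commonAncestor_refl (i : V) : G.CommonAncestor i i := ⟨i, .refl, .refl⟩

theorem CommonAncestor.tail {i j k : V} (h : G.CommonAncestor i j) (e : G.edge j k) :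
    G.CommonAncestor i k := by
  obtain ⟨t, h₁, h₂⟩ := h; exact ⟨t, h₁, h₂.tail e⟩

theorem CommonAncestor.trans_right {i j k : V} (h : G.CommonAncestor i j)
    (e : Relation.ReflTransGen G.edge j k) : G.CommonAncestor i k := by
  obtain ⟨t, h₁, h₂⟩ := h; exact ⟨t, h₁, h₂.trans e⟩

theorem commonAncestor_of_edge {i j : V} (h : G.edge i j) : G.CommonAncestor i j :=
  (commonAncestor_refl i).tail h

theorem nonempty_trek_iff {i j : V} : Nonempty (G.Trek i j) ↔ G.CommonAncestor i j := by
  constructor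
  · rintro ⟨T⟩
    exact ⟨T.top, T.isDPath_left.reflTransGen, T.isDPath_right.reflTransGen⟩
  · rintro ⟨t, h₁, h₂⟩
    obtain ⟨l, hl⟩ := exists_isDPath h₁
    obtain ⟨r, hr⟩ := exists_isDPath h₂
    obtain ⟨T, -⟩ := exists_trek_of_isDPath hl hr
    exact ⟨T⟩

theorem exists_isShortest {i j : V} (h : G.CommonAncestor i j) :
    ∃ T : G.Trek i j, T.IsShortest := by
  have hne := nonempty_trek_iff.2 h
  exact ⟨Function.argmin Trek.length, fun T' => Function.argmin_le _ _⟩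

/-- A pair of directed paths that is not longer than a shortest trek is that trek. -/
theorem HasUniqueShortestTreks.eq_of_isDPath (hG : G.HasUniqueShortestTreks) {i j t : V}
    {l r : List V} (hl : G.IsDPath t l i) (hr : G.IsDPath t r j) {T : G.Trek i j}
    (hT : T.IsShortest) (h : l.length + r.length ≤ T.length) :
    T.top = t ∧ T.left = l ∧ T.right = r := by
  obtain ⟨T', h₁, h₂⟩ := exists_trek_of_isDPath hl hr
  have hT' : T'.IsShortest := fun T'' => (h₁.trans h).trans (hT T'')
  rw [(hG i j ⟨T⟩).unique hT hT']
  exact h₂ (h.trans (hT T'))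

theorem Trek.mem_verts_iff {i j x : V} {T : G.Trek i j} :
    x ∈ T.verts ↔ x ∈ T.leftSide ∨ x ∈ T.rightSide := by
  simp [verts, leftSide, rightSide]; tauto

/-! ### Monomials of treks -/

/-- The exponent vector of `edgeMonomial`. -/
def edgeExp : List V → (V ⊕ V × V →₀ ℕ)
  | [] => 0
  | [_] => 0
  | a :: b :: l => Finsupp.single (Sum.inr (a, b)) 1 + edgeExp (b :: l)

@[simp] theorem edgeExp_singleton (a : V) : edgeExp [a] = 0 := rfl

@[simp] theorem edgeExp_cons_cons (a b : V) (l : List V) :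
    edgeExp (a :: b :: l) = Finsupp.single (Sum.inr (a, b)) 1 + edgeExp (b :: l) := rfl

theorem edgeMonomial_cons_cons (a b : V) (l : List V) :
    edgeMonomial (a :: b :: l) = X (Sum.inr (a, b)) * edgeMonomial (b :: l) := by
  simp [edgeMonomial]

@[simp] theorem edgeMonomial_singleton (a : V) : edgeMonomial [a] = 1 := by
  simp [edgeMonomial]

theorem edgeMonomial_eq (l : List V) : edgeMonomial l = monomial (edgeExp l) 1 := by
  induction l with
  | nil => simp [edgeMonomial, edgeExp]
  | cons a l ih =>
    cases l with
    | nil => simp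
    | cons b l =>
      rw [edgeMonomial_cons_cons, ih, X, monomial_mul, one_mul, edgeExp_cons_cons]

theorem edgeExp_append {a b : V} {l₁ l₂ : List V} (h : G.IsDPath a l₁ b) :
    edgeExp (a :: (l₁ ++ l₂)) = edgeExp (a :: l₁) + edgeExp (b :: l₂) := by
  induction l₁ generalizing a with
  | nil => simp [isDPath_nil.1 h]
  | cons x l ih => simp [ih h.2, add_assoc]

theorem mem_of_edgeExp_ne_zero {a k m : V} {l : List V}
    (h : edgeExp (a :: l) (Sum.inr (k, m)) ≠ 0) : k ∈ a :: l ∧ m ∈ l := by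
  induction l generalizing a with
  | nil => simp at h
  | cons x l ih =>
    by_cases hx : (a, x) = (k, m)
    · simp_all
    · have := @ih x (by simpa [Finsupp.single_apply, hx] using h)
      simp_all

/-- The exponent vector of the monomial of a trek. -/
def Trek.exp {i j : V} (T : G.Trek i j) : V ⊕ V × V →₀ ℕ :=
  Finsupp.single (Sum.inl T.top) 1 + edgeExp T.leftSide + edgeExp T.rightSide

theorem Trek.monomial_eq {i j : V} (T : G.Trek i j) :
    T.monomial = MvPolynomial.monomial T.exp 1 := by
  rw [Trek.monomial, edgeMonomial_eq, edgeMonomial_eq, X, monomial_mul, monomial_mul, one_mul,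
    one_mul, Trek.exp]

theorem Trek.mem_of_exp_ne_zero {i j k m : V} {T : G.Trek i j}
    (h : T.exp (Sum.inr (k, m)) ≠ 0) :
    (k ∈ T.leftSide ∧ m ∈ T.left) ∨ (k ∈ T.rightSide ∧ m ∈ T.right) := by
  by_contra! hc
  apply h
  have h1 : edgeExp T.leftSide (Sum.inr (k, m)) = 0 := by
    by_contra h'; exact hc.1 (mem_of_edgeExp_ne_zero h').1 (mem_of_edgeExp_ne_zero h').2
  have h2 : edgeExp T.rightSide (Sum.inr (k, m)) = 0 := by
    by_contra h'; exact hc.2 (mem_of_edgeExp_ne_zero h').1 (mem_of_edgeExp_ne_zero h').2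
  simp [Trek.exp, h1, h2]

theorem shortestTrekMonomial_comm (i j : V) :
    G.shortestTrekMonomial s(i, j) = G.shortestTrekMonomial s(j, i) := by
  rw [Sym2.eq_swap]

theorem shortestTrekMonomial_of_not {i j : V} (h : ¬ G.CommonAncestor i j) :
    G.shortestTrekMonomial s(i, j) = 0 :=
  shortestTrekMonomial_of_isEmpty (not_nonempty_iff.1 fun h' => h (nonempty_trek_iff.1 h'))

namespace HasUniqueShortestTreks

variable (hG : G.HasUniqueShortestTreks)
include hG

theorem shortestTrekMonomial_ne_zero {i j : V} :
    G.shortestTrekMonomial s(i, j) ≠ 0 ↔ G.CommonAncestor i j := by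
  refine ⟨fun h => by_contra fun h' => h (shortestTrekMonomial_of_not h'), fun h => ?_⟩
  obtain ⟨T, hT⟩ := exists_isShortest h
  rw [shortestTrekMonomial_of_isShortest hG T hT, T.monomial_eq]
  simp

theorem shortestTrekMonomial_of_isDPath {i j t : V} {l r : List V} (hl : G.IsDPath t l i)
    (hr : G.IsDPath t r j) (h : ∀ T : G.Trek i j, l.length + r.length ≤ T.length) :
    G.shortestTrekMonomial s(i, j) =
      monomial (Finsupp.single (Sum.inl t) 1 + edgeExp (t :: l) + edgeExp (t :: r)) 1 := by
  obtain ⟨T, hT⟩ := exists_isShortest ⟨t, hl.reflTransGen, hr.reflTransGen⟩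
  obtain ⟨rfl, rfl, rfl⟩ := hG.eq_of_isDPath hl hr hT (h T)
  rw [shortestTrekMonomial_of_isShortest hG T hT, T.monomial_eq]
  rfl

theorem shortestTrekMonomial_self (v : V) :
    G.shortestTrekMonomial s(v, v) = X (Sum.inl v) := by
  rw [hG.shortestTrekMonomial_of_isDPath (t := v) (l := []) (r := []) rfl rfl (by simp)]
  simp [X]

theorem shortestTrekMonomial_edge {i j : V} (h : G.edge i j) :
    G.shortestTrekMonomial s(i, j) = X (Sum.inl i) * X (Sum.inr (i, j)) := by
  rw [hG.shortestTrekMonomial_of_isDPath (t := i) (l := []) (r := [j]) rfl ⟨h, rfl⟩]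
  · simp [X, monomial_mul]
  · intro T
    by_contra! hc
    have h0 : T.left = [] ∧ T.right = [] := by
      simp only [Trek.length, List.length_nil, List.length_cons] at hc
      constructor <;> apply List.length_eq_zero_iff.1 <;> omega
    have h1 := T.isDPath_left
    have h2 := T.isDPath_right
    rw [h0.1] at h1
    rw [h0.2] at h2
    exact ne_of_edge h (h1.symm.trans h2)

end HasUniqueShortestTreks

end DAG
end
-- d-separation by the parents and the step property
noncomputable section

/-- Without repetitions `y` occurs only in second place. Hence a collider at the second vertex of a
path has the first vertex as one of its two neighbours. -/
theorem List.Nodup.eq_of_infix_triple {α : Type*} {x y a b : α} {l : List α}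
    (h : (x :: y :: l).Nodup) (h' : [a, y, b] <:+: x :: y :: l) : a = x := by
  rcases List.infix_cons_iff.1 h' with h' | h'
  · exact (List.cons_prefix_cons.1 h').1
  · obtain ⟨s, t, hst⟩ := h'
    have hn := (List.nodup_cons.1 h).2
    cases s with
    | nil =>
      simp only [List.nil_append, List.cons_append, List.cons.injEq] at hst
      rw [← hst.2, List.nodup_cons] at hn
      simp at hn
    | cons z s =>
      simp only [List.cons_append, List.append_assoc, List.cons.injEq] at hst
      rw [← hst.2, List.nodup_cons] at hn
      simp at hn

/-- The determinant of a bordered matrix, in terms of the adjugate. -/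
theorem Matrix.det_mul_eq_of_det_bordered_eq_zero {R P : Type*} [CommRing R] [IsDomain R] [Fintype P]
    [DecidableEq P] (x : R) (u v : P → R) (N : Matrix P P R) (hN : N.det ≠ 0)
    (h : (Matrix.fromBlocks (Matrix.of fun _ _ : Unit => x) (Matrix.of fun _ q => u q)
      (Matrix.of fun p _ => v p) N).det = 0) :
    N.det * x = ∑ p, (Matrix.vecMul u N.adjugate) p * v p := by
  -- Block elimination: the left factor clears the upper right block, since `u * adj N * N = det N •
  -- u`. Taking determinants then leaves a product with the nonzero factor `det N`.
  have key : (Matrix.fromBlocks (Matrix.of fun _ _ : Unit => N.det)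
      (Matrix.of fun _ q => -(Matrix.vecMul u N.adjugate) q) 0 1) *
      (Matrix.fromBlocks (Matrix.of fun _ _ : Unit => x) (Matrix.of fun _ q => u q)
      (Matrix.of fun p _ => v p) N) =
      Matrix.fromBlocks
        (Matrix.of fun _ _ : Unit => N.det * x - ∑ p, (Matrix.vecMul u N.adjugate) p * v p) 0
        (Matrix.of fun p _ => v p) N := by
    rw [Matrix.fromBlocks_multiply]
    congr 1
    · ext a b
      simp [Matrix.mul_apply, sub_eq_add_neg]
    · ext a q
      have : (Matrix.vecMul (Matrix.vecMul u N.adjugate) N) q = N.det * u q := by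
        rw [Matrix.vecMul_vecMul, Matrix.adjugate_mul, Matrix.vecMul_smul, Matrix.vecMul_one]
        rfl
      simp only [Matrix.add_apply, Matrix.mul_apply, Matrix.of_apply, Finset.univ_unique, Finset.sum_singleton,
        neg_mul, Finset.sum_neg_distrib, Matrix.zero_apply]
      rw [← this, Matrix.vecMul, dotProduct]
      ring
    · simp
    · simp
  have hd := congrArg Matrix.det key
  rw [Matrix.det_mul, h, mul_zero, Matrix.det_fromBlocks_zero₁₂] at hd
  have := (mul_eq_zero.1 hd.symm).resolve_right hN
  rw [Matrix.det_unique] at this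
  exact sub_eq_zero.1 this

namespace DAG

variable {V : Type*} {G : DAG V}

/-! ### Paths -/

theorem isColliderOn_reverse {p : List V} {k : V} :
    G.IsColliderOn p.reverse k ↔ G.IsColliderOn p k := by
  have key : ∀ p : List V, G.IsColliderOn p k → G.IsColliderOn p.reverse k := by
    rintro p ⟨a, b, h, ha, hb⟩
    exact ⟨b, a, by simpa using List.reverse_infix.2 h, hb, ha⟩
  exact ⟨fun h => by simpa using key _ h, key p⟩

theorem isPath_reverse {p : List V} (h : G.IsPath p) : G.IsPath p.reverse := by
  refine ⟨by simpa using h.1, List.nodup_reverse.2 h.2.1, List.isChain_reverse.2 ?_⟩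
  exact h.2.2.imp fun _ _ h => h.symm

theorem DSeparates.symm {A B C : Finset V} (h : G.DSeparates C A B) : G.DSeparates C B A := by
  rintro p hp ⟨i, hi, hpi⟩ ⟨j, hj, hpj⟩
  obtain ⟨k, hk, h⟩ := h p.reverse (isPath_reverse hp) ⟨j, hj, by simpa using hpj⟩
    ⟨i, hi, by simpa using hpi⟩
  exact ⟨k, by simpa using hk, by simpa only [isColliderOn_reverse] using h⟩

/-- Following a path that starts with an edge out of its first vertex, one meets a descendant of
that vertex which is a collider or the end of the path. -/
theorem exists_descendant_of_edge {j q : V} {l : List V}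
    (h : (j :: q :: l).IsChain fun a b => G.edge a b ∨ G.edge b a) (e : G.edge j q) :
    ∃ k, Relation.TransGen G.edge j k ∧ ((j :: q :: l).getLast? = some k ∨
      G.IsColliderOn (j :: q :: l) k) := by
  induction l generalizing j q with
  | nil => exact ⟨q, .single e, Or.inl rfl⟩
  | cons x l ih =>
    rw [List.isChain_cons_cons] at h
    have h' := h.2
    rw [List.isChain_cons_cons] at h'
    by_cases hx : G.edge q x
    · obtain ⟨k, hk, hk'⟩ := ih h.2 hx
      refine ⟨k, .head e hk, ?_⟩
      rcases hk' with hk' | ⟨a, b, hab, hh⟩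
      · left; simpa using hk'
      · exact Or.inr ⟨a, b, List.infix_cons_iff.2 (Or.inr hab), hh⟩
    · exact ⟨q, .single e, Or.inr ⟨j, x, ⟨[], l, rfl⟩, e, h'.1.resolve_left hx⟩⟩

/-- The local Markov property: the parents of `j` separate it from its nondescendants. -/
theorem dSeparates_parents {i j : V} {S : Finset V} (hS : ∀ p, p ∈ S ↔ G.edge p j) (hij : i ≠ j)
    (hd : ¬ Relation.TransGen G.edge j i) : G.DSeparates S {i} {j} := by
  refine DSeparates.symm ?_
  rintro p hp ⟨j', hj', hpj⟩ ⟨i', hi', hpi⟩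
  rw [Finset.mem_singleton] at hi' hj'
  subst hi' hj'
  match p, hp, hpj, hpi with
  | [j''], _, hpj, hpi =>
    simp at hpj hpi
    exact absurd (hpi.symm.trans hpj) hij
  | j'' :: q :: l, hp, hpj, hpi =>
    obtain rfl : j'' = j' := by simpa using hpj
    have hadj := (List.isChain_cons_cons.1 hp.2.2).1
    by_cases hq : G.edge j'' q
    -- The path leaves `j` along an outgoing edge. If the descendant `k` is the end, then `i`
    -- descends from `j`, which is excluded; if it is a collider, acyclicity keeps all parents of
    -- `j` out of its descendants, so it blocks.
    · obtain ⟨k, hk, hk'⟩ := exists_descendant_of_edge hp.2.2 hq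
      rcases hk' with hk' | hk'
      · rw [hpi, Option.some.injEq] at hk'
        exact absurd (hk' ▸ hk) hd
      · refine ⟨k, ?_, Or.inr ⟨hk', fun m hm hmS => ?_⟩⟩
        · obtain ⟨a, b, hab, -⟩ := hk'
          exact hab.subset (by simp)
        · exact G.acyclic j'' ((hk.trans_left hm).tail ((hS m).1 hmS))
    -- Otherwise the second vertex is a parent of `j`, and it is no collider because its edge to `j`
    -- points away from it.
    · refine ⟨q, by simp, Or.inl ⟨?_, (hS q).2 (hadj.resolve_left hq)⟩⟩
      rintro ⟨a, b, hab, ha, -⟩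
      rw [hp.2.1.eq_of_infix_triple hab] at ha
      exact hq ha

/-! ### The step property -/

/-- Shortest treks into a nondescendant `j` of `i` enter `j` from a parent `s` of `j` that lies on
all shortest treks from `i` to the parents of `j`. -/
def StepProperty (G : DAG V) : Prop :=
  ∀ i j, i ≠ j → ¬ Relation.TransGen G.edge j i → G.CommonAncestor i j →
    ∃ s, G.edge s j ∧
      G.shortestTrekMonomial s(i, j) = G.shortestTrekMonomial s(i, s) * X (Sum.inr (s, j)) ∧
      ∀ p, G.edge p j → G.shortestTrekMonomial s(i, p) * X (Sum.inl s) =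
        G.shortestTrekMonomial s(i, s) * G.shortestTrekMonomial s(s, p)

open Classical in
/-- The substitution `λ_{p₀ j} = 1` and `λ_{kj} = 0` for `k ≠ p₀`. -/
def specializeInto (j p₀ : V) : MvPolynomial (V ⊕ V × V) ℂ →ₐ[ℂ] MvPolynomial (V ⊕ V × V) ℂ :=
  aeval (Sum.elim (fun v => X (Sum.inl v)) fun e =>
    if e.2 = j then if e.1 = p₀ then 1 else 0 else X (Sum.inr e))

theorem specializeInto_monomial (j p₀ : V) (E : V ⊕ V × V →₀ ℕ)
    (hE : ∀ k, E (Sum.inr (k, j)) = 0) :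
    specializeInto j p₀ (monomial E 1) = monomial E 1 := by
  rw [specializeInto, aeval_monomial, monomial_eq]
  simp only [map_one, one_mul]
  refine Finset.prod_congr rfl fun z hz => ?_
  rcases z with v | ⟨k, m⟩
  · rfl
  · have : m ≠ j := by
      rintro rfl
      exact (Finsupp.mem_support_iff.1 hz) (hE k)
    simp [this]

/-- The substitution that sends all `λ_{kl}` to `0`. -/
def specializeZero (V : Type*) :
    MvPolynomial (V ⊕ V × V) ℂ →ₐ[ℂ] MvPolynomial (V ⊕ V × V) ℂ :=
  aeval (Sum.elim (fun v => X (Sum.inl v)) fun _ => 0)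

/-- A trek between distinct vertices has an edge. So the matrix of shortest treks among the parents
specializes to a diagonal matrix, which shows that its determinant is nonzero. -/
theorem specializeZero_shortestTrekMonomial (hG : G.HasUniqueShortestTreks) {p q : V}
    (h : p ≠ q) : specializeZero V (G.shortestTrekMonomial s(p, q)) = 0 := by
  by_cases ht : G.CommonAncestor p q
  · obtain ⟨T, hT⟩ := exists_isShortest ht
    rw [shortestTrekMonomial_of_isShortest hG T hT, T.monomial_eq, specializeZero, aeval_monomial]
    have : ∃ e, T.exp (Sum.inr e) ≠ 0 := by
      have h1 := T.isDPath_left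
      have h2 := T.isDPath_right
      rcases hl : T.left with _ | ⟨x, l⟩
      · rcases hr : T.right with _ | ⟨y, r⟩
        · rw [hl] at h1
          rw [hr] at h2
          exact absurd (h1.symm.trans h2) h
        · exact ⟨(T.top, y), by simp [Trek.exp, Trek.rightSide, hr]⟩
      · exact ⟨(T.top, x), by simp [Trek.exp, Trek.leftSide, hl]⟩
    obtain ⟨e, he⟩ := this
    rw [map_one, one_mul]
    exact Finset.prod_eq_zero (Finsupp.mem_support_iff.2 he) (by simp [he])
  · rw [shortestTrekMonomial_of_not ht, map_zero]

/-- An edge into `j` on a trek would make `j` an ancestor of one of the two ends. Treks between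
nondescendants of `j` are therefore constants for the substitution. -/
theorem specializeInto_shortestTrekMonomial (hG : G.HasUniqueShortestTreks) {j p q : V} (p₀ : V)
    (hp : ¬ Relation.ReflTransGen G.edge j p) (hq : ¬ Relation.ReflTransGen G.edge j q) :
    specializeInto j p₀ (G.shortestTrekMonomial s(p, q)) = G.shortestTrekMonomial s(p, q) := by
  by_cases ht : G.CommonAncestor p q
  · obtain ⟨T, hT⟩ := exists_isShortest ht
    rw [shortestTrekMonomial_of_isShortest hG T hT, T.monomial_eq]
    refine specializeInto_monomial _ _ _ fun k => ?_
    by_contra hk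
    rcases Trek.mem_of_exp_ne_zero hk with ⟨-, h⟩ | ⟨-, h⟩
    · exact hp (T.isDPath_left.reflTransGen_of_mem (List.mem_cons_of_mem _ h))
    · exact hq (T.isDPath_right.reflTransGen_of_mem (List.mem_cons_of_mem _ h))
  · rw [shortestTrekMonomial_of_not ht, map_zero]

/-- The last edge of the shortest trek into a nondescendant. -/
theorem exists_shortestTrekMonomial_eq_mul (hG : G.HasUniqueShortestTreks) {i j : V}
    (hd : ¬ Relation.ReflTransGen G.edge j i) (ht : G.CommonAncestor i j) :
    ∃ s E, G.edge s j ∧ (∀ k, E (Sum.inr (k, j)) = 0) ∧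
      G.shortestTrekMonomial s(i, j) = monomial E 1 * X (Sum.inr (s, j)) := by
  obtain ⟨T, hT⟩ := exists_isShortest ht
  have h1 := T.isDPath_left
  have h2 := T.isDPath_right
  rcases List.eq_nil_or_concat T.right with hr | ⟨r, x, hr⟩
  · rw [hr] at h2
    exact absurd (h2 ▸ h1.reflTransGen) hd
  · rw [List.concat_eq_append] at hr
    rw [hr] at h2
    obtain ⟨s, hs, hsj, hx⟩ := isDPath_append.1 h2
    obtain rfl : x = j := hx
    refine ⟨s, Finsupp.single (Sum.inl T.top) 1 + edgeExp T.leftSide + edgeExp (T.top :: r), hsj,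
      fun k => ?_, ?_⟩
    · have hl : edgeExp T.leftSide (Sum.inr (k, x)) = 0 := by
        by_contra h'
        exact hd (h1.reflTransGen_of_mem (List.mem_cons_of_mem _ (mem_of_edgeExp_ne_zero h').2))
      have hr' : edgeExp (T.top :: r) (Sum.inr (k, x)) = 0 := by
        by_contra h'
        exact G.acyclic x (.tail' (hs.reflTransGen_of_mem
          (List.mem_cons_of_mem _ (mem_of_edgeExp_ne_zero h').2)) hsj)
      simp [hl, hr']
    · rw [shortestTrekMonomial_of_isShortest hG T hT, T.monomial_eq, X, monomial_mul, one_mul,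
        Trek.exp, Trek.rightSide, hr, edgeExp_append hs]
      simp [add_assoc]

theorem shortestTrekMap_X (z : Sym2 V) : G.shortestTrekMap (X z) = G.shortestTrekMonomial z := by
  simp [shortestTrekMap]

/-- Let `S` be the set of parents of `j`. The minor with rows `i, S` and columns `j, S` is killed by
`ψ`, so Cramer's rule gives `det N * ψ(i,j) = ∑ p, Y p * a_p * λ_{pj}` with `N` the matrix of `ψ` on
`S` and `Y = u * adj N`. No `λ_{pj}` occurs in `N` or `Y`, while `ψ(i,j)` is a single monomial
containing exactly one of them, say `λ_{sj}`. Comparing coefficients leaves only `Y s`, and `Y * N =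
det N • u` then says that the row `u` is proportional to row `s` of `N`. -/
theorem stepProperty_of_ciIdeal_le [DecidableEq V] [Finite V] (hG : G.HasUniqueShortestTreks)
    (h : G.ciIdeal ≤ G.shortestTrekIdeal) : G.StepProperty := by
  classical
  cases nonempty_fintype V
  intro i j hij hd ht
  by_cases he : G.edge i j
  -- A parent `i` of `j` lies in the separating set, so this case is treated apart, with `s = i`.
  · refine ⟨i, he, ?_, fun p _ => ?_⟩
    · rw [hG.shortestTrekMonomial_edge he, hG.shortestTrekMonomial_self]
    · rw [hG.shortestTrekMonomial_self, mul_comm]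
  have hd' : ¬ Relation.ReflTransGen G.edge j i := by
    rw [Relation.reflTransGen_iff_eq_or_transGen]
    exact fun h' => h'.elim hij hd
  let S : Finset V := Finset.univ.filter (G.edge · j)
  have hS : ∀ p, p ∈ S ↔ G.edge p j := by simp [S]
  have hpar : ∀ p, G.edge p j → ¬ Relation.ReflTransGen G.edge j p := fun p hp h' =>
    G.acyclic j (.tail' h' hp)
  let f : V → (Unit ⊕ S) → V := fun x => Sum.elim (fun _ => x) fun p => p.1
  have hf : ∀ x, x ∉ S → Function.Injective (f x) := by
    rintro x hx (⟨⟩ | p) (⟨⟩ | q) hpq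
    · rfl
    · exact absurd (show x = q.1 from hpq) fun h' => hx (h' ▸ q.2)
    · exact absurd (show p.1 = x from hpq) fun h' => hx (h' ▸ p.2)
    · exact congrArg Sum.inr (Subtype.ext hpq)
  have hcard : Fintype.card (Fin (S.card + 1)) = Fintype.card (Unit ⊕ S) := by
    simp [add_comm]
  let e := Fintype.equivOfCardEq hcard
  have hiS : i ∉ S := fun h' => he ((hS i).1 h')
  have hjS : j ∉ S := fun h' => edge_irrefl j ((hS j).1 h')
  have hfm : ∀ x a, f x a ∈ ({x} ∪ S : Finset V) := by
    rintro x (⟨⟩ | p)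
    · simp [f]
    · simp [f]
  have hmem : ((sigmaMatrix V).submatrix (f i ∘ e) (f j ∘ e)).det ∈ G.ciIdeal :=
    Ideal.subset_span ⟨{i}, {j}, S, by simpa using hij, by simpa using hiS, by simpa using hjS,
      dSeparates_parents hS hij hd, f i ∘ e, f j ∘ e, (hf i hiS).comp e.injective,
      (hf j hjS).comp e.injective, fun a => hfm i _, fun a => hfm j _, rfl⟩
  have hdet := h hmem
  rw [shortestTrekIdeal, RingHom.mem_ker] at hdet
  let N : Matrix S S (MvPolynomial (V ⊕ V × V) ℂ) :=
    Matrix.of fun p q => G.shortestTrekMonomial s(p.1, q.1)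
  let u : S → MvPolynomial (V ⊕ V × V) ℂ := fun q => G.shortestTrekMonomial s(i, q.1)
  let v : S → MvPolynomial (V ⊕ V × V) ℂ := fun p => G.shortestTrekMonomial s(p.1, j)
  have hdet' : (Matrix.fromBlocks (Matrix.of fun _ _ : Unit => G.shortestTrekMonomial s(i, j))
      (Matrix.of fun _ q => u q) (Matrix.of fun p _ => v p) N).det = 0 := by
    rw [← hdet, AlgHom.map_det, ← Matrix.submatrix_submatrix,
      ← Matrix.det_submatrix_equiv_self e]
    congr 1
    ext a b : 1
    simp only [Matrix.submatrix_apply, AlgHom.mapMatrix_apply, Matrix.map_apply]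
    rcases e a with ⟨⟩ | p <;> rcases e b with ⟨⟩ | q <;>
      simp [f, u, v, N, sigmaMatrix, shortestTrekMap_X]
  have hN : N.det ≠ 0 := by
    intro h0
    have h1 := congrArg (specializeZero V) h0
    rw [AlgHom.map_det, map_zero] at h1
    have : (specializeZero V).mapMatrix N = Matrix.diagonal fun p : S => X (Sum.inl p.1) := by
      ext p q : 1
      by_cases hpq : p = q
      · subst hpq
        simp [N, hG.shortestTrekMonomial_self, specializeZero]
      · simp only [N, AlgHom.mapMatrix_apply, Matrix.map_apply, Matrix.of_apply,
          Matrix.diagonal_apply_ne _ hpq,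
          specializeZero_shortestTrekMonomial hG (fun h' => hpq (Subtype.ext h'))]
    rw [this, Matrix.det_diagonal] at h1
    exact (Finset.prod_ne_zero_iff.2 fun p _ => X_ne_zero _) h1
  have eq1 := Matrix.det_mul_eq_of_det_bordered_eq_zero _ u v N hN hdet'
  set Y := Matrix.vecMul u N.adjugate with hY
  have eq2 : ∀ q, N.det * u q = ∑ p, Y p * N p q := by
    intro q
    have : (Matrix.vecMul Y N) q = N.det * u q := by
      rw [hY, Matrix.vecMul_vecMul, Matrix.adjugate_mul, Matrix.vecMul_smul, Matrix.vecMul_one]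
      rfl
    rw [← this]
    rfl
  have hNε : ∀ p₀, (specializeInto j p₀).mapMatrix N = N := fun p₀ => by
    ext p q : 1
    exact specializeInto_shortestTrekMonomial hG p₀ (hpar _ ((hS _).1 p.2))
      (hpar _ ((hS _).1 q.2))
  have hdε : ∀ p₀, specializeInto j p₀ N.det = N.det := fun p₀ => by
    rw [AlgHom.map_det, hNε]
  have hYε : ∀ p₀ p, specializeInto j p₀ (Y p) = Y p := fun p₀ p => by
    simp only [hY, Matrix.vecMul, dotProduct, map_sum, map_mul]
    refine Finset.sum_congr rfl fun q _ => ?_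
    congr 1
    · exact specializeInto_shortestTrekMonomial hG p₀ hd' (hpar _ ((hS _).1 q.2))
    · have := congrFun (congrFun ((specializeInto j p₀).map_adjugate N) q) p
      rw [hNε] at this
      exact this
  obtain ⟨s, E, hsj, hE, hμ⟩ := exists_shortestTrekMonomial_eq_mul hG hd' ht
  have hsp : ∀ p₀ p : V, specializeInto j p₀ (X (Sum.inr (p, j))) = if p = p₀ then 1 else 0 := by
    intro p₀ p
    simp [specializeInto]
  have hspl : ∀ p₀ p : V, specializeInto j p₀ (X (Sum.inl p)) = X (Sum.inl p) := by
    intro p₀ p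
    simp [specializeInto]
  -- The coefficient of `λ_{p₀ j}` is extracted by setting it to `1` and the other `λ_{kj}` to `0`.
  have eq3 : ∀ p₀ : S, Y p₀ * X (Sum.inl p₀.1) =
      if s = p₀.1 then N.det * monomial E 1 else 0 := by
    intro p₀
    have := congrArg (specializeInto j p₀.1) eq1
    rw [hμ, map_mul, map_mul, hdε, specializeInto_monomial _ _ _ hE, hsp, map_sum] at this
    rw [Finset.sum_eq_single p₀] at this
    · rw [map_mul, hYε] at this
      simp only [v, hG.shortestTrekMonomial_edge ((hS _).1 p₀.2), map_mul, hsp, hspl] at this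
      simp only [if_true, mul_one] at this
      rw [← this]
      split_ifs <;> simp
    · intro p _ hp
      have hne : p.1 ≠ p₀.1 := fun h' => hp (Subtype.ext h')
      rw [map_mul]
      simp [v, hG.shortestTrekMonomial_edge ((hS _).1 p.2), hsp, hne]
    · simp
  let s' : S := ⟨s, (hS s).2 hsj⟩
  have hYs : Y s' * X (Sum.inl s) = N.det * monomial E 1 := (eq3 s').trans (if_pos rfl)
  have hY0 : ∀ p, p ≠ s' → Y p = 0 := by
    intro p hp
    have hne : s ≠ p.1 := fun h' => hp (Subtype.ext h'.symm)
    have := eq3 p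
    rw [if_neg hne] at this
    exact (mul_eq_zero.1 this).resolve_right (X_ne_zero _)
  have eq4 : ∀ q : S, u q * X (Sum.inl s) = monomial E 1 * N s' q := by
    intro q
    have h2 := eq2 q
    rw [Finset.sum_eq_single s' (fun p _ hp => by rw [hY0 p hp, zero_mul]) (by simp)] at h2
    apply mul_left_cancel₀ hN
    rw [← mul_assoc, h2, ← mul_assoc, ← hYs]
    ring
  -- The unknown cofactor `E` is identified by taking `q = s`, where `N s s = a_s`.
  have hE' : monomial E (1 : ℂ) = G.shortestTrekMonomial s(i, s) := by
    have h1 : N s' s' = X (Sum.inl s) := hG.shortestTrekMonomial_self s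
    have h2 := eq4 s'
    rw [h1] at h2
    exact (mul_right_cancel₀ (X_ne_zero _) h2).symm
  refine ⟨s, hsj, by rw [hμ, hE'], fun p hp => ?_⟩
  rw [← hE']
  exact eq4 ⟨p, (hS p).2 hp⟩

end DAG
end
-- The geometry of shortest treks derived from the step property
noncomputable section

namespace DAG

variable {V : Type*} {G : DAG V}

/-- Exponent vectors `e i j` of the shortest treks of a graph with the step property, and an
injective rank function that increases along the edges. -/
structure TrekExponents (G : DAG V) where
  rank : V → ℕ
  rank_injective : Function.Injective rank
  rank_lt : ∀ {i j}, G.edge i j → rank i < rank j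
  exp : V → V → (V ⊕ V × V →₀ ℕ)
  exp_comm : ∀ i j, exp i j = exp j i
  exp_self : ∀ v, exp v v = Finsupp.single (Sum.inl v) 1
  step : ∀ {i j}, rank i < rank j → G.CommonAncestor i j → ∃ s, G.edge s j ∧
    G.CommonAncestor i s ∧ exp i j = exp i s + Finsupp.single (Sum.inr (s, j)) 1 ∧
    ∀ p, G.edge p j → (G.CommonAncestor i p ↔ G.CommonAncestor s p) ∧
      (G.CommonAncestor i p → exp i p + Finsupp.single (Sum.inl s) 1 = exp i s + exp s p)

namespace TrekExponents

variable (E : TrekExponents G) {i j s v w x y p q u : V}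

/-- The length of the shortest trek plus one. -/
def deg (i j : V) : ℕ := (E.exp i j).degree

theorem deg_comm (i j : V) : E.deg i j = E.deg j i := by rw [deg, exp_comm, deg]

@[simp] theorem deg_self (v : V) : E.deg v v = 1 := by simp [deg, exp_self]

/-- `s` precedes `j` on the shortest trek from `i` to `j`, where `j` has the larger rank. -/
structure Pred (i j s : V) : Prop where
  lt : E.rank i < E.rank j
  edge : G.edge s j
  anc : G.CommonAncestor i s
  exp_eq : E.exp i j = E.exp i s + Finsupp.single (Sum.inr (s, j)) 1
  iff : ∀ p, G.edge p j → (G.CommonAncestor i p ↔ G.CommonAncestor s p)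
  parent : ∀ p, G.edge p j → G.CommonAncestor i p →
    E.exp i p + Finsupp.single (Sum.inl s) 1 = E.exp i s + E.exp s p

theorem exists_pred (h : E.rank i < E.rank j) (ht : G.CommonAncestor i j) :
    ∃ s, E.Pred i j s := by
  obtain ⟨s, h1, h2, h3, h4⟩ := E.step h ht
  exact ⟨s, h, h1, h2, h3, fun p hp => (h4 p hp).1, fun p hp => (h4 p hp).2⟩

/-- Induction along the shortest treks. -/
theorem induction_pair {P : V → V → Prop} (hsymm : ∀ i j, P i j → P j i) (hself : ∀ i, P i i)
    (hstep : ∀ i j s, E.Pred i j s → P i s → P i j) (i j : V) (h : G.CommonAncestor i j) :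
    P i j := by
  induction hn : E.rank i + E.rank j using Nat.strong_induction_on generalizing i j with
  | _ n ih =>
  rcases lt_trichotomy (E.rank i) (E.rank j) with hlt | heq | hlt
  · obtain ⟨s, hs⟩ := E.exists_pred hlt h
    exact hstep i j s hs (ih _ (by have := E.rank_lt hs.edge; omega) i s hs.anc rfl)
  · rw [E.rank_injective heq]; exact hself j
  · obtain ⟨s, hs⟩ := E.exists_pred hlt h.symm
    exact hsymm _ _ (hstep j i s hs (ih _ (by have := E.rank_lt hs.edge; omega) j s hs.anc rfl))

theorem deg_pos (h : G.CommonAncestor i j) : 1 ≤ E.deg i j := by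
  refine E.induction_pair (P := fun i j => 1 ≤ E.deg i j) (fun i j h => by rwa [deg_comm])
    (by simp) (fun i j s hs h => ?_) i j h
  rw [deg, hs.exp_eq, map_add]
  exact h.trans (Nat.le_add_right _ _)

theorem Pred.deg_eq {E : TrekExponents G} (h : E.Pred i j s) : E.deg i j = E.deg i s + 1 := by
  rw [deg, h.exp_eq, map_add, Finsupp.degree_single, deg]

theorem eq_of_deg_le_one (h : G.CommonAncestor i j) (hd : E.deg i j ≤ 1) : i = j := by
  revert hd
  refine E.induction_pair (P := fun i j => E.deg i j ≤ 1 → i = j)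
    (fun i j h h' => (h (by rwa [deg_comm])).symm) (fun _ _ => rfl) (fun i j s hs _ h => ?_) i j h
  have := E.deg_pos hs.anc
  rw [hs.deg_eq] at h
  omega

/-- The recursion adds an edge only into the end of larger rank, so no edge of a shortest trek
points to a vertex ranked above both ends. -/
theorem of_exp_ne_zero (h : G.CommonAncestor i j) (hd : E.exp i j (Sum.inr (p, q)) ≠ 0) :
    G.edge p q ∧ (E.rank q ≤ E.rank i ∨ E.rank q ≤ E.rank j) := by
  revert hd
  refine E.induction_pair (P := fun i j => E.exp i j (Sum.inr (p, q)) ≠ 0 →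
    G.edge p q ∧ (E.rank q ≤ E.rank i ∨ E.rank q ≤ E.rank j))
    (fun i j h h' => by rw [exp_comm] at h'; have := h h'; tauto)
    (fun i h => by simp [exp_self] at h) (fun i j s hs ih h => ?_) i j h
  have h2 := E.rank_lt hs.edge
  rw [hs.exp_eq, Finsupp.add_apply] at h
  by_cases hz : E.exp i s (Sum.inr (p, q)) = 0
  · have : (s, j) = (p, q) := by
      by_contra hne
      simp [hz, hne] at h
    simp only [Prod.mk.injEq] at this
    obtain ⟨rfl, rfl⟩ := this
    exact ⟨hs.edge, Or.inr le_rfl⟩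
  · obtain ⟨h3, h4⟩ := ih hz
    exact ⟨h3, h4.imp id fun h => by omega⟩

theorem exp_into_eq_zero (h : G.CommonAncestor i j) (hi : E.rank i < E.rank q)
    (hj : E.rank j < E.rank q) : E.exp i j (Sum.inr (p, q)) = 0 := by
  by_contra hc
  have := (E.of_exp_ne_zero h hc).2
  omega

/-- The last edge is the only one that enters `j`, since the rest of the trek has both ends ranked
below `j`. Thus the exponent vector determines the predecessor; later arguments identify
predecessors by comparing these coordinates. -/
theorem Pred.exp_into {E : TrekExponents G} (h : E.Pred i j s) (p : V) :
    E.exp i j (Sum.inr (p, j)) = Finsupp.single s 1 p := by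
  rw [h.exp_eq, Finsupp.add_apply, E.exp_into_eq_zero h.anc h.lt (E.rank_lt h.edge), zero_add]
  by_cases hp : p = s
  · simp [hp]
  · rw [Finsupp.single_eq_of_ne hp, Finsupp.single_eq_of_ne (by simpa using hp)]

/-! ### Betweenness -/

/-- `v` lies on the shortest trek between `i` and `j`. -/
structure Btw (i v j : V) : Prop where
  left : G.CommonAncestor i v
  right : G.CommonAncestor v j
  anc : G.CommonAncestor i j
  exp_eq : E.exp i j + Finsupp.single (Sum.inl v) 1 = E.exp i v + E.exp v j

variable {E}

theorem Btw.symm (h : E.Btw i v j) : E.Btw j v i :=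
  ⟨h.right.symm, h.left.symm, h.anc.symm, by
    rw [E.exp_comm j i, E.exp_comm j v, E.exp_comm v i, h.exp_eq, add_comm]⟩

theorem btw_left (h : G.CommonAncestor i j) : E.Btw i i j :=
  ⟨commonAncestor_refl i, h, h, by rw [E.exp_self, add_comm]⟩

theorem btw_right (h : G.CommonAncestor i j) : E.Btw i j j :=
  ⟨h, commonAncestor_refl j, h, by rw [E.exp_self]⟩

/-- As `deg` is one more than the length, this is additivity of distance. With `eq_of_deg_le_one` it
turns coincidences of lengths into equalities of vertices. -/
theorem Btw.deg_eq (h : E.Btw i v j) : E.deg i j + 1 = E.deg i v + E.deg v j := by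
  have := congrArg Finsupp.degree h.exp_eq
  simpa [deg] using this

theorem Btw.eq_of_btw (h : E.Btw i s v) (h' : E.Btw i v s) : s = v := by
  have h1 := h.deg_eq
  have h2 := h'.deg_eq
  rw [E.deg_comm v s] at h2
  exact E.eq_of_deg_le_one h.right (by omega)

theorem Btw.eq_of_self (h : E.Btw i v i) : v = i := by
  have h1 := h.deg_eq
  rw [E.deg_comm v i, deg_self] at h1
  exact (E.eq_of_deg_le_one h.left (by omega)).symm

/-- What has to be seen is that the edge `s → j` is itself the shortest trek. The predecessor of `j`
seen from its parent `s` lies between `s` and `s` by the parent condition, hence is `s`. -/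
theorem Pred.btw (h : E.Pred i j s) : E.Btw i s j := by
  have ht := h.anc.tail h.edge
  refine ⟨h.anc, commonAncestor_of_edge h.edge, ht, ?_⟩
  obtain ⟨s', hs'⟩ := E.exists_pred (E.rank_lt h.edge) (commonAncestor_of_edge h.edge)
  have h1 : E.Btw s s' s := ⟨hs'.anc, hs'.anc.symm, commonAncestor_refl s,
    hs'.parent s h.edge (commonAncestor_refl s)⟩
  obtain rfl := h1.eq_of_self
  rw [hs'.exp_eq, h.exp_eq, E.exp_self]
  abel

theorem Pred.parent_btw (h : E.Pred i j s) (hp : G.edge p j) (ht : G.CommonAncestor i p) :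
    E.Btw i s p :=
  ⟨h.anc, (h.iff p hp).1 ht, ht, h.parent p hp ht⟩

/-- If `v` outranked `j`, the trek from `i` to `v` would end with an edge into `v`; the exponent of
this edge is zero on the trek from `i` to `j`, against additivity. -/
theorem Btw.rank_lt_of_lt (h : E.Btw i v j) (hlt : E.rank i < E.rank j) (hne : v ≠ j) :
    E.rank v < E.rank j := by
  by_contra hc
  have hv : E.rank j < E.rank v :=
    lt_of_le_of_ne (not_lt.1 hc) fun h' => hne (E.rank_injective h').symm
  obtain ⟨s, hs⟩ := E.exists_pred (hlt.trans hv) h.left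
  have h1 := congrArg (fun f => f (Sum.inr (s, v))) h.exp_eq
  simp [hs.exp_into, E.exp_into_eq_zero h.anc (hlt.trans hv) hv] at h1
  omega

theorem Btw.pred (h : E.Btw i v j) (hs : E.Pred i j s) (hne : v ≠ j) : E.Pred v j s := by
  have hv := h.rank_lt_of_lt hs.lt hne
  obtain ⟨s', hs'⟩ := E.exists_pred hv h.right
  have h1 := congrArg (fun f => f (Sum.inr (s, j))) h.exp_eq
  simp only [Finsupp.add_apply, hs.exp_into, hs'.exp_into,
    E.exp_into_eq_zero h.left hs.lt hv] at h1
  obtain rfl : s' = s := by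
    by_contra hne'
    simp [hne'] at h1
  exact hs'

theorem Btw.btw_pred (h : E.Btw i v j) (hs : E.Pred i j s) (hne : v ≠ j) : E.Btw i v s := by
  have hs' := h.pred hs hne
  refine ⟨h.left, hs'.anc, hs.anc, ?_⟩
  have := h.exp_eq
  rw [hs.exp_eq, hs'.exp_eq, add_right_comm, ← add_assoc] at this
  exact add_right_cancel this

theorem Btw.of_pred (h : E.Btw i v s) (hs : E.Pred i j s) (hs' : E.Pred v j s) : E.Btw i v j := by
  refine ⟨h.left, hs'.btw.anc, hs.btw.anc, ?_⟩
  rw [hs.exp_eq, hs'.exp_eq, add_right_comm, h.exp_eq, add_assoc]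

/-- The second claim follows from the first by cancelling exponents. For the first, the end of
larger rank is replaced by its predecessor; this is immediate for `j`, but for `i` it must be shown
that the predecessor seen from `j` is also the one seen from `w`. -/
theorem Btw.trans (h : E.Btw i v j) (h' : E.Btw v w j) : E.Btw i v w ∧ E.Btw i w j := by
  suffices hmain : E.Btw i v w by
    refine ⟨hmain, hmain.anc, h'.right, h.anc, ?_⟩
    have h1 := h.exp_eq
    have h2 := h'.exp_eq
    have h3 := hmain.exp_eq
    apply add_right_cancel (b := Finsupp.single (Sum.inl v) 1)
    calc _ = E.exp i j + Finsupp.single (Sum.inl v) 1 + Finsupp.single (Sum.inl w) 1 := by abel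
      _ = E.exp i v + (E.exp v j + Finsupp.single (Sum.inl w) 1) := by rw [h1]; abel
      _ = (E.exp i v + E.exp v w) + E.exp w j := by rw [h2]; abel
      _ = _ := by rw [← h3]; abel
  induction hn : E.rank i + E.rank j using Nat.strong_induction_on generalizing i v w j with
  | _ n ih =>
  rcases lt_trichotomy (E.rank i) (E.rank j) with hlt | heq | hlt
  · by_cases hw : w = j
    · subst hw; exact h
    by_cases hv : v = j
    · subst hv; rw [h'.eq_of_self]; exact btw_right h.left
    obtain ⟨s, hs⟩ := E.exists_pred hlt h.anc
    exact ih _ (by have := E.rank_lt hs.edge; omega) (h.btw_pred hs hv)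
      (h'.btw_pred (h.pred hs hv) hw) rfl
  · obtain rfl := E.rank_injective heq
    obtain rfl := h.eq_of_self
    exact btw_left h'.left
  · by_cases hv : v = i
    · subst hv; exact btw_left h'.left
    obtain ⟨s, hs⟩ := E.exists_pred hlt h.anc.symm
    have hrs := E.rank_lt hs.edge
    have h1 := (h.symm.btw_pred hs hv).symm
    have hvs := h.symm.pred hs hv
    have h2 := ih _ (by omega) h1 h' rfl
    have hsw : E.Btw s w j := by
      refine ⟨h2.anc, h'.right, h1.anc, ?_⟩
      have e1 := h1.exp_eq
      have e2 := h'.exp_eq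
      have e3 := h2.exp_eq
      apply add_right_cancel (b := Finsupp.single (Sum.inl v) 1)
      calc _ = E.exp s j + Finsupp.single (Sum.inl v) 1 + Finsupp.single (Sum.inl w) 1 := by abel
        _ = E.exp s v + (E.exp v j + Finsupp.single (Sum.inl w) 1) := by rw [e1]; abel
        _ = (E.exp s v + E.exp v w) + E.exp w j := by rw [e2]; abel
        _ = _ := by rw [← e3]; abel
    have hrw : E.rank w < E.rank i := by
      rcases eq_or_ne w j with rfl | hwj
      · exact hlt
      rcases lt_trichotomy (E.rank v) (E.rank j) with hl | he | hl
      · exact (h'.rank_lt_of_lt hl hwj).trans hlt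
      · obtain rfl := E.rank_injective he
        exact absurd h'.eq_of_self hwj
      · rcases eq_or_ne w v with rfl | hwv
        · exact hvs.lt
        · exact (h'.symm.rank_lt_of_lt hl hwv).trans hvs.lt
    -- Let `t` be the predecessor of `i` seen from `w`. The parent condition for `t` and induction
    -- put `t` between `j` and `s`, while the parent condition for `s` puts `s` between `j` and `t`;
    -- hence `s = t`.
    obtain ⟨t, ht⟩ := E.exists_pred hrw (hsw.left.symm.tail hs.edge)
    have h3 : E.Btw w t s := ht.parent_btw hs.edge hsw.left.symm
    have h4 : E.Btw j w t := ih _ (by omega) hsw.symm h3 rfl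
    have h4' : E.Btw j t s := by
      refine ⟨h4.anc, h3.right, hsw.anc.symm, ?_⟩
      have e1 := hsw.symm.exp_eq
      have e2 := h3.exp_eq
      have e3 := h4.exp_eq
      apply add_right_cancel (b := Finsupp.single (Sum.inl w) 1)
      calc _ = E.exp j s + Finsupp.single (Sum.inl w) 1 + Finsupp.single (Sum.inl t) 1 := by abel
        _ = E.exp j w + (E.exp w s + Finsupp.single (Sum.inl t) 1) := by rw [e1]; abel
        _ = (E.exp j w + E.exp w t) + E.exp t s := by rw [e2]; abel
        _ = _ := by rw [← e3]; abel
    have h5 : E.Btw j s t := hs.parent_btw ht.edge h4'.left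
    obtain rfl := h5.eq_of_btw h4'
    exact (h2.symm.of_pred ht hvs).symm

/-- The vertices of one trek are linearly ordered. The end of larger rank can be cut off unless one
of the two vertices is an end. -/
theorem Btw.linear (h : E.Btw x u y) (h' : E.Btw x p y) : E.Btw x p u ∨ E.Btw u p y := by
  induction hn : E.rank x + E.rank y using Nat.strong_induction_on generalizing x y with
  | _ n ih =>
  by_cases huy : u = y
  · subst huy; exact Or.inl h'
  by_cases hpy : p = y
  · subst hpy; exact Or.inr (btw_right h.right)
  by_cases hux : u = x
  · subst hux; exact Or.inr h'
  by_cases hpx : p = x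
  · subst hpx; exact Or.inl (btw_left h.left)
  rcases lt_trichotomy (E.rank x) (E.rank y) with hlt | heq | hlt
  · obtain ⟨s, hs⟩ := E.exists_pred hlt h.anc
    refine (ih _ (by have := E.rank_lt hs.edge; omega) (h.btw_pred hs huy)
      (h'.btw_pred hs hpy) rfl).imp id fun h3 => ?_
    exact h3.of_pred (h.pred hs huy) (h'.pred hs hpy)
  · obtain rfl := E.rank_injective heq
    exact absurd h.eq_of_self hux
  · obtain ⟨s, hs⟩ := E.exists_pred hlt h.anc.symm
    refine (ih _ (by have := E.rank_lt hs.edge; omega) (h.symm.btw_pred hs hux).symm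
      (h'.symm.btw_pred hs hpx).symm rfl).imp (fun h3 => ?_) id
    exact (h3.symm.of_pred (h.symm.pred hs hux) (h'.symm.pred hs hpx)).symm

/-- If `t` is the predecessor of `j` seen from `v`, then the parent conditions place `s` before `t`
and `t` before `s` on treks from `i`. -/
theorem Pred.pred_of_btw (h : E.Pred i j s) (hv : E.Btw i v s) : E.Pred v j s := by
  have hrv : E.rank v < E.rank j := by
    have hsj := E.rank_lt h.edge
    rcases eq_or_ne v s with rfl | hvs
    · exact hsj
    rcases lt_trichotomy (E.rank i) (E.rank s) with hl | he | hl
    · exact (hv.rank_lt_of_lt hl hvs).trans hsj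
    · obtain rfl := E.rank_injective he
      exact absurd hv.eq_of_self hvs
    · rcases eq_or_ne v i with rfl | hvi
      · exact h.lt
      · exact (hv.symm.rank_lt_of_lt hl hvi).trans h.lt
  obtain ⟨t, ht⟩ := E.exists_pred hrv (hv.right.tail h.edge)
  have h3 := ht.parent_btw h.edge hv.right
  have h4 := (hv.trans h3).2
  obtain rfl := (h.parent_btw ht.edge h4.left).eq_of_btw h4
  exact ht

/-- Shortest treks that overlap in a nontrivial piece fit together, so being shortest is a local
condition. The assumption `u ≠ v` is essential: for `u = v` both hypotheses are empty apart from the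
existence of treks. -/
theorem Btw.glue (h : E.Btw x u v) (h' : E.Btw u v y) (hne : u ≠ v) :
    E.Btw x u y ∧ E.Btw x v y := by
  suffices hmain : ∀ n x u v y, E.rank x + E.rank y = n → E.rank x < E.rank y → E.Btw x u v →
      E.Btw u v y → u ≠ v → E.Btw x u y by
    rcases lt_trichotomy (E.rank x) (E.rank y) with hlt | heq | hlt
    · have := hmain _ x u v y rfl hlt h h' hne
      exact ⟨this, (this.trans h').2⟩
    · obtain rfl := E.rank_injective heq
      exact absurd (h.eq_of_btw h'.symm) hne
    · have := hmain _ y v u x rfl hlt h'.symm h.symm hne.symm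
      exact ⟨(this.trans h.symm).2.symm, this.symm⟩
  clear h h' hne
  intro n
  induction n using Nat.strong_induction_on with
  | _ n ih =>
  intro x u v y hn hlt h h' hne
  by_cases hvy : v = y
  · subst hvy; exact h
  by_cases hxu : x = u
  · subst hxu; exact btw_left h'.anc
  have huy : u ≠ y := by
    rintro rfl; exact hne h'.eq_of_self.symm
  -- An interior vertex never outranks both ends. If `u` outranked `y`, it would also outrank `v`,
  -- hence both `x` and `v`.
  have hru : E.rank u < E.rank y := by
    by_contra hc
    have hyu : E.rank y < E.rank u :=
      lt_of_le_of_ne (not_lt.1 hc) fun h' => huy (E.rank_injective h').symm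
    have h1 := h'.symm.rank_lt_of_lt hyu hne.symm
    rcases lt_trichotomy (E.rank x) (E.rank v) with hl | he | hl
    · exact absurd (h.rank_lt_of_lt hl hne) (by omega)
    · obtain rfl := E.rank_injective he
      exact hne h.eq_of_self
    · exact absurd (h.symm.rank_lt_of_lt hl (Ne.symm hxu)) (by omega)
  obtain ⟨s, hs⟩ := E.exists_pred hru h'.anc
  have huvs := h'.btw_pred hs hvy
  have hrs := E.rank_lt hs.edge
  have hxus : E.Btw x u s := by
    rcases lt_trichotomy (E.rank x) (E.rank s) with hl | he | hl
    · exact ih _ (by omega) x u v s rfl hl h huvs hne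
    · obtain rfl := E.rank_injective he
      exact absurd (h.eq_of_btw huvs.symm) hne
    · have := ih _ (by omega) s v u x rfl hl huvs.symm h.symm hne.symm
      exact (this.trans h.symm).2.symm
  have hus : u ≠ s := by
    rintro rfl; exact hne huvs.eq_of_self.symm
  obtain ⟨t, ht⟩ := E.exists_pred hlt (hxus.anc.tail hs.edge)
  have h1 : E.Btw x t s := ht.parent_btw hs.edge hxus.anc
  -- Both `u` and `t` lie between `x` and `s`. If `t` comes first, then `u` lies between `s` and `t`
  -- and also `s` between `u` and `t`, which forces `u = s` by lengths; otherwise `s` and `t` lie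
  -- before each other as seen from `u`.
  obtain rfl : s = t := by
    rcases hxus.linear h1 with h2 | h2
    · have h3 := (hxus.symm.trans h2.symm).1
      have h4 := hs.parent_btw ht.edge h3.right
      have e1 := h3.deg_eq
      have e2 := h4.deg_eq
      rw [E.deg_comm u s] at e2
      exact absurd (E.eq_of_deg_le_one hxus.right (by rw [E.deg_comm]; omega)) hus
    · exact (hs.parent_btw ht.edge h2.left).eq_of_btw h2
  exact hxus.of_pred ht hs

/-- An edge that occurs on the shortest trek. -/
theorem btw_of_exp_ne_zero (ht : G.CommonAncestor x y) (h : E.exp x y (Sum.inr (p, q)) ≠ 0) :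
    (E.Btw x p y ∧ E.Btw p q y) ∨ (E.Btw x q y ∧ E.Btw q p y) := by
  revert h
  refine E.induction_pair (P := fun x y => E.exp x y (Sum.inr (p, q)) ≠ 0 →
    (E.Btw x p y ∧ E.Btw p q y) ∨ (E.Btw x q y ∧ E.Btw q p y)) (fun x y ih h => ?_)
    (fun x h => by simp [E.exp_self] at h) (fun x y s hs ih h => ?_) x y ht
  · rw [E.exp_comm] at h
    refine (ih h).symm.imp ?_ ?_ <;>
    · rintro ⟨h1, h2⟩
      have := h1.trans h2
      exact ⟨this.2.symm, this.1.symm⟩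
  · rw [hs.exp_eq, Finsupp.add_apply] at h
    by_cases hz : E.exp x s (Sum.inr (p, q)) = 0
    · have : (s, y) = (p, q) := by
        by_contra hne
        simp [hz, hne] at h
      simp only [Prod.mk.injEq] at this
      obtain ⟨rfl, rfl⟩ := this
      exact Or.inl ⟨hs.btw, btw_right hs.btw.right⟩
    · refine (ih hz).imp ?_ ?_ <;>
      · rintro ⟨h1, h2⟩
        have h3 := hs.pred_of_btw h1
        exact ⟨h1.of_pred hs h3, h2.of_pred h3 (h3.pred_of_btw h2)⟩

theorem exp_inr_le_one (ht : G.CommonAncestor x y) : E.exp x y (Sum.inr (p, q)) ≤ 1 := by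
  refine E.induction_pair (P := fun x y => E.exp x y (Sum.inr (p, q)) ≤ 1) (fun x y ih => ?_)
    (fun x => by simp [E.exp_self]) (fun x y s hs ih => ?_) x y ht
  · rwa [E.exp_comm]
  · by_cases h : (s, y) = (p, q)
    · simp only [Prod.mk.injEq] at h
      obtain ⟨rfl, rfl⟩ := h
      rw [hs.exp_into]
      simp
    · rw [hs.exp_eq, Finsupp.add_apply]
      simpa [Finsupp.single_apply, h] using ih

end TrekExponents

end DAG
end
noncomputable section

/-! ### Switching the ends of pairs -/

namespace Sym2Multiset

variable {B X : Type*}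

/-- The multiset of the ends of the pairs in a multiset. -/
def ends (M : Multiset (Sym2 B)) : Multiset B := M.bind Sym2.toMultiset

@[simp] theorem ends_zero : ends (0 : Multiset (Sym2 B)) = 0 := rfl

@[simp] theorem ends_cons (x y : B) (M : Multiset (Sym2 B)) :
    ends (s(x, y) ::ₘ M) = x ::ₘ y ::ₘ ends M := by
  rw [ends, Multiset.cons_bind, ends, show s(x, y).toMultiset = x ::ₘ y ::ₘ 0 from rfl]
  simp

theorem exists_cons_of_mem_ends {M : Multiset (Sym2 B)} {b : B} (h : b ∈ ends M) :
    ∃ w N, M = s(b, w) ::ₘ N := by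
  induction M using Multiset.induction with
  | empty => simp at h
  | cons z M ih =>
    induction z using Sym2.ind with
    | _ x y =>
    rw [ends_cons, Multiset.mem_cons, Multiset.mem_cons] at h
    rcases h with rfl | rfl | h
    · exact ⟨y, M, rfl⟩
    · exact ⟨x, M, by rw [Sym2.eq_swap]⟩
    · obtain ⟨w, N, rfl⟩ := ih h
      exact ⟨w, s(x, y) ::ₘ N, Multiset.cons_swap _ _ _⟩

/-- Two admissible pairs `{x, y}` and `{z, w}` are replaced by the admissible pairs `{x, z}` and
`{y, w}`. -/
def Switch (ok : B → B → Prop) (M N : Multiset (Sym2 B)) : Prop :=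
  ∃ x y z w R, M = s(x, y) ::ₘ s(z, w) ::ₘ R ∧ N = s(x, z) ::ₘ s(y, w) ::ₘ R ∧
    ok x y ∧ ok z w ∧ ok x z ∧ ok y w

theorem Switch.symm {ok : B → B → Prop} {M N : Multiset (Sym2 B)} (h : Switch ok M N) :
    Switch ok N M := by
  obtain ⟨x, y, z, w, R, rfl, rfl, h1, h2, h3, h4⟩ := h
  exact ⟨x, z, y, w, R, rfl, rfl, h3, h4, h1, h2⟩

theorem Switch.add {ok : B → B → Prop} {M N : Multiset (Sym2 B)} (h : Switch ok M N)
    (K : Multiset (Sym2 B)) : Switch ok (M + K) (N + K) := by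
  obtain ⟨x, y, z, w, R, rfl, rfl, h'⟩ := h
  exact ⟨x, y, z, w, R + K, by simp, by simp, h'⟩

theorem switch_add {ok : B → B → Prop} {M N : Multiset (Sym2 B)}
    (h : Relation.ReflTransGen (Switch ok) M N) (K : Multiset (Sym2 B)) :
    Relation.ReflTransGen (Switch ok) (M + K) (N + K) :=
  h.lift (· + K) fun _ _ h => h.add K

theorem switch_cons {ok : B → B → Prop} {M N : Multiset (Sym2 B)}
    (h : Relation.ReflTransGen (Switch ok) M N) (z : Sym2 B) :
    Relation.ReflTransGen (Switch ok) (z ::ₘ M) (z ::ₘ N) :=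
  h.lift (z ::ₘ ·) fun _ _ h => by simpa [Multiset.add_comm _ {z}] using h.add {z}

/-- If the complement of the relation `ok` has no induced path or cycle on four vertices, then
multisets of admissible pairs with the same ends are connected by switches. -/
theorem switch_connected {ok : B → B → Prop} (hsymm : ∀ x y, ok x y → ok y x)
    (htp : ∀ a b c d, ¬ ok a b → ¬ ok b c → ¬ ok c d → ¬ ok a c ∨ ¬ ok b d)
    (M N : Multiset (Sym2 B)) (hM : ∀ x y, s(x, y) ∈ M → ok x y)
    (hN : ∀ x y, s(x, y) ∈ N → ok x y) (h : ends M = ends N) :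
    Relation.ReflTransGen (Switch ok) M N := by
  classical
  have hrev : ∀ {M N : Multiset (Sym2 B)}, Switch ok M N →
      Relation.ReflTransGen (Switch ok) N M := fun h => .single h.symm
  induction hn : M.card using Nat.strong_induction_on generalizing M N with
  | _ n ih =>
  by_cases hM0 : ends M = 0
  · have : ∀ K : Multiset (Sym2 B), ends K = 0 → K = 0 := by
      intro K hK
      induction K using Multiset.induction with
      | empty => rfl
      | cons z K _ =>
        induction z using Sym2.ind with
        | _ x y => simp at hK
    rw [this M hM0, this N (h ▸ hM0)]
  -- The end `b` is chosen with the most forbidden partners. The four-vertex condition then makes it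
  -- dominant: whatever is forbidden with a forbidden partner of `b` is forbidden with `b` too.
  · obtain ⟨b, hb, hmax⟩ := Finset.exists_max_image (ends M).toFinset
      (fun b => ((ends M).toFinset.filter fun x => ¬ ok x b).card)
      (by simpa [Finset.nonempty_iff_ne_empty] using hM0)
    rw [Multiset.mem_toFinset] at hb
    have hdom : ∀ c ∈ ends M, ¬ ok b c → ∀ x ∈ ends M, ¬ ok x c → ¬ ok x b := by
      intro c hc hbc x hx hxc hxb
      refine absurd (hmax c (by simpa using hc)) (not_le.2 (Finset.card_lt_card ?_))
      rw [Finset.ssubset_iff_of_subset]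
      · exact ⟨x, by simp [hx, hxc], by simp [hxb]⟩
      · intro y hy
        simp only [Finset.mem_filter, Multiset.mem_toFinset] at hy ⊢
        refine ⟨hy.1, fun hyc => ?_⟩
        rcases htp x c b y hxc (fun h => hbc (hsymm _ _ h)) (fun h => hy.2 (hsymm _ _ h)) with h | h
        · exact h hxb
        · exact h (hsymm _ _ hyc)
    obtain ⟨w, M, rfl⟩ := exists_cons_of_mem_ends hb
    obtain ⟨w', N, rfl⟩ := exists_cons_of_mem_ends (h ▸ hb)
    have h' := h
    rw [ends_cons, ends_cons, Multiset.cons_inj_right] at h'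
    rw [Multiset.card_cons] at hn
    have hbw := hM b w (Multiset.mem_cons_self _ _)
    have hbw' := hN b w' (Multiset.mem_cons_self _ _)
    have hM' := fun x y hxy => hM x y (Multiset.mem_cons_of_mem hxy)
    have hN' := fun x y hxy => hN x y (Multiset.mem_cons_of_mem hxy)
    by_cases hww : w = w'
    · subst hww
      rw [Multiset.cons_inj_right] at h'
      exact switch_cons (ih _ (by omega) M N hM' hN' h' rfl) _
    · have hwN : w ∈ ends N := by
        have : w ∈ w' ::ₘ ends N := h' ▸ Multiset.mem_cons_self _ _
        exact (Multiset.mem_cons.1 this).resolve_left hww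
      have hwM : w' ∈ ends M := by
        have : w' ∈ w ::ₘ ends M := h' ▸ Multiset.mem_cons_self _ _
        exact (Multiset.mem_cons.1 this).resolve_left (Ne.symm hww)
      -- Now `M` contains `{b,w}` and `{w',y}`, and `N` contains `{b,w'}` and `{w,x}`. If `{w',x}`
      -- or `{w,y}` is allowed, one switch creates a common pair, which is removed by induction.
      obtain ⟨x, N, rfl⟩ := exists_cons_of_mem_ends hwN
      obtain ⟨y, M, rfl⟩ := exists_cons_of_mem_ends hwM
      have hwx := hN' w x (Multiset.mem_cons_self _ _)
      have hwy := hM' w' y (Multiset.mem_cons_self _ _)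
      have hM'' := fun x y hxy => hM' x y (Multiset.mem_cons_of_mem hxy)
      have hN'' := fun x y hxy => hN' x y (Multiset.mem_cons_of_mem hxy)
      rw [Multiset.card_cons] at hn
      have h'' : y ::ₘ ends M = x ::ₘ ends N := by
        rw [ends_cons, ends_cons, Multiset.cons_swap w w', Multiset.cons_inj_right,
          Multiset.cons_inj_right] at h'
        exact h'
      have hmem : ∀ {p q : B} {K : Multiset (Sym2 B)}, ok p q →
          (∀ x y, s(x, y) ∈ K → ok x y) → ∀ x y, s(x, y) ∈ s(p, q) ::ₘ K → ok x y := by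
        intro p q K hpq hK x y hxy
        rcases Multiset.mem_cons.1 hxy with hxy | hxy
        · rcases Sym2.eq_iff.1 hxy with ⟨rfl, rfl⟩ | ⟨rfl, rfl⟩
          · exact hpq
          · exact hsymm _ _ hpq
        · exact hK x y hxy
      by_cases hwx' : ok w' x
      · refine Relation.ReflTransGen.trans (b := s(b, w) ::ₘ s(w', x) ::ₘ N) ?_
          (hrev ⟨b, w', w, x, N, rfl, rfl, hbw', hwx, hbw, hwx'⟩)
        refine switch_cons (ih _ ?_ _ _ hM' (hmem hwx' hN'') ?_ rfl) _
        · rw [Multiset.card_cons]; omega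
        · rw [ends_cons, ends_cons, h'']
      by_cases hwy' : ok w y
      · refine Relation.ReflTransGen.head (b := s(b, w') ::ₘ s(w, y) ::ₘ M)
          ⟨b, w, w', y, M, rfl, rfl, hbw, hwy, hbw', hwy'⟩ ?_
        refine switch_cons (ih _ ?_ _ _ (hmem hwy' hM'') hN' ?_ rfl) _
        · rw [Multiset.card_cons]; omega
        · rw [ends_cons, ends_cons, h'']
      -- Both easy switches are forbidden now. If `{w,w'}` were forbidden as well, `y, w, w', x`
      -- would be a forbidden walk with both `{y,w'}` and `{w,x}` allowed.
      have hww' : ok w w' := by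
        by_contra hww'
        rcases htp y w w' x (fun h => hwy' (hsymm _ _ h)) hww' hwx' with h | h
        · exact h (hsymm _ _ hwy)
        · exact h hwx
      have hxM : x ∈ ends (s(b, w) ::ₘ s(w', y) ::ₘ M) := by rw [h]; simp
      have hbx : ok b x := by
        by_contra hbx
        exact hdom x hxM hbx w' (by simp) hwx' (hsymm _ _ hbw')
      have hby : ok b y := by
        by_contra hby
        exact hdom y (by simp) hby w (by simp) hwy' (hsymm _ _ hbw)
      -- By dominance `b` may be paired with `x` and with `y`. Hence one switch on either side
      -- produces the common pair `{w,w'}`.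
      refine Relation.ReflTransGen.head (b := s(w, w') ::ₘ s(b, y) ::ₘ M)
        ⟨w, b, w', y, M, by rw [Sym2.eq_swap], rfl, hsymm _ _ hbw, hwy, hww', hby⟩ ?_
      refine Relation.ReflTransGen.trans (b := s(w, w') ::ₘ s(b, x) ::ₘ N) ?_
        (hrev ⟨w', b, w, x, N, by rw [Sym2.eq_swap], by rw [Sym2.eq_swap], hsymm _ _ hbw', hwx,
          hsymm _ _ hww', hbx⟩)
      refine switch_cons (ih _ ?_ _ _ (hmem hby hM'') (hmem hbx hN'') ?_ rfl) _
      · rw [Multiset.card_cons]; omega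
      · rw [ends_cons, ends_cons, h'']

/-- Used with `β` the branch at `u`, to lift switches of branches to switches of treks through `u`.
The given partners `y` and `w` in `hlift` serve to know that `x` and `z` are joined to `u` at all.
-/
theorem exists_switch_of_map {okX : X → X → Prop} {okB : B → B → Prop} {β : X → B}
    (hsymm : ∀ x y, okX x y → okX y x)
    (hlift : ∀ x y z w, okX x y → okX z w → okB (β x) (β z) → okX x z)
    {M : Multiset (Sym2 X)} {N : Multiset (Sym2 B)} (hM : ∀ x y, s(x, y) ∈ M → okX x y)
    (h : Switch okB (M.map (Sym2.map β)) N) :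
    ∃ M', Switch okX M M' ∧ M'.map (Sym2.map β) = N ∧ ∀ x y, s(x, y) ∈ M' → okX x y := by
  classical
  obtain ⟨b, b', d, d', R, hMR, rfl, -, -, h1, h2⟩ := h
  have hmk : ∀ (K : Multiset (Sym2 X)) (b b' : B) (R : Multiset (Sym2 B)),
      K.map (Sym2.map β) = s(b, b') ::ₘ R →
      ∃ x y K', K = s(x, y) ::ₘ K' ∧ β x = b ∧ β y = b' ∧ K'.map (Sym2.map β) = R := by
    intro K b b' R hK
    obtain ⟨a, ha, hab, hR⟩ := (Multiset.map_eq_cons _ _ _ _).2 hK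
    have hK' : K = a ::ₘ K.erase a := (Multiset.cons_erase ha).symm
    generalize K.erase a = K' at hK' hR
    subst hK'
    induction a using Sym2.ind with
    | _ x y =>
    rw [Sym2.map_mk] at hab
    rcases Sym2.eq_iff.1 hab with ⟨hx, hy⟩ | ⟨hx, hy⟩
    · exact ⟨x, y, K', rfl, hx, hy, hR⟩
    · exact ⟨y, x, K', by rw [Sym2.eq_swap], hy, hx, hR⟩
  obtain ⟨x, y, K, rfl, rfl, rfl, hK⟩ := hmk _ _ _ _ hMR
  obtain ⟨z, w, K, rfl, rfl, rfl, rfl⟩ := hmk _ _ _ _ hK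
  have hxy := hM x y (by simp)
  have hzw := hM z w (by simp)
  have hxz := hlift x y z w hxy hzw h1
  have hyw := hlift y x w z (hsymm _ _ hxy) (hsymm _ _ hzw) h2
  refine ⟨s(x, z) ::ₘ s(y, w) ::ₘ K, ⟨x, y, z, w, K, rfl, rfl, hxy, hzw, hxz, hyw⟩, by simp,
    fun p q hpq => ?_⟩
  rw [Multiset.mem_cons, Multiset.mem_cons] at hpq
  rcases hpq with hpq | hpq | hpq
  · rcases Sym2.eq_iff.1 hpq with ⟨rfl, rfl⟩ | ⟨rfl, rfl⟩
    exacts [hxz, hsymm _ _ hxz]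
  · rcases Sym2.eq_iff.1 hpq with ⟨rfl, rfl⟩ | ⟨rfl, rfl⟩
    exacts [hyw, hsymm _ _ hyw]
  · exact hM p q (by simp [hpq])

theorem exists_switches_of_map {okX : X → X → Prop} {okB : B → B → Prop} {β : X → B}
    (hsymm : ∀ x y, okX x y → okX y x)
    (hlift : ∀ x y z w, okX x y → okX z w → okB (β x) (β z) → okX x z)
    {M : Multiset (Sym2 X)} {N : Multiset (Sym2 B)} (hM : ∀ x y, s(x, y) ∈ M → okX x y)
    (h : Relation.ReflTransGen (Switch okB) (M.map (Sym2.map β)) N) :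
    ∃ M', Relation.ReflTransGen (Switch okX) M M' ∧ M'.map (Sym2.map β) = N ∧
      ∀ x y, s(x, y) ∈ M' → okX x y := by
  generalize hK : M.map (Sym2.map β) = K at h
  induction h using Relation.ReflTransGen.head_induction_on generalizing M with
  | refl => exact ⟨M, .refl, hK, hM⟩
  | head h _ ih =>
    subst hK
    obtain ⟨M', h1, h2, h3⟩ := exists_switch_of_map hsymm hlift hM h
    obtain ⟨M'', h4, h5, h6⟩ := ih h3 h2
    exact ⟨M'', .head h1 h4, h5, h6⟩

end Sym2Multiset
end
noncomputable section

namespace DAG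

variable {V : Type*} {G : DAG V}

namespace TrekExponents

variable {E : TrekExponents G} {i j s v w x y p q u b b' : V}

/-! ### Branches at a vertex -/

theorem deg_of_edge (h : G.edge i j) : E.deg i j = 2 := by
  have hij := commonAncestor_of_edge h
  obtain ⟨s, hs⟩ := E.exists_pred (E.rank_lt h) hij
  have h1 := (hs.parent_btw h (commonAncestor_refl i)).eq_of_self
  subst h1
  rw [hs.deg_eq, deg_self]

/-- `a` and `b` are joined by an edge. -/
def _root_.DAG.Adjacent (G : DAG V) (a b : V) : Prop := G.edge a b ∨ G.edge b a

theorem _root_.DAG.Adjacent.symm {a b : V} (h : G.Adjacent a b) : G.Adjacent b a := Or.symm h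

theorem _root_.DAG.Adjacent.ne {a b : V} (h : G.Adjacent a b) : a ≠ b :=
  h.elim ne_of_edge fun h => (ne_of_edge h).symm

theorem _root_.DAG.Adjacent.commonAncestor {a b : V} (h : G.Adjacent a b) :
    G.CommonAncestor a b :=
  h.elim commonAncestor_of_edge fun h => (commonAncestor_of_edge h).symm

theorem deg_of_adjacent (h : G.Adjacent i j) : E.deg i j = 2 :=
  h.elim deg_of_edge fun h => by rw [deg_comm]; exact deg_of_edge h

theorem exists_adjacent_btw (E : TrekExponents G) (h : G.CommonAncestor x u) (hne : x ≠ u) :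
    ∃ b, G.Adjacent b u ∧ E.Btw x b u := by
  suffices h : x ≠ u → (∃ b, G.Adjacent b u ∧ E.Btw x b u) ∧ ∃ b, G.Adjacent b x ∧ E.Btw u b x from
    (h hne).1
  clear hne
  refine E.induction_pair (P := fun x u => x ≠ u → (∃ b, G.Adjacent b u ∧ E.Btw x b u) ∧
    ∃ b, G.Adjacent b x ∧ E.Btw u b x) (fun i j h hne => (h hne.symm).symm)
    (fun i h => absurd rfl h) (fun i j s hs ih _ => ⟨⟨s, Or.inl hs.edge, hs.btw⟩, ?_⟩) x u h
  by_cases his : i = s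
  · subst his
    exact ⟨j, Or.inr hs.edge, btw_left hs.btw.anc.symm⟩
  · obtain ⟨b, hb, hb'⟩ := (ih his).2
    exact ⟨b, hb, (hb'.symm.of_pred hs (hs.pred_of_btw hb'.symm)).symm⟩

theorem Btw.eq_of_adjacent (h : E.Btw b b' u) (hb : G.Adjacent b u) (hne : b' ≠ u) : b = b' := by
  have h1 := h.deg_eq
  rw [deg_of_adjacent hb] at h1
  have h2 : ¬ E.deg b' u ≤ 1 := fun h' => hne (E.eq_of_deg_le_one h.right h')
  exact E.eq_of_deg_le_one h.left (by omega)

/-- Two neighbours of `u` on one trek are linearly ordered on the same side of `u`, and there is no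
room for a vertex between a neighbour and `u`. -/
theorem Btw.branch_unique (h : E.Btw x b u) (hb : G.Adjacent b u) (h' : E.Btw x b' u)
    (hb' : G.Adjacent b' u) : b = b' := by
  rcases h.linear h' with h1 | h1
  · have h2 := (h.symm.trans h1.symm).1
    exact (h2.symm.eq_of_adjacent hb' hb.ne).symm
  · exact h1.eq_of_adjacent hb hb'.ne

open Classical in
/-- The vertex next to `u` on the shortest trek from `u` to `x`, or `u` itself if `x = u`. -/
def branch (E : TrekExponents G) (u x : V) : V :=
  if h : x ≠ u ∧ G.CommonAncestor x u then (E.exists_adjacent_btw h.2 h.1).choose else u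

@[simp] theorem branch_self (E : TrekExponents G) (u : V) : E.branch u u = u := by
  rw [branch, dif_neg (by simp)]

theorem branch_spec (E : TrekExponents G) (h : G.CommonAncestor x u) (hne : x ≠ u) :
    G.Adjacent (E.branch u x) u ∧ E.Btw x (E.branch u x) u := by
  rw [branch, dif_pos ⟨hne, h⟩]
  exact (E.exists_adjacent_btw h hne).choose_spec

theorem Btw.branch_eq (h : E.Btw x b u) (hb : G.Adjacent b u) : E.branch u x = b := by
  have hne : x ≠ u := by
    rintro rfl; exact hb.ne h.eq_of_self
  have := E.branch_spec h.anc hne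
  exact this.2.branch_unique this.1 h hb

theorem branch_eq_self_iff (E : TrekExponents G) (h : G.CommonAncestor x u) :
    E.branch u x = u ↔ x = u := by
  refine ⟨fun h' => ?_, fun h => by rw [h, branch_self]⟩
  by_contra hne
  exact (E.branch_spec h hne).1.ne h'

theorem branch_mem (E : TrekExponents G) (u x : V) :
    E.branch u x = u ∨ G.Adjacent (E.branch u x) u := by
  by_cases h : x ≠ u ∧ G.CommonAncestor x u
  · exact Or.inr (E.branch_spec h.2 h.1).1
  · rw [branch, dif_neg h]; exact Or.inl rfl

theorem btw_branch (E : TrekExponents G) (h : G.CommonAncestor x u) :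
    E.Btw x (E.branch u x) u := by
  by_cases hne : x = u
  · subst hne; rw [branch_self]; exact btw_left h
  · exact (E.branch_spec h hne).2

/-- The shortest treks that pass `u` can come from the branch `b` and leave through `b'`. -/
structure Passes (E : TrekExponents G) (u b b' : V) : Prop where
  left : b = u ∨ G.Adjacent b u
  right : b' = u ∨ G.Adjacent b' u
  btw : E.Btw b u b'

theorem Passes.symm (h : E.Passes u b b') : E.Passes u b' b := ⟨h.right, h.left, h.btw.symm⟩

theorem Btw.passes (h : E.Btw x u y) : E.Passes u (E.branch u x) (E.branch u y) := by
  refine ⟨E.branch_mem u x, E.branch_mem u y, ?_⟩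
  have h1 := E.btw_branch h.left
  have h2 := E.btw_branch h.right.symm
  have h3 := (h.symm.trans h1.symm).1
  exact (h3.symm.trans h2.symm).1

/-- The trek from `x`, the passage through `u` and the trek to `y` overlap in the edges at `u`, so
`Btw.glue` applies twice. Together with `Btw.passes` this makes passing through `u` a question about
branches alone. -/
theorem Passes.btw_of_branch (h : E.Passes u (E.branch u x) (E.branch u y))
    (hx : G.CommonAncestor x u) (hy : G.CommonAncestor y u) : E.Btw x u y := by
  by_cases hxu : x = u
  · subst hxu; exact btw_left hy.symm
  by_cases hyu : y = u
  · subst hyu; exact btw_right hx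
  have h1 := E.branch_spec hx hxu
  have h2 := E.branch_spec hy hyu
  have h3 := (h1.2.glue h.btw h1.1.ne).2
  exact (h3.glue h2.2.symm h2.1.ne.symm).1

/-- Passages through `u` can be read off the graph. If `u → b'` and `b'` has the larger rank, the
predecessor of `b'` seen from `b` lies between `b` and `u`, so it is one of them, and being `b`
would mean adjacency. -/
theorem passes_iff (ha : G.Adjacent b u) (hb : G.Adjacent b' u) :
    E.Passes u b b' ↔ b ≠ b' ∧ ¬ G.Adjacent b b' ∧ ¬ (G.edge b u ∧ G.edge b' u) := by
  constructor
  · rintro ⟨-, -, h⟩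
    refine ⟨?_, fun hadj => ?_, fun ⟨h1, h2⟩ => ?_⟩
    · rintro rfl
      exact ha.ne h.eq_of_self.symm
    · have := h.deg_eq
      rw [deg_of_adjacent hadj, deg_of_adjacent ha, deg_of_adjacent hb.symm] at this
      omega
    · rcases lt_trichotomy (E.rank b) (E.rank b') with hl | he | hl
      · exact absurd (h.rank_lt_of_lt hl hb.ne.symm) (not_lt.2 (E.rank_lt h2).le)
      · obtain rfl := E.rank_injective he
        exact ha.ne h.eq_of_self.symm
      · exact absurd (h.symm.rank_lt_of_lt hl ha.ne.symm) (not_lt.2 (E.rank_lt h1).le)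
  · suffices h : ∀ b b', G.Adjacent b u → G.Adjacent b' u → E.rank b < E.rank b' →
        ¬ G.Adjacent b b' → ¬ (G.edge b u ∧ G.edge b' u) → E.Passes u b b' by
      rintro ⟨hne, h1, h2⟩
      rcases lt_trichotomy (E.rank b) (E.rank b') with hl | he | hl
      · exact h b b' ha hb hl h1 h2
      · exact absurd (E.rank_injective he) hne
      · exact (h b' b hb ha hl (fun h => h1 h.symm) (fun h => h2 h.symm)).symm
    clear ha hb
    intro b b' ha hb hlt hadj hpar
    have hub : G.edge u b' := by
      rcases hb with hb | hb
      · rcases ha with ha | ha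
        · exact absurd ⟨ha, hb⟩ hpar
        · have := E.rank_lt ha
          have := E.rank_lt hb
          omega
      · exact hb
    obtain ⟨s, hs⟩ := E.exists_pred hlt (ha.commonAncestor.tail hub)
    have h1 := hs.parent_btw hub ha.commonAncestor
    have hsu : s = u := by
      by_contra hsu
      obtain rfl := h1.eq_of_adjacent ha hsu
      exact hadj (Or.inl hs.edge)
    subst hsu
    exact ⟨Or.inr ha, Or.inr hb, hs.btw⟩

/-- Let `c` outrank `a`, so that `u → c`. An edge `b → c` would put `u` between `a` and `b` by the
parent condition; so the failure for `b, c` can only come from `c → b`. Then `b` has the largest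
rank, and the failure for `a, b` can only come from `a → b`. -/
theorem edge_of_not_passes {a c : V} (ha : G.Adjacent a u) (hb : G.Adjacent b u)
    (hc : G.Adjacent c u) (hac : E.Passes u a c) (hab : ¬ E.Passes u a b)
    (hbc : ¬ E.Passes u b c) : G.edge a b ∧ G.edge c b := by
  suffices h : ∀ a c, G.Adjacent a u → G.Adjacent c u → E.rank a < E.rank c → E.Passes u a c →
      ¬ E.Passes u a b → ¬ E.Passes u b c → G.edge a b ∧ G.edge c b by
    rcases lt_trichotomy (E.rank a) (E.rank c) with hl | he | hl
    · exact h a c ha hc hl hac hab hbc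
    · obtain rfl := E.rank_injective he
      exact absurd rfl ((passes_iff ha hc).1 hac).1
    · exact (h c a hc ha hl hac.symm (fun h => hbc h.symm) (fun h => hab h.symm)).symm
  clear ha hc hac hab hbc
  intro a c ha hc hlt hac hab hbc
  have hac' := (passes_iff ha hc).1 hac
  have huc : G.edge u c := by
    rcases hc with hc | hc
    · rcases ha with ha | ha
      · exact absurd ⟨ha, hc⟩ hac'.2.2
      · have := E.rank_lt ha
        have := E.rank_lt hc
        omega
    · exact hc
  have hnab : a ≠ b := by rintro rfl; exact hbc hac
  have hncb : b ≠ c := by rintro rfl; exact hab hac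
  obtain ⟨s, hs⟩ := E.exists_pred hlt hac.btw.anc
  obtain rfl : s = u := (hs.parent_btw huc ha.commonAncestor).eq_of_btw
    (hac.btw.btw_pred hs hc.ne.symm)
  have hnbc : ¬ G.edge b c := by
    intro hbc'
    have h1 := hs.parent_btw hbc' ((hs.iff b hbc').2 hb.symm.commonAncestor)
    exact hab ⟨Or.inr ha, Or.inr hb, h1⟩
  rw [passes_iff hb hc] at hbc
  rw [passes_iff ha hb] at hab
  have hcs : ¬ G.edge c s := fun h => by
    have := E.rank_lt h
    have := E.rank_lt huc
    omega
  have hcb : G.edge c b := by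
    by_contra hcb
    exact hbc ⟨hncb, fun h => h.elim hnbc hcb, fun h => hcs h.2⟩
  have h1 := E.rank_lt hcb
  have h2 := E.rank_lt huc
  refine ⟨?_, hcb⟩
  by_contra hab'
  refine hab ⟨hnab, fun h => h.elim hab' fun h => ?_, fun h => ?_⟩
  · have := E.rank_lt h
    omega
  · have := E.rank_lt h.2
    omega

/-- If both `a, c` and `b, d` passed, the two triples `a, b, c` and `b, c, d` would yield the
opposite edges `c → b` and `b → c`. None of the four is `u`, because `u` passes with every branch.
This is the hypothesis of `switch_connected`. -/
theorem passes_quadruple (E : TrekExponents G) (u a b c d : V) (hab : ¬ E.Passes u a b)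
    (hbc : ¬ E.Passes u b c) (hcd : ¬ E.Passes u c d) :
    ¬ E.Passes u a c ∨ ¬ E.Passes u b d := by
  by_contra! h
  obtain ⟨hac, hbd⟩ := h
  have hself : ∀ x, (x = u ∨ G.Adjacent x u) → E.Passes u u x := fun x hx => by
    refine ⟨Or.inl rfl, hx, btw_left ?_⟩
    rcases hx with rfl | hx
    · exact commonAncestor_refl _
    · exact hx.symm.commonAncestor
  have ha := hac.left.resolve_left (by rintro rfl; exact hab (hself b hbd.left))
  have hb := hbd.left.resolve_left (by rintro rfl; exact hbc (hself c hac.right))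
  have hc := hac.right.resolve_left (by rintro rfl; exact hcd (hself d hbd.right))
  have hd := hbd.right.resolve_left (by rintro rfl; exact hcd (hself c hac.right).symm)
  have h1 := (edge_of_not_passes ha hb hc hac hab hbc).2
  have h2 := (edge_of_not_passes hb hc hd hbd hbc hcd).1
  have := E.rank_lt h1
  have := E.rank_lt h2
  omega

end TrekExponents

end DAG
end
noncomputable section

namespace Sym2Multiset

variable {B : Type*}

theorem mem_ends {M : Multiset (Sym2 B)} {b : B} : b ∈ ends M ↔ ∃ z ∈ M, b ∈ z := by
  simp [ends]

theorem Switch.ends_eq {ok : B → B → Prop} {M N : Multiset (Sym2 B)} (h : Switch ok M N) :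
    ends M = ends N := by
  obtain ⟨x, y, z, w, R, rfl, rfl, -⟩ := h
  simp [Multiset.cons_swap y z]

theorem ends_eq_of_switches {ok : B → B → Prop} {M N : Multiset (Sym2 B)}
    (h : Relation.ReflTransGen (Switch ok) M N) : ends M = ends N := by
  induction h with
  | refl => rfl
  | tail _ h ih => exact ih.trans h.ends_eq

end Sym2Multiset

open Sym2Multiset

namespace DAG

variable {V : Type*} {G : DAG V}

namespace TrekExponents

variable {E : TrekExponents G} {i j s v w x y p q u b b' : V}

/-! ### Counting branches -/

theorem exp_edge (h : G.edge i j) : E.exp i j (Sum.inr (i, j)) = 1 := by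
  have hij := commonAncestor_of_edge h
  obtain ⟨s, hs⟩ := E.exists_pred (E.rank_lt h) hij
  have h1 := (hs.parent_btw h (commonAncestor_refl i)).eq_of_self
  subst h1
  rw [hs.exp_into]
  simp

theorem Btw.exp_inr_eq (h : E.Btw x u y) (e : V × V) :
    E.exp x y (Sum.inr e) = E.exp x u (Sum.inr e) + E.exp u y (Sum.inr e) := by
  simpa using congrArg (fun f => f (Sum.inr e)) h.exp_eq

/-- The branch-counting formula for one trek and a directed edge. -/
theorem branch_count_aux [DecidableEq V] {e : V × V} (he : e = (u, b) ∨ e = (b, u))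
    (hb : G.edge e.1 e.2) (h : G.CommonAncestor x y) :
    (E.Btw x u y → (if E.branch u x = b then 1 else 0) + (if E.branch u y = b then 1 else 0) =
      E.exp x y (Sum.inr e)) ∧ (¬ E.Btw x u y → E.exp x y (Sum.inr e) = 0) := by
  have hadj : G.Adjacent b u := by
    rcases he with rfl | rfl
    exacts [Or.inr hb, Or.inl hb]
  have hle : E.exp x y (Sum.inr e) ≤ 1 := E.exp_inr_le_one (p := e.1) (q := e.2) h
  have key : E.exp x y (Sum.inr e) ≠ 0 →
      E.Btw x u y ∧ (E.branch u x = b ∨ E.branch u y = b) := by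
    intro hne
    have h1 : (E.Btw x u y ∧ E.Btw u b y) ∨ (E.Btw x b y ∧ E.Btw b u y) := by
      rcases he with rfl | rfl
      · exact btw_of_exp_ne_zero h hne
      · exact (btw_of_exp_ne_zero h hne).symm
    rcases h1 with ⟨h1, h2⟩ | ⟨h1, h2⟩
    · exact ⟨h1, Or.inr (h2.symm.branch_eq hadj)⟩
    · have h3 := h1.trans h2
      exact ⟨h3.2, Or.inl (h3.1.branch_eq hadj)⟩
  have hbr : ∀ x, G.CommonAncestor x u →
      (if E.branch u x = b then 1 else 0) ≤ E.exp x u (Sum.inr e) := by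
    intro x hx
    split_ifs with hxb
    · have hxu : x ≠ u := by
        rintro rfl
        rw [branch_self] at hxb
        exact hadj.ne hxb.symm
      have h1 := (E.branch_spec hx hxu).2
      rw [hxb] at h1
      rw [h1.exp_inr_eq]
      rcases he with rfl | rfl
      · rw [E.exp_comm b u, exp_edge hb]; omega
      · rw [exp_edge hb]; omega
    · omega
  refine ⟨fun hbtw => ?_, fun hbtw => by_contra fun hne => hbtw (key hne).1⟩
  have h1 := hbr x hbtw.left
  have h2 := hbr y hbtw.right.symm
  have h3 := hbtw.exp_inr_eq e
  rw [E.exp_comm u y] at h3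
  by_cases hz : E.exp x y (Sum.inr e) = 0
  · omega
  · have h4 := (key hz).2
    by_cases hx : E.branch u x = b <;> by_cases hy : E.branch u y = b <;>
      simp only [hx, hy, if_true, if_false, or_self] at h1 h2 h4 ⊢ <;> omega

/-- Only one of the two orientations is an edge, so one of the two exponents vanishes and the sum
treats both cases alike. -/
theorem branch_count [DecidableEq V] (hb : G.Adjacent b u) (h : G.CommonAncestor x y) :
    (E.Btw x u y → (if E.branch u x = b then 1 else 0) + (if E.branch u y = b then 1 else 0) =
      E.exp x y (Sum.inr (u, b)) + E.exp x y (Sum.inr (b, u))) ∧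
    (¬ E.Btw x u y → E.exp x y (Sum.inr (u, b)) + E.exp x y (Sum.inr (b, u)) = 0) := by
  have h0 : ∀ p q, G.edge q p → E.exp x y (Sum.inr (p, q)) = 0 := by
    intro p q hqp
    by_contra hne
    exact G.acyclic p (.head (E.of_exp_ne_zero h hne).1 (.single hqp))
  rcases hb with hb | hb
  · have := branch_count_aux (E := E) (e := (b, u)) (Or.inr rfl) hb h
    rwa [h0 u b hb, zero_add]
  · have := branch_count_aux (E := E) (e := (u, b)) (Or.inl rfl) hb h
    rwa [h0 b u hb, add_zero]

/-- Flow conservation at `u`: the top emits one unit along each side, which is absorbed at the two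
ends. So the number of ends at `u` can be recovered from the exponent vector. -/
theorem end_count [DecidableEq V] [Fintype V] (E : TrekExponents G) (u : V)
    (h : G.CommonAncestor x y) :
    (if x = u then 1 else 0) + (if y = u then 1 else 0) + ∑ w, E.exp x y (Sum.inr (u, w)) =
      2 * E.exp x y (Sum.inl u) + ∑ w, E.exp x y (Sum.inr (w, u)) := by
  refine E.induction_pair (P := fun x y => (if x = u then 1 else 0) + (if y = u then 1 else 0) +
      ∑ w, E.exp x y (Sum.inr (u, w)) = 2 * E.exp x y (Sum.inl u) +
      ∑ w, E.exp x y (Sum.inr (w, u))) (fun i j h => ?_) (fun i => ?_) (fun i j s hs h => ?_) x y h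
  · rw [E.exp_comm j i]
    omega
  · simp only [E.exp_self, Finsupp.single_apply]
    simp only [Sum.inl.injEq, reduceCtorEq, if_false, Finset.sum_const_zero]
    omega
  · have h1 : ∑ w, (Finsupp.single (Sum.inr (s, j)) 1 : V ⊕ V × V →₀ ℕ) (Sum.inr (u, w)) =
        if s = u then 1 else 0 := by
      rw [Finset.sum_eq_single j]
      · simp [Finsupp.single_apply]
      · intro w _ hw
        simp [hw.symm]
      · simp
    have h2 : ∑ w, (Finsupp.single (Sum.inr (s, j)) 1 : V ⊕ V × V →₀ ℕ) (Sum.inr (w, u)) =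
        if j = u then 1 else 0 := by
      rw [Finset.sum_eq_single s]
      · simp [Finsupp.single_apply]
      · intro w _ hw
        simp [hw.symm]
      · simp
    simp only [hs.exp_eq, Finsupp.add_apply, Finset.sum_add_distrib, h1, h2]
    simp only [Finsupp.single_apply, reduceCtorEq, if_false]
    omega

/-! ### Fibers of the shortest trek map -/

/-- The exponent vector of the shortest trek of an unordered pair. -/
def pairExp (E : TrekExponents G) : Sym2 V → (V ⊕ V × V →₀ ℕ) := Sym2.lift ⟨E.exp, E.exp_comm⟩

@[simp] theorem pairExp_mk (E : TrekExponents G) (x y : V) : E.pairExp s(x, y) = E.exp x y := rfl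

/-- The exponent vector of a product of shortest treks. -/
def totalExp (E : TrekExponents G) (M : Multiset (Sym2 V)) : V ⊕ V × V →₀ ℕ :=
  (M.map E.pairExp).sum

@[simp] theorem totalExp_zero (E : TrekExponents G) : E.totalExp 0 = 0 := rfl

@[simp] theorem totalExp_cons (E : TrekExponents G) (x y : V) (M : Multiset (Sym2 V)) :
    E.totalExp (s(x, y) ::ₘ M) = E.exp x y + E.totalExp M := by
  simp [totalExp]

/-- All pairs of a multiset are joined by treks. -/
def _root_.DAG.AllTreks (G : DAG V) (M : Multiset (Sym2 V)) : Prop :=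
  ∀ x y, s(x, y) ∈ M → G.CommonAncestor x y

theorem _root_.DAG.AllTreks.of_cons {z : Sym2 V} {M : Multiset (Sym2 V)}
    (h : G.AllTreks (z ::ₘ M)) : G.AllTreks M :=
  fun x y hxy => h x y (Multiset.mem_cons_of_mem hxy)

/-- The pairs whose shortest trek passes `u`. -/
def passing (E : TrekExponents G) (u : V) : Set (Sym2 V) := {z | ∃ x y, z = s(x, y) ∧ E.Btw x u y}

theorem mk_mem_passing : s(x, y) ∈ E.passing u ↔ E.Btw x u y := by
  constructor
  · rintro ⟨x', y', h, h'⟩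
    rcases Sym2.eq_iff.1 h with ⟨rfl, rfl⟩ | ⟨rfl, rfl⟩
    exacts [h', h'.symm]
  · exact fun h => ⟨x, y, rfl, h⟩

open Classical in
/-- The pairs of branches at `u` that are used by the treks of a multiset. -/
def branches (E : TrekExponents G) (u : V) (M : Multiset (Sym2 V)) : Multiset (Sym2 V) :=
  (M.filter (· ∈ E.passing u)).map (Sym2.map (E.branch u))

@[simp] theorem branches_zero (E : TrekExponents G) (u : V) : E.branches u 0 = 0 := by
  simp [branches]

theorem branches_cons_of_btw {M : Multiset (Sym2 V)} (h : E.Btw x u y) :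
    E.branches u (s(x, y) ::ₘ M) = s(E.branch u x, E.branch u y) ::ₘ E.branches u M := by
  simp [branches, mk_mem_passing, h]

theorem branches_cons_of_not {M : Multiset (Sym2 V)} (h : ¬ E.Btw x u y) :
    E.branches u (s(x, y) ::ₘ M) = E.branches u M := by
  simp [branches, mk_mem_passing, h]

theorem count_ends_branches [DecidableEq V] (hb : G.Adjacent b u) {M : Multiset (Sym2 V)}
    (hM : G.AllTreks M) : (ends (E.branches u M)).count b =
      E.totalExp M (Sum.inr (u, b)) + E.totalExp M (Sum.inr (b, u)) := by
  induction M using Multiset.induction with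
  | empty => simp
  | cons z M ih =>
    induction z using Sym2.ind with
    | _ x y =>
    have ih := ih hM.of_cons
    have h1 := branch_count (E := E) hb (hM x y (Multiset.mem_cons_self _ _))
    simp only [totalExp_cons, Finsupp.add_apply]
    by_cases h : E.Btw x u y
    · have h2 := h1.1 h
      simp only [branches_cons_of_btw h, ends_cons, Multiset.count_cons, ih, eq_comm (a := b)]
      omega
    · have h2 := h1.2 h
      rw [branches_cons_of_not h, ih]
      omega

theorem count_ends [DecidableEq V] [Fintype V] (E : TrekExponents G) (u : V)
    {M : Multiset (Sym2 V)} (hM : G.AllTreks M) :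
    (ends M).count u + ∑ w, E.totalExp M (Sum.inr (u, w)) =
      2 * E.totalExp M (Sum.inl u) + ∑ w, E.totalExp M (Sum.inr (w, u)) := by
  induction M using Multiset.induction with
  | empty => simp
  | cons z M ih =>
    induction z using Sym2.ind with
    | _ x y =>
    have ih := ih hM.of_cons
    have h1 := end_count E u (hM x y (Multiset.mem_cons_self _ _))
    simp only [totalExp_cons, Finsupp.add_apply, Finset.sum_add_distrib, ends_cons,
      Multiset.count_cons, eq_comm (a := u)]
    omega

theorem count_ends_branches_self [DecidableEq V] (E : TrekExponents G) (u : V)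
    {M : Multiset (Sym2 V)} (hM : G.AllTreks M) :
    (ends (E.branches u M)).count u = (ends M).count u := by
  induction M using Multiset.induction with
  | empty => simp
  | cons z M ih =>
    induction z using Sym2.ind with
    | _ x y =>
    have ih := ih hM.of_cons
    have hxy := hM x y (Multiset.mem_cons_self _ _)
    by_cases h : E.Btw x u y
    · simp only [branches_cons_of_btw h, ends_cons, Multiset.count_cons, ih, eq_comm (a := u),
        E.branch_eq_self_iff h.left, E.branch_eq_self_iff h.right.symm]
    · have hx : u ≠ x := by rintro rfl; exact h (btw_left hxy)
      have hy : u ≠ y := by rintro rfl; exact h (btw_right hxy)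
      simp [branches_cons_of_not h, ih, hx, hy]

theorem ends_eq_of_totalExp [Finite V] {M N : Multiset (Sym2 V)} (hM : G.AllTreks M)
    (hN : G.AllTreks N) (h : E.totalExp M = E.totalExp N) : ends M = ends N := by
  classical
  cases nonempty_fintype V
  ext u
  have h1 := E.count_ends u hM
  have h2 := E.count_ends u hN
  rw [h] at h1
  omega

/-- The use of a neighbour `b` as a branch is counted by the exponents of the edge between `b` and
`u`, and the use of `u` itself by the number of ends at `u`. Both are functions of the total
exponent. -/
theorem ends_branches_eq [Finite V] {M N : Multiset (Sym2 V)} (hM : G.AllTreks M)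
    (hN : G.AllTreks N) (h : E.totalExp M = E.totalExp N) (u : V) :
    ends (E.branches u M) = ends (E.branches u N) := by
  classical
  ext b
  by_cases hb : G.Adjacent b u
  · rw [count_ends_branches hb hM, count_ends_branches hb hN, h]
  by_cases hbu : b = u
  · subst hbu
    rw [count_ends_branches_self E b hM, count_ends_branches_self E b hN,
      ends_eq_of_totalExp hM hN h]
  have h0 : ∀ K : Multiset (Sym2 V), (ends (E.branches u K)).count b = 0 := by
    intro K
    rw [Multiset.count_eq_zero, mem_ends]
    rintro ⟨z, hz, hbz⟩
    obtain ⟨z', -, rfl⟩ := Multiset.mem_map.1 hz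
    obtain ⟨x, -, rfl⟩ := Sym2.mem_map.1 hbz
    exact (E.branch_mem u x).elim hbu hb
  rw [h0, h0]

theorem branches_passes {M : Multiset (Sym2 V)} (h : s(b, b') ∈ E.branches u M) :
    E.Passes u b b' := by
  classical
  rw [branches, Multiset.mem_map] at h
  obtain ⟨z, hz, hzb⟩ := h
  rw [Multiset.mem_filter] at hz
  obtain ⟨x, y, rfl, hxy⟩ := hz.2
  rw [Sym2.map_mk] at hzb
  rcases Sym2.eq_iff.1 hzb with ⟨rfl, rfl⟩ | ⟨rfl, rfl⟩
  exacts [hxy.passes, hxy.passes.symm]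

/-- Two treks through a common vertex exchange their ends. -/
def Move (E : TrekExponents G) (M N : Multiset (Sym2 V)) : Prop :=
  ∃ u, Switch (fun x y => E.Btw x u y) M N

theorem Move.allTreks {M N : Multiset (Sym2 V)} (h : E.Move M N) (hM : G.AllTreks M) :
    G.AllTreks N := by
  obtain ⟨u, x, y, z, w, R, rfl, rfl, -, -, h1, h2⟩ := h
  intro p q hpq
  rw [Multiset.mem_cons, Multiset.mem_cons] at hpq
  rcases hpq with hpq | hpq | hpq
  · rcases Sym2.eq_iff.1 hpq with ⟨rfl, rfl⟩ | ⟨rfl, rfl⟩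
    exacts [h1.anc, h1.anc.symm]
  · rcases Sym2.eq_iff.1 hpq with ⟨rfl, rfl⟩ | ⟨rfl, rfl⟩
    exacts [h2.anc, h2.anc.symm]
  · exact hM p q (by simp [hpq])

/-- All four treks split at `u`, so either pair of treks contributes the four pieces from `x, y, z,
w` to `u`, less `a_u` twice. -/
theorem Move.totalExp_eq {M N : Multiset (Sym2 V)} (h : E.Move M N) :
    E.totalExp M = E.totalExp N := by
  obtain ⟨u, x, y, z, w, R, rfl, rfl, h1, h2, h3, h4⟩ := h
  simp only [totalExp_cons]
  rw [← add_assoc, ← add_assoc]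
  congr 1
  apply add_right_cancel (b := Finsupp.single (Sum.inl u) 1 + Finsupp.single (Sum.inl u) 1)
  calc _ = (E.exp x y + Finsupp.single (Sum.inl u) 1) +
        (E.exp z w + Finsupp.single (Sum.inl u) 1) := by abel
    _ = (E.exp x z + Finsupp.single (Sum.inl u) 1) +
        (E.exp y w + Finsupp.single (Sum.inl u) 1) := by
      rw [h1.exp_eq, h2.exp_eq, h3.exp_eq, h4.exp_eq, E.exp_comm z u, E.exp_comm u y]
      abel
    _ = _ := by abel

theorem moves_allTreks {M N : Multiset (Sym2 V)} (h : Relation.ReflTransGen E.Move M N)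
    (hM : G.AllTreks M) : G.AllTreks N := by
  induction h with
  | refl => exact hM
  | tail _ h ih => exact h.allTreks ih

theorem moves_totalExp {M N : Multiset (Sym2 V)} (h : Relation.ReflTransGen E.Move M N) :
    E.totalExp M = E.totalExp N := by
  induction h with
  | refl => rfl
  | tail _ h ih => exact ih.trans h.totalExp_eq

/-- A trek of `M` that follows a trek of `N` up to `u` can be made to follow it one step further. -/
theorem exists_moves_branch [Finite V] {M N : Multiset (Sym2 V)} (hM : G.AllTreks M)
    (hN : G.AllTreks N) (h : E.totalExp M = E.totalExp N) (hx : s(v, x) ∈ M)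
    (hxu : E.Btw v u x) (hw : s(v, w) ∈ N) (hwu : E.Btw v u w) :
    ∃ M' y, Relation.ReflTransGen E.Move M M' ∧ s(v, y) ∈ M' ∧ E.Btw v u y ∧
      E.branch u y = E.branch u w := by
  classical
  set F := M.filter (· ∈ E.passing u) with hF
  set R := M.filter (· ∉ E.passing u) with hR
  have hFR : F + R = M := Multiset.filter_add_not _ _
  have hFb : ∀ x y, s(x, y) ∈ F → E.Btw x u y := fun x y hxy =>
    mk_mem_passing.1 (Multiset.mem_filter.1 hxy).2
  -- The treks through `u` are rearranged so that their multiset of branch pairs becomes that of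
  -- `N`; the other treks stay fixed.
  have hconn := switch_connected (ok := E.Passes u) (fun _ _ h => h.symm)
    (E.passes_quadruple u) (E.branches u M) (E.branches u N) (fun _ _ => branches_passes)
    (fun _ _ => branches_passes) (ends_branches_eq hM hN h u)
  obtain ⟨F', hFF', hF'N, hF'⟩ := exists_switches_of_map
    (okX := fun x y => E.Btw x u y) (fun _ _ h => h.symm)
    (fun x y z w h1 h2 h3 => h3.btw_of_branch h1.left h2.left) hFb hconn
  have hMF' : Relation.ReflTransGen E.Move M (F' + R) := by
    rw [← hFR]
    exact (switch_add hFF' R).lift id fun _ _ h => ⟨u, h⟩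
  have hv : v ∈ ends F' := by
    rw [← ends_eq_of_switches hFF', mem_ends]
    exact ⟨s(v, x), Multiset.mem_filter.2 ⟨hx, mk_mem_passing.2 hxu⟩, by simp⟩
  obtain ⟨t, K, rfl⟩ := exists_cons_of_mem_ends hv
  have hvt := hF' v t (Multiset.mem_cons_self _ _)
  by_cases htw : E.branch u t = E.branch u w
  · exact ⟨_, t, hMF', by simp, hvt, htw⟩
  -- The trek from `v` may still leave by a wrong branch. But some trek `{p,y}` now has the branch
  -- pair of `{v,w}`, and as `p` and `v` share a branch, the treks `{v,t}` and `{p,y}` can be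
  -- exchanged into `{v,y}` and `{t,p}`.
  have hmem : s(E.branch u v, E.branch u w) ∈ (s(v, t) ::ₘ K).map (Sym2.map (E.branch u)) := by
    rw [hF'N, branches, Multiset.mem_map]
    exact ⟨s(v, w), Multiset.mem_filter.2 ⟨hw, mk_mem_passing.2 hwu⟩, rfl⟩
  obtain ⟨p, y, hpy, hp, hy⟩ : ∃ p y, s(p, y) ∈ s(v, t) ::ₘ K ∧ E.branch u p = E.branch u v ∧
      E.branch u y = E.branch u w := by
    obtain ⟨z, hz, hz'⟩ := Multiset.mem_map.1 hmem
    induction z using Sym2.ind with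
    | _ p y =>
    rcases Sym2.eq_iff.1 hz' with ⟨h1, h2⟩ | ⟨h1, h2⟩
    · exact ⟨p, y, hz, h1, h2⟩
    · exact ⟨y, p, Sym2.eq_swap (a := p) ▸ hz, h2, h1⟩
  have hpyb := hF' p y hpy
  have hpyK : s(p, y) ∈ K := by
    refine (Multiset.mem_cons.1 hpy).resolve_left fun heq => htw ?_
    rcases Sym2.eq_iff.1 heq with ⟨rfl, rfl⟩ | ⟨rfl, rfl⟩
    · exact hy
    · rw [hp, hy]
  obtain ⟨K, rfl⟩ := Multiset.exists_cons_of_mem hpyK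
  have hvy : E.Btw v u y := by
    have := hpyb.passes
    rw [hp] at this
    exact this.btw_of_branch hvt.left hpyb.right.symm
  have htp : E.Btw t u p := by
    have := hvt.passes
    rw [← hp] at this
    exact (this.btw_of_branch hpyb.left hvt.right.symm).symm
  refine ⟨s(v, y) ::ₘ s(t, p) ::ₘ K + R, y, hMF'.tail ⟨u, ?_⟩, by simp, hvy, hy⟩
  exact Switch.add ⟨v, t, y, p, K, by rw [Sym2.eq_swap (a := y)], rfl, hvt, hpyb.symm, hvy, htp⟩ R

/-- A trek starting at `v` is made to follow the trek to `w` one vertex further at a time; `deg u w`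
measures the remaining distance. -/
theorem exists_moves_mem [Finite V] {M N : Multiset (Sym2 V)} (hM : G.AllTreks M)
    (hN : G.AllTreks N) (h : E.totalExp M = E.totalExp N) (hw : s(v, w) ∈ N) :
    ∃ M', Relation.ReflTransGen E.Move M M' ∧ s(v, w) ∈ M' := by
  suffices key : ∀ n M u x, E.deg u w = n → G.AllTreks M → E.totalExp M = E.totalExp N →
      s(v, x) ∈ M → E.Btw v u x → E.Btw v u w →
      ∃ M', Relation.ReflTransGen E.Move M M' ∧ s(v, w) ∈ M' by
    have hv : v ∈ ends M := by
      rw [ends_eq_of_totalExp hM hN h, mem_ends]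
      exact ⟨_, hw, by simp⟩
    obtain ⟨x, K, rfl⟩ := exists_cons_of_mem_ends hv
    exact key _ _ v x rfl hM h (Multiset.mem_cons_self _ _)
      (btw_left (hM v x (Multiset.mem_cons_self _ _))) (btw_left (hN v w hw))
  intro n
  induction n using Nat.strong_induction_on with
  | _ n ih =>
  intro M u x hn hM h hx hxu hwu
  obtain ⟨M', y, hMM', hy, hyu, hyw⟩ := exists_moves_branch hM hN h hx hxu hw hwu
  by_cases huw : u = w
  · subst huw
    rw [branch_self, E.branch_eq_self_iff hyu.right.symm] at hyw
    subst hyw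
    exact ⟨M', hMM', hy⟩
  · have h1 := E.branch_spec hwu.right.symm (Ne.symm huw)
    have h2 := E.btw_branch hyu.right.symm
    rw [hyw] at h2
    have h3 := h1.2.deg_eq
    rw [deg_of_adjacent h1.1, E.deg_comm w u, E.deg_comm w] at h3
    obtain ⟨M'', hM'', hmem⟩ := ih _ (by omega) M' _ y rfl (moves_allTreks hMM' hM)
      ((moves_totalExp hMM').symm.trans h) hy (hyu.trans h2.symm).2 (hwu.trans h1.2.symm).2
    exact ⟨M'', hMM'.trans hM'', hmem⟩

/-- Products of shortest treks with the same exponent vector are connected by moves. -/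
theorem moves_of_totalExp_eq [Finite V] {M N : Multiset (Sym2 V)} (hM : G.AllTreks M)
    (hN : G.AllTreks N) (h : E.totalExp M = E.totalExp N) : Relation.ReflTransGen E.Move M N := by
  induction N using Multiset.induction generalizing M with
  | empty =>
    rcases Multiset.empty_or_exists_mem M with rfl | ⟨z, hz⟩
    · exact .refl
    · obtain ⟨M, rfl⟩ := Multiset.exists_cons_of_mem hz
      induction z using Sym2.ind with
      | _ x y =>
      -- Every trek contributes its top to the exponent, so a nonempty product cannot have exponent
      -- zero.
      have h1 := E.deg_pos (hM x y (Multiset.mem_cons_self _ _))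
      have h2 := congrArg Finsupp.degree h
      rw [totalExp_cons, map_add, totalExp_zero, map_zero] at h2
      rw [deg] at h1
      omega
  | cons z N ih =>
    induction z using Sym2.ind with
    | _ v w =>
    obtain ⟨M', hMM', hmem⟩ := exists_moves_mem hM hN h (Multiset.mem_cons_self _ _)
    obtain ⟨K, rfl⟩ := Multiset.exists_cons_of_mem hmem
    have h1 := (moves_totalExp hMM').symm.trans h
    rw [totalExp_cons, totalExp_cons] at h1
    refine hMM'.trans ((ih (moves_allTreks hMM' hM).of_cons hN.of_cons
      (add_left_cancel h1)).lift (s(v, w) ::ₘ ·) ?_)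
    rintro A B ⟨u, h⟩
    exact ⟨u, by simpa [Multiset.add_comm _ {s(v, w)}] using h.add {s(v, w)}⟩

end TrekExponents

end DAG
end
noncomputable section

open Sym2Multiset

namespace DAG

variable {V : Type*} {G : DAG V}

/-! ### Exponents of the shortest treks -/

/-- A finite DAG has an injective rank function that increases along the edges. -/
theorem exists_rank [Finite V] (G : DAG V) : ∃ rank : V → ℕ, Function.Injective rank ∧
    ∀ i j, G.edge i j → rank i < rank j := by
  classical
  cases nonempty_fintype V
  let e := Fintype.equivFin V
  let f : V → ℕ := fun v => {a | Relation.TransGen G.edge a v}.ncard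
  -- The number of proper ancestors increases strictly along edges; the index below `card V` breaks
  -- ties.
  refine ⟨fun v => f v * Fintype.card V + e v, fun v w h => ?_, fun i j h => ?_⟩
  · have h1 := congrArg (· % Fintype.card V) h
    simp only [Nat.mul_add_mod_self_right, Nat.mod_eq_of_lt (e v).2,
      Nat.mod_eq_of_lt (e w).2] at h1
    exact e.injective (Fin.ext h1)
  · have h1 : f i < f j := by
      refine Set.ncard_lt_ncard ⟨fun a ha => ha.tail h, fun hs => G.acyclic i ?_⟩ (Set.toFinite _)
      exact hs (a := i) (.single h)
    have h2 : (f i + 1) * Fintype.card V ≤ f j * Fintype.card V := Nat.mul_le_mul_right _ h1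
    have h3 := (e i).2
    simp only [add_mul] at h2
    change f i * _ + _ < f j * _ + _
    omega

/-- The step property yields exponent vectors of the shortest treks. -/
theorem exists_trekExponents [Finite V] (hG : G.HasUniqueShortestTreks) (hS : G.StepProperty) :
    ∃ E : TrekExponents G, ∀ i j, G.CommonAncestor i j →
      G.shortestTrekMonomial s(i, j) = monomial (E.exp i j) 1 := by
  obtain ⟨rank, hinj, hlt⟩ := G.exists_rank
  have hz : ∀ z, ∃ m, G.shortestTrekMonomial z ≠ 0 →
      G.shortestTrekMonomial z = monomial m 1 := by
    intro z
    induction z using Sym2.ind with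
    | _ i j =>
    by_cases h : G.CommonAncestor i j
    · obtain ⟨T, hT⟩ := exists_isShortest h
      exact ⟨T.exp, fun _ => by rw [shortestTrekMonomial_of_isShortest hG T hT, T.monomial_eq]⟩
    · exact ⟨0, fun h' => absurd (shortestTrekMonomial_of_not h) h'⟩
  choose f hf using hz
  have hψ : ∀ {i j}, G.CommonAncestor i j →
      G.shortestTrekMonomial s(i, j) = monomial (f s(i, j)) 1 :=
    fun h => hf _ (hG.shortestTrekMonomial_ne_zero.2 h)
  have hinj' : Function.Injective fun m : V ⊕ V × V →₀ ℕ => monomial m (1 : ℂ) :=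
    monomial_left_injective one_ne_zero
  have htrans : ∀ {i j}, Relation.TransGen G.edge i j → rank i < rank j := by
    intro i j h
    induction h with
    | single h => exact hlt _ _ h
    | tail _ h ih => exact ih.trans (hlt _ _ h)
  refine ⟨⟨rank, hinj, hlt _ _, fun i j => f s(i, j), fun i j => by rw [Sym2.eq_swap],
    fun v => ?_, fun {i j} hr h => ?_⟩, fun i j => hψ⟩
  · apply hinj'
    dsimp only
    rw [← hψ (commonAncestor_refl v), hG.shortestTrekMonomial_self, X]
  · obtain ⟨s, h1, h2, h3⟩ := hS i j (fun h => hr.ne (congrArg rank h))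
      (fun h => (hr.trans (htrans h)).false) h
    have his : G.CommonAncestor i s := by
      rw [← hG.shortestTrekMonomial_ne_zero]
      intro h0
      rw [h0, zero_mul] at h2
      exact hG.shortestTrekMonomial_ne_zero.2 h h2
    refine ⟨s, h1, his, ?_, fun p hp => ?_⟩
    · apply hinj'
      rw [hψ h, hψ his, X, monomial_mul, mul_one] at h2
      exact h2
    · have h4 := h3 p hp
      have hiff : G.CommonAncestor i p ↔ G.CommonAncestor s p := by
        rw [← hG.shortestTrekMonomial_ne_zero, ← hG.shortestTrekMonomial_ne_zero]
        have hx : (X (Sum.inl s) : MvPolynomial (V ⊕ V × V) ℂ) ≠ 0 := X_ne_zero _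
        have hs := hG.shortestTrekMonomial_ne_zero.2 his
        rw [← mul_ne_zero_iff_right hx, h4, mul_ne_zero_iff_left hs]
      refine ⟨hiff, fun hip => hinj' ?_⟩
      rw [hψ hip, hψ his, hψ (hiff.1 hip), X, monomial_mul, monomial_mul, mul_one] at h4
      exact h4

/-! ### d-separation by single vertices -/

/-- A path leads from `i` to a vertex with a trek to `i`, which is its end or a collider. -/
theorem exists_commonAncestor_of_isChain {i x : V} {l : List V}
    (h : (x :: l).IsChain fun a b => G.edge a b ∨ G.edge b a)
    (hx : Relation.ReflTransGen G.edge x i) :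
    ∃ k, G.CommonAncestor i k ∧ ((x :: l).getLast? = some k ∨ G.IsColliderOn (x :: l) k) := by
  induction l generalizing x with
  | nil => exact ⟨x, ⟨x, hx, .refl⟩, Or.inl rfl⟩
  | cons y l ih =>
    rcases (List.isChain_cons_cons.1 h).1 with e | e
    · obtain ⟨k, hk, hk'⟩ := exists_descendant_of_edge h e
      exact ⟨k, ⟨x, hx, hk.to_reflTransGen⟩, hk'⟩
    · obtain ⟨k, hk, hk'⟩ := ih (List.isChain_cons_cons.1 h).2 (.head e hx)
      refine ⟨k, hk, hk'.imp (fun h => by rwa [List.getLast?_cons_cons]) ?_⟩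
      rintro ⟨a, b, hab, h⟩
      exact ⟨a, b, hab.trans (List.suffix_cons _ _).isInfix, h⟩

/-- A path with given ends that is not blocked by `c`. -/
structure IsActive (G : DAG V) (c : V) (p : List V) (i j : V) : Prop where
  isPath : G.IsPath p
  head : p.head? = some i
  last : p.getLast? = some j
  ne : ∀ k ∈ p, ¬ G.IsColliderOn p k → k ≠ c
  desc : ∀ k ∈ p, G.IsColliderOn p k → Relation.ReflTransGen G.edge k c

theorem dSeparates_singleton_of {A B : Finset V} {c : V}
    (h : ∀ i ∈ A, ∀ j ∈ B, ∀ p, ¬ G.IsActive c p i j) : G.DSeparates {c} A B := by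
  rintro p hp ⟨i, hi, hpi⟩ ⟨j, hj, hpj⟩
  by_contra! hc
  refine h i hi j hj p ⟨hp, hpi, hpj, fun k hk hk' hkc => (hc k hk).1 hk' (by simp [hkc]),
    fun k hk hk' => ?_⟩
  obtain ⟨m, hm, hmc⟩ := (hc k hk).2 hk'
  rwa [Finset.mem_singleton.1 hmc] at hm

theorem IsActive.reverse {c i j : V} {p : List V} (h : G.IsActive c p i j) :
    G.IsActive c p.reverse j i where
  isPath := isPath_reverse h.isPath
  head := by simpa using h.last
  last := by simpa using h.head
  ne k hk hk' := h.ne k (by simpa using hk) (by rwa [isColliderOn_reverse] at hk')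
  desc k hk hk' := h.desc k (by simpa using hk) (by rwa [isColliderOn_reverse] at hk')

/-- Up to its end or its first collider the path forms a trek from `i`, and on an active path every
collider is an ancestor of `c`. -/
theorem IsActive.commonAncestor {c i j : V} {p : List V} (h : G.IsActive c p i j) :
    G.CommonAncestor i j ∨ G.CommonAncestor i c := by
  obtain ⟨⟨hne, hn, hch⟩, hhead, hlast, h1, h2⟩ := h
  cases p with
  | nil => exact absurd rfl hne
  | cons x l =>
    obtain rfl : x = i := by simpa using hhead
    obtain ⟨k, hk, hk' | hk'⟩ := exists_commonAncestor_of_isChain hch .refl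
    · rw [hlast, Option.some.injEq] at hk'
      subst hk'
      exact Or.inl hk
    · refine Or.inr (hk.trans_right (h2 k ?_ hk'))
      obtain ⟨a, b, hab, -⟩ := hk'
      exact hab.subset (by simp)

theorem IsColliderOn.mem {p : List V} {k : V} (h : G.IsColliderOn p k) : k ∈ p := by
  obtain ⟨a, b, hab, -⟩ := h
  exact hab.subset (by simp)

/-- Removing the first edge from an active path, if it points to the first vertex. -/
theorem IsActive.tail {c i j q : V} {l : List V} (h : G.IsActive c (j :: q :: l) j i)
    (e : G.edge q j) : G.IsActive c (q :: l) q i ∧ q ≠ c := by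
  have hq : ¬ G.IsColliderOn (j :: q :: l) q := by
    rintro ⟨a, b, hab, ha, -⟩
    obtain rfl := h.isPath.2.1.eq_of_infix_triple hab
    exact G.acyclic a (.head ha (.single e))
  have hmem : ∀ k ∈ q :: l, k ∈ j :: q :: l := fun k hk => List.mem_cons_of_mem _ hk
  refine ⟨⟨⟨by simp, (List.nodup_cons.1 h.isPath.2.1).2, (List.isChain_cons_cons.1
    h.isPath.2.2).2⟩, rfl, by simpa [List.getLast?_cons_cons] using h.last,
    fun k hk hk' => h.ne k (hmem k hk) ?_, fun k hk hk' => h.desc k (hmem k hk) ?_⟩,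
    h.ne q (by simp) hq⟩
  · rintro ⟨a, b, hab, hab'⟩
    rcases List.infix_cons_iff.1 hab with h' | h'
    · have h1 := List.cons_prefix_cons.1 (List.cons_prefix_cons.1 h').2
      obtain rfl := h1.1
      exact hq ⟨a, b, hab, hab'⟩
    · exact hk' ⟨a, b, h', hab'⟩
  · obtain ⟨a, b, hab, hab'⟩ := hk'
    exact ⟨a, b, hab.trans (List.suffix_cons _ _).isInfix, hab'⟩

theorem TrekExponents.rank_le {E : TrekExponents G} {i j : V}
    (h : Relation.ReflTransGen G.edge i j) : E.rank i ≤ E.rank j := by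
  induction h with
  | refl => exact le_rfl
  | tail _ h ih => exact ih.trans (E.rank_lt h).le

/-- An interior vertex of the shortest trek blocks all paths between its ends. -/
theorem TrekExponents.Btw.not_isActive {E : TrekExponents G} {i j c : V} (h : E.Btw i c j)
    (hi : c ≠ i) (hj : c ≠ j) (p : List V) : ¬ G.IsActive c p i j := by
  suffices key : ∀ n i j, E.rank i + E.rank j = n → E.rank i < E.rank j → E.Btw i c j → c ≠ i →
      c ≠ j → ∀ p, ¬ G.IsActive c p j i by
    rcases lt_trichotomy (E.rank i) (E.rank j) with hlt | heq | hlt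
    · exact fun hp => key _ i j rfl hlt h hi hj _ hp.reverse
    · obtain rfl := E.rank_injective heq
      exact absurd h.eq_of_self hi
    · exact key _ j i rfl hlt h.symm hj hi p
  intro n
  induction n using Nat.strong_induction_on with
  | _ n ih =>
  intro i j hn hlt h hi hj p hp
  obtain ⟨s, hs⟩ := E.exists_pred hlt h.anc
  cases p with
  | nil => exact hp.isPath.1 rfl
  | cons x l =>
  obtain rfl : x = j := by simpa using hp.head
  cases l with
  | nil =>
    obtain rfl : x = i := by simpa using hp.last
    exact hi h.eq_of_self
  | cons q l =>
  have hcx := h.rank_lt_of_lt hlt hj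
  rcases (List.isChain_cons_cons.1 hp.isPath.2.2).1 with e | e
  -- The path leaves the end of larger rank along an outgoing edge, so it meets a descendant of
  -- larger rank still. That can be neither the other end nor a collider, which would be an ancestor
  -- of `c`.
  · obtain ⟨k, hk, hk'⟩ := exists_descendant_of_edge hp.isPath.2.2 e
    have hxk : E.rank x < E.rank k := by
      obtain ⟨y, hy, hyk⟩ := Relation.TransGen.head'_iff.1 hk
      exact (E.rank_lt hy).trans_le (rank_le hyk)
    rcases hk' with hk' | hk'
    · rw [hp.last, Option.some.injEq] at hk'
      subst hk'
      omega
    · have := rank_le (E := E) (hp.desc k hk'.mem hk')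
      omega
  -- The path arrives from a parent `q`, and the first vertex is dropped. If `i` and `q` have a
  -- trek, then `c` lies on the shortest one and induction applies. If not, then `c` and `q` have
  -- none either by the parent conditions, but an active path from `q` to `i` requires one of the
  -- two.
  · obtain ⟨hq, hqc⟩ := hp.tail e
    have hcs := h.pred hs hj
    have hics := h.btw_pred hs hj
    by_cases hiq : G.CommonAncestor i q
    · have h1 := ((hs.parent_btw e hiq).symm.trans hics.symm).2
      by_cases hne : q = i
      · subst hne
        exact hi h1.eq_of_self
      have hqx := E.rank_lt e
      rcases lt_trichotomy (E.rank i) (E.rank q) with hlt' | heq | hlt'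
      · exact ih _ (by omega) i q rfl hlt' h1.symm hi hqc.symm _ hq
      · exact hne (E.rank_injective heq).symm
      · exact ih _ (by omega) q i rfl hlt' h1 hqc.symm hi _ hq.reverse
    · have hcq : ¬ G.CommonAncestor c q := fun h' =>
        hiq ((hs.iff q e).2 ((hcs.iff q e).1 h'))
      rcases hq.commonAncestor with h' | h'
      · exact hiq h'.symm
      · exact hcq h'.symm

theorem dSeparates_empty {i j : V} (h : ¬ G.CommonAncestor i j) : G.DSeparates ∅ {i} {j} := by
  rintro p hp ⟨i', hi', hpi⟩ ⟨j', hj', hpj⟩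
  rw [Finset.mem_singleton] at hi' hj'
  subst hi' hj'
  cases p with
  | nil => exact absurd rfl hp.1
  | cons x l =>
    obtain rfl : x = i' := by simpa using hpi
    obtain ⟨k, hk, hk' | hk'⟩ := exists_commonAncestor_of_isChain hp.2.2 .refl
    · rw [hpj, Option.some.injEq] at hk'
      subst hk'
      exact absurd hk h
    · exact ⟨k, hk'.mem, Or.inr ⟨hk', fun _ _ => by simp⟩⟩

/-! ### The quadratic ideal -/

variable [DecidableEq V]

/-- The ideal generated by the vanishing indeterminates and the single vertex minors. -/
def quadraticIdeal (G : DAG V) : Ideal (MvPolynomial (Sym2 V) ℂ) :=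
  Ideal.span (G.noTrekVariables ∪ G.singleVertexMinors)

/-- The two kinds of generators are the minors for separating sets of sizes 0 and 1. -/
theorem quadraticIdeal_le_ciIdeal : G.quadraticIdeal ≤ G.ciIdeal := by
  have hinj : ∀ {a b : V}, a ≠ b → Function.Injective (![a, b] : Fin 2 → V) := by
    intro a b hab x y
    fin_cases x <;> fin_cases y <;> simp [hab, hab.symm]
  refine Ideal.span_le.2 (Set.union_subset ?_ ?_)
  · rintro _ ⟨i, j, hij, rfl⟩
    have hca : ¬ G.CommonAncestor i j := fun h => by
      obtain ⟨T⟩ := nonempty_trek_iff.2 h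
      exact hij.false T
    have hne : i ≠ j := by rintro rfl; exact hca (commonAncestor_refl i)
    refine Ideal.subset_span ⟨{i}, {j}, ∅, by simpa using hne, by simp, by simp,
      dSeparates_empty hca, fun _ => i, fun _ => j, ?_, ?_, by simp, by simp, ?_⟩
    · exact Function.injective_of_subsingleton (α := Fin 1) _
    · exact Function.injective_of_subsingleton (α := Fin 1) _
    · exact (Matrix.det_fin_one (((sigmaMatrix V).submatrix (fun _ : Fin 1 => i)
        fun _ : Fin 1 => j))).symm
  · rintro _ ⟨A, B, c, hAB, hcA, hcB, hd, i, hi, j, hj, k, hk, l, hl, hij, hkl, rfl⟩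
    refine Ideal.subset_span ⟨A, B, {c}, hAB, by simpa using hcA, by simpa using hcB, hd,
      (![i, j] : Fin 2 → V), (![k, l] : Fin 2 → V), ?_, ?_, ?_, ?_, ?_⟩
    · exact hinj hij
    · exact hinj hkl
    · intro a
      rw [Finset.union_comm, ← Finset.insert_eq]
      fin_cases a
      exacts [hi, hj]
    · intro a
      rw [Finset.union_comm, ← Finset.insert_eq]
      fin_cases a
      exacts [hk, hl]
    · exact (Matrix.det_fin_two ((sigmaMatrix V).submatrix (![i, j] : Fin 2 → V)
        (![k, l] : Fin 2 → V))).symm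

namespace TrekExponents

variable {E : TrekExponents G}

/-- The binomial is the minor with rows `x, w` and columns `y, z`: by hypothesis `u` lies between
every row and every column, so it separates them. Rows or columns equal to `u` are supplied by the
bordering with `u`, hence the erasures. -/
theorem switch_mem_quadraticIdeal {u x y z w : V} (h1 : E.Btw x u y) (h2 : E.Btw z u w)
    (h3 : E.Btw x u z) (h4 : E.Btw y u w) :
    (X s(x, y) * X s(z, w) - X s(x, z) * X s(y, w) : MvPolynomial (Sym2 V) ℂ) ∈
      G.quadraticIdeal := by
  by_cases hxw : x = w
  · subst hxw
    rw [Sym2.eq_swap (a := z), Sym2.eq_swap (a := y), mul_comm, sub_self]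
    exact zero_mem _
  by_cases hyz : y = z
  · subst hyz
    rw [sub_self]
    exact zero_mem _
  refine Ideal.subset_span (Or.inr ⟨({x, w} : Finset V).erase u, ({y, z} : Finset V).erase u, u,
    ?_, by simp, by simp, dSeparates_singleton_of ?_, x, ?_, w, ?_, y, ?_, z, ?_, hxw, hyz, ?_⟩)
  · rw [Finset.disjoint_left]
    have hb : ∀ {v}, v ≠ u → ¬ E.Btw v u v := fun hv h => hv h.eq_of_self.symm
    simp only [Finset.mem_erase, Finset.mem_insert, Finset.mem_singleton]
    rintro v ⟨hv, rfl | rfl⟩ ⟨-, rfl | rfl⟩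
    exacts [hb hv h1, hb hv h3, hb hv h4, hb hv h2]
  · simp only [Finset.mem_erase, Finset.mem_insert, Finset.mem_singleton]
    rintro i ⟨hi, rfl | rfl⟩ j ⟨hj, rfl | rfl⟩ p
    exacts [h1.not_isActive hi.symm hj.symm p, h3.not_isActive hi.symm hj.symm p,
      h4.symm.not_isActive hi.symm hj.symm p, h2.symm.not_isActive hi.symm hj.symm p]
  · by_cases h : x = u <;> simp [h]
  · by_cases h : w = u <;> simp [h]
  · by_cases h : y = u <;> simp [h]
  · by_cases h : z = u <;> simp [h]
  · rw [Sym2.eq_swap (a := z), Sym2.eq_swap (a := y) (b := w)]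

theorem Move.sub_mem {M N : Multiset (Sym2 V)} (h : E.Move M N) :
    ((M.map X).prod - (N.map X).prod : MvPolynomial (Sym2 V) ℂ) ∈ G.quadraticIdeal := by
  obtain ⟨u, x, y, z, w, R, rfl, rfl, h1, h2, h3, h4⟩ := h
  simp only [Multiset.map_cons, Multiset.prod_cons]
  rw [← mul_assoc, ← mul_assoc, ← sub_mul]
  exact Ideal.mul_mem_right _ _ (switch_mem_quadraticIdeal h1 h2 h3 h4)

theorem sub_mem_of_moves {M N : Multiset (Sym2 V)} (h : Relation.ReflTransGen E.Move M N) :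
    ((M.map X).prod - (N.map X).prod : MvPolynomial (Sym2 V) ℂ) ∈ G.quadraticIdeal := by
  induction h with
  | refl => rw [sub_self]; exact zero_mem _
  | tail _ h ih => simpa using add_mem ih h.sub_mem

theorem prod_mem_of_not_allTreks {M : Multiset (Sym2 V)} (h : ¬ G.AllTreks M) :
    ((M.map X).prod : MvPolynomial (Sym2 V) ℂ) ∈ G.quadraticIdeal := by
  simp only [AllTreks, not_forall] at h
  obtain ⟨x, y, hxy, h⟩ := h
  obtain ⟨R, rfl⟩ := Multiset.exists_cons_of_mem hxy
  rw [Multiset.map_cons, Multiset.prod_cons]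
  exact Ideal.mul_mem_right _ _ (Ideal.subset_span (Or.inl ⟨x, y,
    not_nonempty_iff.1 fun h' => h (nonempty_trek_iff.1 h'), rfl⟩))

omit [DecidableEq V] in
theorem shortestTrekMap_prod (hE : ∀ i j, G.CommonAncestor i j →
    G.shortestTrekMonomial s(i, j) = monomial (E.exp i j) 1) {M : Multiset (Sym2 V)}
    (h : G.AllTreks M) :
    G.shortestTrekMap (M.map X).prod = monomial (E.totalExp M) 1 := by
  induction M using Multiset.induction with
  | empty => simp
  | cons z M ih =>
    induction z using Sym2.ind with
    | _ x y =>
    rw [Multiset.map_cons, Multiset.prod_cons, map_mul, ih h.of_cons, shortestTrekMap_X,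
      hE x y (h x y (Multiset.mem_cons_self _ _)), monomial_mul, one_mul, totalExp_cons]

omit [DecidableEq V] in
theorem shortestTrekMap_prod_of_not {M : Multiset (Sym2 V)} (h : ¬ G.AllTreks M) :
    G.shortestTrekMap (M.map X).prod = 0 := by
  simp only [AllTreks, not_forall] at h
  obtain ⟨x, y, hxy, h⟩ := h
  obtain ⟨R, rfl⟩ := Multiset.exists_cons_of_mem hxy
  rw [Multiset.map_cons, Multiset.prod_cons, map_mul, shortestTrekMap_X,
    shortestTrekMonomial_of_not h, zero_mul]

/-- A linear map `g` back to the quotient sends a monomial to the class of any product of treks with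
this image. By connectedness under moves the choice does not matter, so `g ∘ ψ` is the quotient map
and the kernel of `ψ` lies in the quadratic ideal. -/
theorem shortestTrekIdeal_le [Finite V] (hE : ∀ i j, G.CommonAncestor i j →
    G.shortestTrekMonomial s(i, j) = monomial (E.exp i j) 1) :
    G.shortestTrekIdeal ≤ G.quadraticIdeal := by
  classical
  let mk := Ideal.Quotient.mkₐ ℂ G.quadraticIdeal
  let g : MvPolynomial (V ⊕ V × V) ℂ →ₗ[ℂ] MvPolynomial (Sym2 V) ℂ ⧸ G.quadraticIdeal :=
    (basisMonomials _ ℂ).constr ℂ fun t =>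
      if h : ∃ M, G.AllTreks M ∧ E.totalExp M = t then mk (h.choose.map X).prod else 0
  have hg : g ∘ₗ G.shortestTrekMap.toLinearMap = mk.toLinearMap := by
    refine (basisMonomials _ ℂ).ext fun m => ?_
    have hm : (monomial m 1 : MvPolynomial (Sym2 V) ℂ) = ((Finsupp.toMultiset m).map X).prod := by
      rw [monomial_eq, C_1, one_mul, Finsupp.toMultiset_map, Finsupp.prod_toMultiset,
        Finsupp.prod_mapDomain_index (fun _ => pow_zero _) fun _ _ _ => pow_add _ _ _]
    simp only [coe_basisMonomials, LinearMap.comp_apply, AlgHom.toLinearMap_apply, hm]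
    generalize Finsupp.toMultiset m = M
    by_cases hM : G.AllTreks M
    · rw [shortestTrekMap_prod hE hM]
      have h : ∃ N, G.AllTreks N ∧ E.totalExp N = E.totalExp M := ⟨M, hM, rfl⟩
      have h1 : g (monomial (E.totalExp M) 1) = mk (h.choose.map X).prod := by
        have := (basisMonomials (V ⊕ V × V) ℂ).constr_basis ℂ (fun t =>
          if h : ∃ M, G.AllTreks M ∧ E.totalExp M = t then mk (h.choose.map X).prod else 0)
          (E.totalExp M)
        rw [coe_basisMonomials, dif_pos h] at this
        exact this
      rw [h1]
      exact Ideal.Quotient.eq.2 (sub_mem_of_moves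
        (moves_of_totalExp_eq h.choose_spec.1 hM h.choose_spec.2))
    · rw [shortestTrekMap_prod_of_not hM, map_zero]
      exact (Ideal.Quotient.eq_zero_iff_mem.2 (prod_mem_of_not_allTreks hM)).symm
  intro f hf
  have h1 := LinearMap.congr_fun hg f
  rw [LinearMap.comp_apply, AlgHom.toLinearMap_apply, RingHom.mem_ker.1 hf, map_zero] at h1
  exact Ideal.Quotient.eq_zero_iff_mem.1 h1.symm

end TrekExponents

end DAG
end
noncomputable section

namespace DAG

variable {V : Type*} {G : DAG V}

/-! ### Paths that are not blocked -/

/-- `v` is an ancestor of the set `S` (possibly an element of it). -/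
def IsAncestor (G : DAG V) (S : Finset V) (v : V) : Prop :=
  ∃ s ∈ S, Relation.ReflTransGen G.edge v s

theorem IsAncestor.of_edge {S : Finset V} {v w : V} (h : G.IsAncestor S w) (e : G.edge v w) :
    G.IsAncestor S v := by
  obtain ⟨s, hs, hw⟩ := h
  exact ⟨s, hs, .head e hw⟩

theorem isAncestor_of_mem {S : Finset V} {v : V} (h : v ∈ S) : G.IsAncestor S v := ⟨v, h, .refl⟩

/-- A path to a vertex of `A` none of whose interior vertices is blocked by `S`. -/
structure IsConnecting (G : DAG V) (S A : Finset V) (p : List V) : Prop where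
  isPath : G.IsPath p
  last : ∃ a ∈ A, p.getLast? = some a
  collider : ∀ u v w, [u, v, w] <:+: p → G.edge u v → G.edge w v → G.IsAncestor S v
  noncollider : ∀ u v w, [u, v, w] <:+: p → ¬ (G.edge u v ∧ G.edge w v) → v ∉ S

/-- A path from `x` to a vertex of `A` is not blocked by `S`. -/
def Connects (G : DAG V) (S A : Finset V) (x : V) : Prop := ∃ l, G.IsConnecting S A (x :: l)

variable {S A B : Finset V}

theorem IsConnecting.suffix {p q : List V} (h : G.IsConnecting S A p) (hq : q <:+ p)
    (hne : q ≠ []) : G.IsConnecting S A q where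
  isPath := ⟨hne, h.isPath.2.1.sublist hq.sublist, h.isPath.2.2.suffix hq⟩
  last := by
    obtain ⟨a, ha, hpa⟩ := h.last
    obtain ⟨t, rfl⟩ := hq
    rw [List.getLast?_append_of_ne_nil _ hne] at hpa
    exact ⟨a, ha, hpa⟩
  collider u v w huv := h.collider u v w (huv.trans hq.isInfix)
  noncollider u v w huv := h.noncollider u v w (huv.trans hq.isInfix)

theorem IsConnecting.exists_suffix {p : List V} {y : V} (h : G.IsConnecting S A p) (hy : y ∈ p) :
    ∃ t l, t ++ y :: l = p ∧ G.IsConnecting S A (y :: l) := by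
  obtain ⟨t, l, rfl⟩ := List.append_of_mem hy
  exact ⟨t, l, rfl, h.suffix (List.suffix_append _ _) (by simp)⟩

theorem IsConnecting.connects_of_mem {p : List V} {y : V} (h : G.IsConnecting S A p)
    (hy : y ∈ p) : G.Connects S A y := by
  obtain ⟨t, l, -, h⟩ := h.exists_suffix hy
  exact ⟨l, h⟩

theorem IsConnecting.cons {x y : V} {l : List V} (h : G.IsConnecting S A (x :: l))
    (hy : y ∉ x :: l) (e : G.edge x y ∨ G.edge y x)
    (h1 : ∀ z, l.head? = some z → G.edge y x → G.edge z x → G.IsAncestor S x)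
    (h2 : ∀ z, l.head? = some z → ¬ (G.edge y x ∧ G.edge z x) → x ∉ S) :
    G.IsConnecting S A (y :: x :: l) := by
  have hinf : ∀ {u v w}, [u, v, w] <:+: y :: x :: l →
      (u = y ∧ v = x ∧ l.head? = some w) ∨ [u, v, w] <:+: x :: l := by
    intro u v w huv
    rcases List.infix_cons_iff.1 huv with h' | h'
    · have h3 := List.cons_prefix_cons.1 h'
      have h4 := List.cons_prefix_cons.1 h3.2
      refine Or.inl ⟨h3.1, h4.1, ?_⟩
      obtain ⟨t, ht⟩ := h4.2
      rw [← ht]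
      rfl
    · exact Or.inr h'
  obtain ⟨a, ha, hla⟩ := h.last
  refine ⟨⟨by simp, List.nodup_cons.2 ⟨hy, h.isPath.2.1⟩,
    List.isChain_cons_cons.2 ⟨e.symm, h.isPath.2.2⟩⟩, ⟨a, ha, ?_⟩, ?_, ?_⟩
  · rwa [List.getLast?_cons_cons]
  · intro u v w huv hu hw
    rcases hinf huv with ⟨rfl, rfl, h'⟩ | h'
    exacts [h1 w h' hu hw, h.collider u v w h' hu hw]
  · intro u v w huv hu
    rcases hinf huv with ⟨rfl, rfl, h'⟩ | h'
    exacts [h2 w h' hu, h.noncollider u v w h' hu]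

/-- An edge `x → y` keeps `x` from being a collider when `y` is prepended. If `y` is already on the
path, its final part starting at `y` serves. -/
theorem Connects.of_edge {x y : V} (h : G.Connects S A x) (hx : x ∉ S) (e : G.edge x y) :
    G.Connects S A y := by
  obtain ⟨l, h⟩ := h
  by_cases hy : y ∈ x :: l
  · exact h.connects_of_mem hy
  · exact ⟨_, h.cons hy (Or.inl e)
      (fun z _ h' _ => absurd (.head h' (.single e)) (G.acyclic y)) (fun _ _ _ => hx)⟩

theorem Connects.of_reflTransGen {x y : V} (h : G.Connects S A x) (hx : ¬ G.IsAncestor S x)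
    (e : Relation.ReflTransGen G.edge x y) : G.Connects S A y := by
  induction e using Relation.ReflTransGen.head_induction_on with
  | refl => exact h
  | head e e' ih =>
    exact ih (h.of_edge (fun h' => hx (isAncestor_of_mem h')) e) fun h' => hx (h'.of_edge e)

theorem connects_of_isDPath {y a : V} {l : List V} (h : G.IsDPath y l a) (ha : a ∈ A)
    (hl : ∀ v ∈ l, v ∉ S) : G.Connects S A y := by
  obtain ⟨h1, h2⟩ := isDPath_iff.1 h
  have hinf : ∀ {u v w}, [u, v, w] <:+: y :: l → G.edge u v ∧ G.edge v w ∧ v ∈ l := by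
    intro u v w huv
    have h3 := h1.infix huv
    refine ⟨(List.isChain_cons_cons.1 h3).1,
      (List.isChain_cons_cons.1 (List.isChain_cons_cons.1 h3).2).1, ?_⟩
    rcases List.infix_cons_iff.1 huv with h' | h'
    · exact (List.cons_prefix_cons.1 h').2.subset (by simp)
    · exact h'.subset (by simp)
  refine ⟨l, ⟨by simp, h.nodup, h1.imp fun _ _ => Or.inl⟩, ⟨a, ha, ?_⟩,
    fun u v w huv hu hw => ?_, fun u v w huv _ => hl v (hinf huv).2.2⟩
  · rw [List.getLast?_eq_getLast_of_ne_nil (List.cons_ne_nil _ _), h2]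
  · exact absurd (.head hw (.single (hinf huv).2.1)) (G.acyclic w)

theorem IsConnecting.of_collider {m y : V} {l : List V} (h : G.IsConnecting S A (m :: l))
    (e : G.edge y m) (hm : G.IsAncestor S m)
    (hl : m ∉ S ∨ ∀ z, l.head? = some z → G.edge z m) : G.Connects S A y := by
  by_cases hy : y ∈ m :: l
  · exact h.connects_of_mem hy
  · refine ⟨_, h.cons hy (Or.inr e) (fun _ _ _ _ => hm) fun z hz hz' => ?_⟩
    exact hl.resolve_right fun h' => hz' ⟨e, h' z hz⟩

/-- The vertices that are connected to `A` are closed under moral edges. -/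
theorem Connects.of_moral {x y m : V} (h : G.Connects S A x) (hx : x ∉ S)
    (hB : ∀ b ∈ B, ¬ G.Connects S A b)
    (hm : G.IsAncestor A m ∨ G.IsAncestor B m ∨ G.IsAncestor S m) (hxm : x = m ∨ G.edge x m)
    (hym : y = m ∨ G.edge y m) : G.Connects S A y := by
  have hcm : G.Connects S A m := by
    rcases hxm with rfl | e
    exacts [h, h.of_edge hx e]
  rcases hym with rfl | e
  · exact hcm
  -- If `m` is an ancestor of `S`, then `m` may serve as a collider on a path from `y`. When `m` is
  -- already on the path and belongs to `S`, it must be a collider there or the first vertex; the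
  -- latter is `x`, which is not in `S`, so the next edge also points to `m`.
  by_cases hmS : G.IsAncestor S m
  · rcases hxm with rfl | e'
    · obtain ⟨l, h⟩ := h
      exact h.of_collider e hmS (Or.inl hx)
    obtain ⟨l, h⟩ := h
    by_cases hml : m ∈ x :: l
    · obtain ⟨t, l', ht, h'⟩ := h.exists_suffix hml
      refine h'.of_collider e hmS (or_iff_not_imp_left.2 fun hm z hz => ?_)
      rw [not_not] at hm
      cases l' with
      | nil => simp at hz
      | cons z' l' =>
        obtain rfl : z' = z := by simpa using hz
        rcases List.eq_nil_or_concat t with rfl | ⟨t', u, rfl⟩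
        · obtain rfl : m = x := by simpa using congrArg List.head? ht
          exact absurd hm hx
        · have hinf : [u, m, z'] <:+: x :: l := ⟨t', l', by rw [← ht]; simp⟩
          by_contra hz
          exact h.noncollider u m z' hinf (fun h => hz h.2) hm
    · exact (h.cons hml (Or.inl e') (fun _ _ h' _ => absurd (.head h' (.single e')) (G.acyclic m))
        fun _ _ _ => hx).of_collider e hmS (Or.inr fun z hz => by
          obtain rfl : x = z := by simpa using hz
          exact e')
  -- Now descending paths from `m` avoid `S`. Descent into `A` gives a new path from `y`; descent
  -- into `B` would connect `A` with `B`.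
  · rcases hm with ⟨a, ha, hma⟩ | ⟨b, hb, hmb⟩ | hm
    · obtain ⟨l, hl⟩ := exists_isDPath hma
      refine connects_of_isDPath (l := m :: l) ⟨e, hl⟩ ha fun v hv hvS => hmS ?_
      obtain ⟨_, _, -, h', -⟩ := hl.mem_split hv
      exact ⟨v, hvS, h'.reflTransGen⟩
    · exact absurd (hcm.of_reflTransGen hmS hmb) (hB b hb)
    · exact absurd hm hmS

theorem exists_infix_triple {α : Type*} {p : List α} {k : α} (hk : k ∈ p) (h1 : p.head? ≠ some k)
    (h2 : p.getLast? ≠ some k) : ∃ u w, [u, k, w] <:+: p := by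
  obtain ⟨t, l, rfl⟩ := List.append_of_mem hk
  rcases List.eq_nil_or_concat t with rfl | ⟨t', u, rfl⟩
  · simp at h1
  cases l with
  | nil => simp at h2
  | cons w l => exact ⟨u, w, t', l, by simp⟩

theorem DSeparates.not_connects (h : G.DSeparates S A B) (hAS : Disjoint A S) (hBS : Disjoint B S) :
    ∀ b ∈ B, ¬ G.Connects S A b := by
  rintro b hb ⟨l, hl⟩
  obtain ⟨a, ha, hla⟩ := hl.last
  obtain ⟨k, hk, h⟩ := h.symm _ hl.isPath ⟨b, hb, rfl⟩ ⟨a, ha, hla⟩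
  rcases h with ⟨h1, h2⟩ | ⟨⟨u, w, huw, hu, hw⟩, h2⟩
  · have hka : k ≠ a := fun h => Finset.disjoint_left.1 hAS ha (h ▸ h2)
    have hkb : k ≠ b := fun h => Finset.disjoint_left.1 hBS hb (h ▸ h2)
    obtain ⟨u, w, huw⟩ := exists_infix_triple hk (by simpa using hkb.symm)
      (by simpa [hla] using hka.symm)
    exact hl.noncollider u k w huw (fun h => h1 ⟨u, w, huw, h⟩) h2
  · obtain ⟨s, hs, hks⟩ := hl.collider u k w huw hu hw
    exact h2 s hks hs

end DAG

/-! ### Covariance matrices -/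

namespace DAG

variable {V : Type*} {G : DAG V} [Fintype V] [DecidableEq V]

/-- `L` is strictly triangular for the rank, so a left kernel vector vanishes by induction on the
rank. -/
theorem isUnit_one_sub {L : Matrix V V ℝ} (hL : ∀ i j, ¬ G.edge i j → L i j = 0) :
    IsUnit (1 - L) := by
  obtain ⟨rank, -, hlt⟩ := G.exists_rank
  rw [← Matrix.vecMul_injective_iff_isUnit, ← Matrix.coe_vecMulLinear,
    injective_iff_map_eq_zero]
  intro x hx
  have hx' : ∀ j, x j = ∑ i, x i * L i j := by
    intro j
    have := congrFun hx j
    rw [Matrix.vecMulLinear_apply, Matrix.vecMul_sub, Matrix.vecMul_one] at this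
    simpa [sub_eq_zero, Matrix.vecMul, dotProduct] using this
  suffices h : ∀ n j, rank j = n → x j = 0 from funext fun j => h _ j rfl
  intro n
  induction n using Nat.strong_induction_on with
  | _ n ih =>
  intro j hj
  rw [hx']
  refine Finset.sum_eq_zero fun i _ => ?_
  by_cases e : G.edge i j
  · rw [ih _ (hj ▸ hlt i j e) i rfl, zero_mul]
  · rw [hL i j e, mul_zero]

theorem covariance_apply (L : Matrix V V ℝ) (ω : V → ℝ) (i j : V) :
    covariance L ω i j = ∑ k, (1 - L)⁻¹ k i * ω k * (1 - L)⁻¹ k j := by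
  rw [covariance, Matrix.mul_apply]
  simp only [Matrix.mul_diagonal, Matrix.transpose_apply]

/-- The inverse depends in the columns of an ancestral set only on these columns. -/
theorem inv_one_sub_eq {L L' : Matrix V V ℝ} (hL : ∀ i j, ¬ G.edge i j → L i j = 0)
    (hL' : ∀ i j, ¬ G.edge i j → L' i j = 0) {U : Set V}
    (hU : ∀ i j, G.edge i j → j ∈ U → i ∈ U) (h : ∀ i, ∀ j ∈ U, L i j = L' i j) (k : V) :
    ∀ j ∈ U, (1 - L)⁻¹ k j = (1 - L')⁻¹ k j := by
  obtain ⟨rank, -, hlt⟩ := G.exists_rank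
  -- The recursion `P = 1 + P * L` expresses a column of the inverse by the columns of the parents.
  have hP : ∀ {L : Matrix V V ℝ}, IsUnit (1 - L) → ∀ j, (1 - L)⁻¹ k j =
      (1 : Matrix V V ℝ) k j + ∑ m, (1 - L)⁻¹ k m * L m j := by
    intro L hL j
    have h1 := Matrix.nonsing_inv_mul (1 - L) ((Matrix.isUnit_iff_isUnit_det _).1 hL)
    rw [Matrix.mul_sub, Matrix.mul_one, sub_eq_iff_eq_add] at h1
    exact congrFun (congrFun h1 k) j
  suffices key : ∀ n, ∀ j ∈ U, rank j = n → (1 - L)⁻¹ k j = (1 - L')⁻¹ k j from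
    fun j hj => key _ j hj rfl
  intro n
  induction n using Nat.strong_induction_on with
  | _ n ih =>
  intro j hj hn
  rw [hP (isUnit_one_sub hL), hP (isUnit_one_sub hL')]
  congr 1
  refine Finset.sum_congr rfl fun m _ => ?_
  rw [← h m j hj]
  by_cases e : G.edge m j
  · rw [ih _ (hn ▸ hlt m j e) m (hU m j e hj) rfl]
  · rw [hL m j e, mul_zero, mul_zero]

theorem covariance_posDef {L : Matrix V V ℝ} (hL : IsUnit (1 - L)) {ω : V → ℝ}
    (hω : ∀ i, 0 < ω i) : (covariance L ω).PosDef := by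
  have h := (Matrix.PosDef.diagonal hω).conjTranspose_mul_mul_same (B := (1 - L)⁻¹)
    (Matrix.mulVec_injective_of_isUnit ((Matrix.isUnit_nonsing_inv_iff).2 hL))
  rwa [Matrix.conjTranspose_eq_transpose_of_trivial] at h

theorem covariance_mul_concentration {L : Matrix V V ℝ} (hL : IsUnit (1 - L)) {ω : V → ℝ}
    (hω : ∀ i, 0 < ω i) :
    ((1 - L) * Matrix.diagonal (fun i => (ω i)⁻¹) * (1 - L).transpose) * covariance L ω = 1 := by
  have h1 : (1 - L).transpose * ((1 - L)⁻¹).transpose = 1 := by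
    rw [← Matrix.transpose_mul,
      Matrix.nonsing_inv_mul (1 - L) ((Matrix.isUnit_iff_isUnit_det _).1 hL),
      Matrix.transpose_one]
  have h2 : Matrix.diagonal (fun i => (ω i)⁻¹) * Matrix.diagonal ω = 1 := by
    rw [Matrix.diagonal_mul_diagonal, ← Matrix.diagonal_one]
    congr 1
    ext i
    exact inv_mul_cancel₀ (hω i).ne'
  calc _ = (1 - L) * Matrix.diagonal (fun i => (ω i)⁻¹) *
        ((1 - L).transpose * ((1 - L)⁻¹).transpose) * Matrix.diagonal ω * (1 - L)⁻¹ := by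
          simp only [covariance, Matrix.mul_assoc]
    _ = (1 - L) * (Matrix.diagonal (fun i => (ω i)⁻¹) * Matrix.diagonal ω) * (1 - L)⁻¹ := by
          rw [h1, Matrix.mul_one, Matrix.mul_assoc (1 - L)]
    _ = 1 := by
          rw [h2, Matrix.mul_one,
            Matrix.mul_nonsing_inv (1 - L) ((Matrix.isUnit_iff_isUnit_det _).1 hL)]

/-- A vanishing block of the inverse makes the columns of the other block linear combinations of
the separating columns. -/
theorem exists_columns_eq {M K : Matrix V V ℝ} (hM : M.PosDef) (hK : K.PosDef)
    (hKM : K * M = 1) {P : Set V} {S : Finset V} (hPS : ∀ x ∈ P, x ∉ S)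
    (h0 : ∀ x ∈ P, ∀ y, y ∉ P → y ∉ S → K x y = 0) {b : V} (hb : b ∉ P) :
    ∃ w : S → ℝ, ∀ x, x ∈ P ∨ x ∈ S → M x b = ∑ s : S, M x s * w s := by
  classical
  have hMS : IsUnit (M.submatrix (Subtype.val : S → V) Subtype.val) :=
    (hM.submatrix Subtype.val_injective).isUnit
  obtain ⟨w, hw⟩ := Matrix.mulVec_surjective_iff_isUnit.2 hMS fun s => M s b
  -- `x` is column `b` corrected to vanish on `S`. As `K * M = 1`, the vector `K x` vanishes on `P`;
  -- restricting `x` to `P` gives a vector `z` with `zᵀ K z = 0`, so `z = 0` by positive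
  -- definiteness.
  let x : V → ℝ := fun v => M v b - ∑ s : S, M v s * w s
  have hxS : ∀ v ∈ S, x v = 0 := by
    intro v hv
    have := congrFun hw ⟨v, hv⟩
    simp only [Matrix.mulVec, dotProduct, Matrix.submatrix_apply] at this
    simp only [x, this, sub_self]
  have hKx : ∀ v ∈ P, ∑ u, K v u * x u = 0 := by
    intro v hv
    have h1 : ∀ t, ∑ u, K v u * M u t = if v = t then 1 else 0 := by
      intro t
      rw [← Matrix.mul_apply, hKM, Matrix.one_apply]
    have h2 : ∑ u, K v u * x u = ∑ u, K v u * M u b - ∑ s : S, (∑ u, K v u * M u s) * w s := by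
      simp only [x, mul_sub, Finset.sum_sub_distrib, Finset.mul_sum, Finset.sum_mul]
      rw [Finset.sum_comm]
      simp only [mul_assoc]
    rw [h2, h1, if_neg (fun h : v = b => hb (h ▸ hv))]
    simp only [h1]
    rw [Finset.sum_eq_zero, sub_zero]
    intro s _
    rw [if_neg (fun h : v = s => hPS v hv (h ▸ s.2)), zero_mul]
  let z : V → ℝ := fun v => if v ∈ P then x v else 0
  have hz : z = 0 := by
    by_contra hne
    have h1 := hK.dotProduct_mulVec_pos hne
    refine h1.ne' ?_
    simp only [dotProduct, Matrix.mulVec, star_trivial]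
    refine Finset.sum_eq_zero fun v _ => ?_
    by_cases hv : v ∈ P
    · rw [← mul_zero (z v), ← hKx v hv]
      congr 1
      refine Finset.sum_congr rfl fun u _ => ?_
      by_cases hu : u ∈ P
      · simp only [z, if_pos hu]
      by_cases huS : u ∈ S
      · simp only [z, if_neg hu, hxS u huS]
      · rw [h0 v hv u hu huS, zero_mul, zero_mul]
    · simp only [z, if_neg hv, zero_mul]
  refine ⟨w, fun v hv => sub_eq_zero.1 ?_⟩
  rcases hv with hv | hv
  · have h1 := congrFun hz v
    simp only [z, if_pos hv] at h1
    exact h1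
  · exact hxS v hv

theorem _root_.Matrix.det_mul_eq_zero_of_card_lt {R m n : Type*} [Field R] [Fintype m] [Fintype n]
    [DecidableEq n] (M : Matrix n m R) (N : Matrix m n R) (h : Fintype.card m < Fintype.card n) :
    (M * N).det = 0 := by
  by_contra hne
  have h1 := Matrix.rank_of_isUnit _ ((Matrix.isUnit_iff_isUnit_det _).2 (Ne.isUnit hne))
  have h2 := (Matrix.rank_mul_le_right M N).trans (Matrix.rank_le_card_height N)
  omega

/-- The global Markov property. Discarding the edges into vertices outside the ancestral set `U` of
`A ∪ B ∪ S` changes no covariance within `U`, and the off-diagonal concentration entries then live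
on the moral graph of `U`. The vertices connected to `A` without being blocked by `S` are closed
under moral edges outside `S` and miss `B`, so the relevant block of the covariance matrix factors
through the columns of `S` and has rank at most `#S`. -/
theorem covariance_minor_eq_zero {A B S : Finset V} (hAS : Disjoint A S)
    (hBS : Disjoint B S) (hd : G.DSeparates S A B) {L : Matrix V V ℝ}
    (hL : ∀ i j, ¬ G.edge i j → L i j = 0) {ω : V → ℝ} (hω : ∀ i, 0 < ω i)
    {r s : Fin (S.card + 1) → V} (hr : ∀ a, r a ∈ A ∪ S) (hs : ∀ a, s a ∈ B ∪ S) :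
    ((covariance L ω).submatrix r s).det = 0 := by
  classical
  set U : Set V := {m | G.IsAncestor A m ∨ G.IsAncestor B m ∨ G.IsAncestor S m} with hUdef
  have hU : ∀ i j, G.edge i j → j ∈ U → i ∈ U := fun i j e hj =>
    hj.imp (·.of_edge e) (.imp (·.of_edge e) (·.of_edge e))
  set L' : Matrix V V ℝ := Matrix.of fun i j => if j ∈ U then L i j else 0 with hL'def
  have hL' : ∀ i j, ¬ (G.edge i j ∧ j ∈ U) → L' i j = 0 := by
    intro i j h
    rw [hL'def, Matrix.of_apply]
    split_ifs with hj
    · exact hL i j fun e => h ⟨e, hj⟩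
    · rfl
  have hL'' : ∀ i j, ¬ G.edge i j → L' i j = 0 := fun i j h => hL' i j fun h' => h h'.1
  have hunit := isUnit_one_sub hL''
  have hrU : ∀ a, r a ∈ U := by
    intro a
    rcases Finset.mem_union.1 (hr a) with h | h
    exacts [Or.inl (isAncestor_of_mem h), Or.inr (Or.inr (isAncestor_of_mem h))]
  have hsU : ∀ a, s a ∈ U := by
    intro a
    rcases Finset.mem_union.1 (hs a) with h | h
    exacts [Or.inr (Or.inl (isAncestor_of_mem h)), Or.inr (Or.inr (isAncestor_of_mem h))]
  have hsub : (covariance L ω).submatrix r s = (covariance L' ω).submatrix r s := by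
    ext a b
    rw [Matrix.submatrix_apply, Matrix.submatrix_apply, covariance_apply, covariance_apply]
    refine Finset.sum_congr rfl fun k _ => ?_
    have h := inv_one_sub_eq hL hL'' hU (fun i j hj => by simp [hL'def, hj]) k
    rw [h _ (hrU a), h _ (hsU b)]
  set K := (1 - L') * Matrix.diagonal (fun i => (ω i)⁻¹) * (1 - L').transpose with hKdef
  have hKM : K * covariance L' ω = 1 := covariance_mul_concentration hunit hω
  have hMpos := covariance_posDef hunit hω
  have hKpos : K.PosDef := by
    have := hMpos.inv
    rwa [Matrix.inv_eq_left_inv hKM] at this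
  have hB := hd.not_connects hAS hBS
  set P : Set V := {x | x ∈ U ∧ x ∉ S ∧ G.Connects S A x} with hPdef
  have hone : ∀ {x m}, (1 - L') x m ≠ 0 → x = m ∨ (G.edge x m ∧ m ∈ U) := by
    intro x m h
    by_contra! hc
    rw [Matrix.sub_apply, Matrix.one_apply_ne hc.1, hL' x m (fun h' => hc.2 h'.1 h'.2),
      sub_zero] at h
    exact h rfl
  have h0 : ∀ x ∈ P, ∀ y, y ∉ P → y ∉ S → K x y = 0 := by
    rintro x ⟨hxU, hxS, hx⟩ y hy hyS
    rw [hKdef, Matrix.mul_apply]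
    refine Finset.sum_eq_zero fun m _ => ?_
    rw [Matrix.mul_diagonal, Matrix.transpose_apply]
    by_contra hne
    have h1 := hone (left_ne_zero_of_mul (left_ne_zero_of_mul hne))
    have h2 := hone (right_ne_zero_of_mul hne)
    have hmU : m ∈ U := by
      rcases h1 with rfl | h1
      exacts [hxU, h1.2]
    have hyU : y ∈ U := by
      rcases h2 with rfl | h2
      exacts [hmU, hU y m h2.1 h2.2]
    exact hy ⟨hyU, hyS, hx.of_moral hxS hB hmU (h1.imp_right (·.1)) (h2.imp_right (·.1))⟩
  have hsP : ∀ b, s b ∉ P := by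
    rintro b ⟨-, h1, h2⟩
    rcases Finset.mem_union.1 (hs b) with h | h
    exacts [hB _ h h2, h1 h]
  have hrP : ∀ a, r a ∈ P ∨ r a ∈ S := by
    intro a
    rcases Finset.mem_union.1 (hr a) with h | h
    · exact Or.inl ⟨hrU a, Finset.disjoint_left.1 hAS h,
        connects_of_isDPath (l := []) rfl h (by simp)⟩
    · exact Or.inr h
  choose w hw using fun b => exists_columns_eq hMpos hKpos hKM (fun x hx => hx.2.1) h0 (hsP b)
  have hfac : (covariance L' ω).submatrix r s =
      (Matrix.of fun a (t : S) => covariance L' ω (r a) t) * Matrix.of fun t b => w b t := by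
    ext a b
    rw [Matrix.submatrix_apply, hw b _ (hrP a), Matrix.mul_apply]
    rfl
  rw [hsub, hfac]
  exact Matrix.det_mul_eq_zero_of_card_lt _ _ (by simp)

theorem aeval_covariancePoint_sigma (L : Matrix V V ℝ) (ω : V → ℝ) {n : Type*} [Fintype n]
    [DecidableEq n] (r s : n → V) :
    aeval (covariancePoint L ω) ((sigmaMatrix V).submatrix r s).det =
      (((covariance L ω).submatrix r s).det : ℂ) := by
  rw [AlgHom.map_det]
  change _ = Complex.ofRealHom _
  rw [RingHom.map_det]
  congr 1
  ext a b
  simp [sigmaMatrix, covariancePoint]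

/-- The conditional independence ideal vanishes on the model. -/
theorem ciIdeal_le_vanishingIdeal : G.ciIdeal ≤ G.vanishingIdeal := by
  refine Ideal.span_le.2 ?_
  rintro _ ⟨A, B, S, -, hAS, hBS, hd, r, s, -, -, hr, hs, rfl⟩
  refine mem_vanishingIdeal_iff.2 ?_
  rintro _ ⟨L, ω, hL, hω, rfl⟩
  rw [aeval_covariancePoint_sigma, covariance_minor_eq_zero hAS hBS hd hL hω hr hs,
    Complex.ofReal_zero]

end DAG
end
noncomputable section

namespace DAG

variable {V : Type*} {G : DAG V}

/-! ### The lowest order terms of the covariances -/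

section Powers

variable [Fintype V] [DecidableEq V] {L : Matrix V V ℝ}

theorem pow_eq_zero_of_forall (hL : ∀ i j, ¬ G.edge i j → L i j = 0) {n : ℕ} {k i : V}
    (h : ∀ l, G.IsDPath k l i → l.length ≠ n) : (L ^ n) k i = 0 := by
  induction n generalizing k with
  | zero =>
    rw [pow_zero, Matrix.one_apply_ne]
    rintro rfl
    exact h [] rfl rfl
  | succ n ih =>
    rw [pow_succ', Matrix.mul_apply]
    refine Finset.sum_eq_zero fun x _ => ?_
    by_cases e : G.edge k x
    · rw [ih fun l hl hn => h (x :: l) ⟨e, hl⟩ (by simp [hn]), mul_zero]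
    · rw [hL k x e, zero_mul]

/-- The value of the parameters `a = ω` and `λ = L`. -/
def parameterPoint (L : Matrix V V ℝ) (ω : V → ℝ) : V ⊕ V × V → ℂ :=
  Sum.elim (fun v => (ω v : ℂ)) fun e => (L e.1 e.2 : ℂ)

theorem pow_eq_eval (hL : ∀ i j, ¬ G.edge i j → L i j = 0) (ω : V → ℝ) {k i : V} {l : List V}
    (hl : G.IsDPath k l i) (h : ∀ l', G.IsDPath k l' i → l'.length = l.length → l' = l) :
    ((L ^ l.length) k i : ℂ) = eval (parameterPoint L ω) (edgeMonomial (k :: l)) := by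
  induction l generalizing k with
  | nil =>
    obtain rfl := isDPath_nil.1 hl
    simp
  | cons y l ih =>
    rw [List.length_cons, pow_succ', Matrix.mul_apply, Finset.sum_eq_single y]
    · rw [edgeMonomial_cons_cons, map_mul, eval_X, Complex.ofReal_mul, ih hl.2 fun l' h1 h2 => ?_]
      · rfl
      · exact (List.cons_eq_cons.1 (h (y :: l') ⟨hl.1, h1⟩ (by simp [h2]))).2
    · intro x _ hx
      by_cases e : G.edge k x
      · rw [pow_eq_zero_of_forall hL fun l' h1 h2 => hx
          (List.cons_eq_cons.1 (h (x :: l') ⟨e, h1⟩ (by simp [h2]))).1, mul_zero]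
      · rw [hL k x e, zero_mul]
    · simp

theorem pow_card_eq_zero (hL : ∀ i j, ¬ G.edge i j → L i j = 0) : L ^ Fintype.card V = 0 := by
  ext k i
  refine pow_eq_zero_of_forall hL fun l hl hn => ?_
  have := hl.nodup.length_le_card
  rw [List.length_cons] at this
  omega

/-- The Neumann series of the inverse is finite because `L` is nilpotent. The coefficient of `t ^ (n
+ m)` collects the pairs of directed paths of lengths `n` and `m` from a common top. -/
theorem covariance_smul_apply (hL : ∀ i j, ¬ G.edge i j → L i j = 0) (ω : V → ℝ) (t : ℝ)
    (i j : V) : covariance (t • L) ω i j = ∑ k, ∑ n ∈ Finset.range (Fintype.card V),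
      ∑ m ∈ Finset.range (Fintype.card V), t ^ (n + m) * (ω k * (L ^ n) k i * (L ^ m) k j) := by
  have hinv : (1 - t • L)⁻¹ = ∑ n ∈ Finset.range (Fintype.card V), t ^ n • L ^ n := by
    refine Matrix.inv_eq_left_inv ?_
    have := geom_sum_mul_neg (t • L) (Fintype.card V)
    rw [smul_pow, pow_card_eq_zero hL, smul_zero, sub_zero] at this
    simpa only [smul_pow] using this
  rw [covariance_apply]
  refine Finset.sum_congr rfl fun k _ => ?_
  rw [hinv, Matrix.sum_apply, Matrix.sum_apply, mul_assoc, Finset.sum_mul]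
  refine Finset.sum_congr rfl fun n _ => ?_
  rw [Finset.mul_sum, Finset.mul_sum]
  refine Finset.sum_congr rfl fun m _ => ?_
  rw [Matrix.smul_apply, Matrix.smul_apply, smul_eq_mul, smul_eq_mul, pow_add]
  ring

omit [Fintype V] [DecidableEq V] in
/-- The lengths of the shortest treks. -/
theorem exists_length (hG : G.HasUniqueShortestTreks) :
    ∃ w : Sym2 V → ℕ, ∀ i j (T : G.Trek i j), T.IsShortest → T.length = w s(i, j) := by
  have : ∀ z : Sym2 V, ∃ n, ∀ i j (T : G.Trek i j), s(i, j) = z → T.IsShortest → T.length = n := by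
    intro z
    induction z using Sym2.ind with
    | _ i j =>
    by_cases h : G.CommonAncestor i j
    · obtain ⟨T, hT⟩ := exists_isShortest h
      refine ⟨T.length, fun i' j' T' hz hT' => ?_⟩
      rcases Sym2.eq_iff.1 hz with ⟨rfl, rfl⟩ | ⟨rfl, rfl⟩
      · rw [(hG _ _ ⟨T⟩).unique hT hT']
      · rw [(hG _ _ ⟨T⟩).unique hT hT'.symm, Trek.length_symm]
    · refine ⟨0, fun i' j' T' hz _ => absurd ?_ h⟩
      rcases Sym2.eq_iff.1 hz with ⟨rfl, rfl⟩ | ⟨rfl, rfl⟩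
      exacts [nonempty_trek_iff.1 ⟨T'⟩, nonempty_trek_iff.1 ⟨T'.symm⟩]
  choose w hw using this
  exact ⟨w, fun i j T => hw _ i j T rfl⟩

/-- The shortest trek monomial is the lowest order term of the covariance. -/
theorem exists_covariance_eq_pow_mul (hG : G.HasUniqueShortestTreks) {w : Sym2 V → ℕ}
    (hw : ∀ i j (T : G.Trek i j), T.IsShortest → T.length = w s(i, j))
    (hL : ∀ i j, ¬ G.edge i j → L i j = 0) (ω : V → ℝ) (z : Sym2 V) :
    ∃ h : ℝ → ℂ, Continuous h ∧
      (∀ t : ℝ, covariancePoint (t • L) ω z = (t : ℂ) ^ w z * h t) ∧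
      h 0 = eval (parameterPoint L ω) (G.shortestTrekMonomial z) := by
  induction z using Sym2.ind with
  | _ i j =>
  let τ : V → ℕ → ℕ → ℝ := fun k n m => ω k * (L ^ n) k i * (L ^ m) k j
  have hτ : ∀ {k n m}, τ k n m ≠ 0 →
      ∃ l r, G.IsDPath k l i ∧ G.IsDPath k r j ∧ l.length = n ∧ r.length = m := by
    intro k n m h
    by_contra! hc
    by_cases hl : ∃ l, G.IsDPath k l i ∧ l.length = n
    · obtain ⟨l, hl, hn⟩ := hl
      refine right_ne_zero_of_mul h (pow_eq_zero_of_forall hL fun r hr => hc l r hl hr hn)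
    · push Not at hl
      exact right_ne_zero_of_mul (left_ne_zero_of_mul h) (pow_eq_zero_of_forall hL hl)
  by_cases ht : G.CommonAncestor i j
  · obtain ⟨T, hT⟩ := exists_isShortest ht
    have hTw := hw i j T hT
    -- A pair of directed paths not longer than the shortest trek is that trek, so there is exactly
    -- one nonzero term of order at most `w`.
    have hτ' : ∀ {k n m}, τ k n m ≠ 0 → n + m ≤ w s(i, j) →
        k = T.top ∧ n = T.left.length ∧ m = T.right.length := by
      intro k n m h hle
      obtain ⟨l, r, hl, hr, rfl, rfl⟩ := hτ h
      obtain ⟨rfl, rfl, rfl⟩ := hG.eq_of_isDPath hl hr hT (hTw ▸ hle)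
      exact ⟨rfl, rfl, rfl⟩
    -- The subtraction in the exponent is truncated, which is harmless because the terms with `n + m
    -- < w` vanish.
    let h : ℝ → ℝ := fun t => ∑ k, ∑ n ∈ Finset.range (Fintype.card V),
      ∑ m ∈ Finset.range (Fintype.card V), t ^ (n + m - w s(i, j)) * τ k n m
    refine ⟨fun t => (h t : ℂ), Complex.continuous_ofReal.comp (by fun_prop), fun t => ?_, ?_⟩
    · have : covariance (t • L) ω i j = t ^ w s(i, j) * h t := by
        rw [covariance_smul_apply hL]
        simp only [h, Finset.mul_sum]
        refine Finset.sum_congr rfl fun k _ => Finset.sum_congr rfl fun n _ =>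
          Finset.sum_congr rfl fun m _ => ?_
        by_cases h0 : τ k n m = 0
        · rw [h0, mul_zero, mul_zero]
          exact mul_eq_zero_of_right _ h0
        · have hle : w s(i, j) ≤ n + m := by
            by_contra! hlt
            obtain ⟨-, rfl, rfl⟩ := hτ' h0 hlt.le
            rw [← hTw] at hlt
            exact lt_irrefl _ hlt
          change t ^ (n + m) * τ k n m = _
          rw [← mul_assoc (t ^ w s(i, j)), ← pow_add, Nat.add_sub_cancel' hle]
      change ((covariance (t • L) ω i j : ℝ) : ℂ) = _
      rw [this, Complex.ofReal_mul, Complex.ofReal_pow]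
    · have hzero : ∀ k n m, (k, n, m) ≠ (T.top, T.left.length, T.right.length) →
          (0 : ℝ) ^ (n + m - w s(i, j)) * τ k n m = 0 := by
        intro k n m hne
        by_cases hle : n + m ≤ w s(i, j)
        · by_cases h0 : τ k n m = 0
          · rw [h0, mul_zero]
          · obtain ⟨rfl, rfl, rfl⟩ := hτ' h0 hle
            exact absurd rfl hne
        · rw [zero_pow (by omega), zero_mul]
      have hlen : ∀ {l x}, G.IsDPath T.top l x → l.length ∈ Finset.range (Fintype.card V) := by
        intro l x hl
        have := hl.nodup.length_le_card
        rw [List.length_cons] at this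
        exact Finset.mem_range.2 (by omega)
      have h0 : h 0 = τ T.top T.left.length T.right.length := by
        simp only [h]
        rw [Finset.sum_eq_single T.top, Finset.sum_eq_single T.left.length,
          Finset.sum_eq_single T.right.length]
        · rw [← hTw, Trek.length, Nat.sub_self, pow_zero, one_mul]
        · exact fun m _ hm => hzero _ _ _ (by simp [hm])
        · exact fun hm => absurd (hlen T.isDPath_right) hm
        · exact fun n _ hn => Finset.sum_eq_zero fun m _ => hzero _ _ _ (by simp [hn])
        · exact fun hm => absurd (hlen T.isDPath_left) hm
        · exact fun k _ hk => Finset.sum_eq_zero fun n _ => Finset.sum_eq_zero fun m _ =>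
            hzero _ _ _ (by simp [hk])
        · simp
      have hl : ((L ^ T.left.length) T.top i : ℂ) =
          eval (parameterPoint L ω) (edgeMonomial T.leftSide) := by
        refine pow_eq_eval hL ω T.isDPath_left fun l' h1 h2 => ?_
        exact (hG.eq_of_isDPath h1 T.isDPath_right hT (by rw [h2, Trek.length])).2.1.symm
      have hr : ((L ^ T.right.length) T.top j : ℂ) =
          eval (parameterPoint L ω) (edgeMonomial T.rightSide) := by
        refine pow_eq_eval hL ω T.isDPath_right fun l' h1 h2 => ?_
        exact (hG.eq_of_isDPath T.isDPath_left h1 hT (by rw [h2, Trek.length])).2.2.symm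
      rw [shortestTrekMonomial_of_isShortest hG T hT, Trek.monomial, map_mul, map_mul, eval_X,
        ← hl, ← hr]
      change (h 0 : ℂ) = _
      rw [h0, Complex.ofReal_mul, Complex.ofReal_mul]
      rfl
  · refine ⟨0, continuous_const, fun t => ?_, ?_⟩
    · have : covariance (t • L) ω i j = 0 := by
        rw [covariance_smul_apply hL]
        refine Finset.sum_eq_zero fun k _ => Finset.sum_eq_zero fun n _ =>
          Finset.sum_eq_zero fun m _ => mul_eq_zero_of_right _ ?_
        by_contra hne
        obtain ⟨l, r, hl, hr, -⟩ := hτ hne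
        exact ht ⟨k, hl.reflTransGen, hr.reflTransGen⟩
      change ((covariance (t • L) ω i j : ℝ) : ℂ) = _
      rw [this, Complex.ofReal_zero, Pi.zero_apply, mul_zero]
    · rw [shortestTrekMonomial_of_not ht, map_zero, Pi.zero_apply]

end Powers

/-! ### Initial forms -/

theorem _root_.MvPolynomial.IsWeightedHomogeneous.eval_pow_mul {σ R : Type*} [CommSemiring R]
    {w : σ → ℕ} {n : ℕ} {φ : MvPolynomial σ R} (h : φ.IsWeightedHomogeneous w n) (t : R)
    (x : σ → R) : eval (fun i => t ^ w i * x i) φ = t ^ n * eval x φ := by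
  rw [eval_eq, eval_eq, Finset.mul_sum]
  refine Finset.sum_congr rfl fun d hd => ?_
  have h1 : ∏ i ∈ d.support, t ^ (w i * d i) = t ^ n := by
    rw [Finset.prod_pow_eq_pow_sum, ← h (mem_support_iff.1 hd), Finsupp.weight_apply,
      Finsupp.sum]
    simp only [smul_eq_mul, mul_comm]
  simp only [mul_pow, ← pow_mul, Finset.prod_mul_distrib, h1]
  ring

theorem _root_.MvPolynomial.exists_sum_weightedHomogeneousComponent {σ R : Type*} [CommSemiring R]
    (w : σ → ℕ) (φ : MvPolynomial σ R) :
    ∃ N, φ = ∑ n ∈ Finset.range N, weightedHomogeneousComponent w n φ := by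
  refine ⟨weightedTotalDegree w φ + 1, ?_⟩
  conv_lhs => rw [← sum_weightedHomogeneousComponent w φ]
  refine finsum_eq_sum_of_support_subset _ fun n hn => ?_
  rw [Finset.coe_range, Set.mem_Iio, Nat.lt_succ_iff]
  by_contra! hlt
  exact hn (weightedHomogeneousComponent_eq_zero n φ hlt)

/-- The shortest trek map is determined by positive real parameters supported on the edges. -/
theorem shortestTrekMap_eq_zero_of_forall (hG : G.HasUniqueShortestTreks)
    {f : MvPolynomial (Sym2 V) ℂ} (h : ∀ (L : Matrix V V ℝ) (ω : V → ℝ),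
      (∀ i j, ¬ G.edge i j → L i j = 0) → (∀ i, 0 < ω i) →
      eval (parameterPoint L ω) (G.shortestTrekMap f) = 0) : G.shortestTrekMap f = 0 := by
  classical
  -- A polynomial vanishing on a product of infinite sets is zero. Only the `λ` of edges occur in
  -- the image of `ψ`, so the other coordinates may be set to `0`.
  refine MvPolynomial.funext_set (fun _ => Complex.ofReal '' Set.Ioi 0) (fun _ => ?_)
    fun x hx => ?_
  · exact (Set.Ioi_infinite 0).image Complex.ofReal_injective.injOn
  choose y hy hyx using fun i => hx i (Set.mem_univ i)
  let L : Matrix V V ℝ := fun i j => if G.edge i j then y (Sum.inr (i, j)) else 0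
  have h1 := h L (fun v => y (Sum.inl v)) (fun i j hij => if_neg hij) fun i => hy _
  rw [map_zero, ← h1]
  have key : (eval x).comp G.shortestTrekMap.toRingHom =
      (eval (parameterPoint L fun v => y (Sum.inl v))).comp G.shortestTrekMap.toRingHom := by
    refine MvPolynomial.ringHom_ext (fun r => by simp) fun z => ?_
    simp only [RingHom.comp_apply, AlgHom.toRingHom_eq_coe, RingHom.coe_coe, shortestTrekMap_X]
    induction z using Sym2.ind with
    | _ i j =>
    by_cases ht : G.CommonAncestor i j
    · obtain ⟨T, hT⟩ := exists_isShortest ht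
      have hed : ∀ {a b : V} {l : List V}, G.IsDPath a l b →
          eval x (edgeMonomial (a :: l)) =
            eval (parameterPoint L fun v => y (Sum.inl v)) (edgeMonomial (a :: l)) := by
        intro a b l hl
        induction l generalizing a with
        | nil => simp
        | cons c l ih =>
          rw [edgeMonomial_cons_cons, map_mul, map_mul, ih hl.2, eval_X, eval_X]
          congr 1
          simp only [parameterPoint, Sum.elim_inr, L, if_pos hl.1]
          exact (hyx _).symm
      rw [shortestTrekMonomial_of_isShortest hG T hT, Trek.monomial, map_mul, map_mul, map_mul,
        map_mul, Trek.leftSide, Trek.rightSide, hed T.isDPath_left, hed T.isDPath_right, eval_X,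
        eval_X, ← hyx]
      rfl
    · rw [shortestTrekMonomial_of_not ht, map_zero, map_zero]
  exact RingHom.congr_fun key f

variable [Fintype V] [DecidableEq V]

/-- Lowest order components of elements of the vanishing ideal. -/
theorem component_mem_shortestTrekIdeal (hG : G.HasUniqueShortestTreks) {w : Sym2 V → ℕ}
    (hw : ∀ i j (T : G.Trek i j), T.IsShortest → T.length = w s(i, j)) {N d : ℕ}
    {g : ℕ → MvPolynomial (Sym2 V) ℂ} (hg : ∀ n, (g n).IsWeightedHomogeneous w n)
    (h : ∑ n ∈ Finset.range N, g (d + n) ∈ G.vanishingIdeal) (hN : 0 < N) :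
    g d ∈ G.shortestTrekIdeal := by
  refine RingHom.mem_ker.2 (shortestTrekMap_eq_zero_of_forall hG fun L ω hL hω => ?_)
  choose k hk1 hk2 hk3 using exists_covariance_eq_pow_mul hG hw hL ω
  -- `F t` is the value of the polynomial at the covariance matrix of `t • L`, divided by `t ^ d`.
  -- It vanishes for `t ≠ 0`, hence by continuity at `0`, where only `g d` at the shortest trek
  -- monomials survives.
  let F : ℝ → ℂ := fun t => ∑ n ∈ Finset.range N, (t : ℂ) ^ n * eval (fun z => k z t) (g (d + n))
  have hFc : Continuous F := by
    refine continuous_finsetSum _ fun n _ => (by fun_prop : Continuous fun t : ℝ =>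
      (t : ℂ) ^ n).mul ?_
    exact (MvPolynomial.continuous_eval (g (d + n))).comp (continuous_pi fun z => hk1 z)
  have hF : ∀ t : ℝ, t ≠ 0 → F t = 0 := by
    intro t ht
    have h1 := mem_vanishingIdeal_iff.1 h (covariancePoint (t • L) ω) ⟨t • L, ω,
      fun i j hij => by rw [Matrix.smul_apply, hL i j hij, smul_zero], hω, rfl⟩
    have h2 : covariancePoint (t • L) ω = fun z => (t : ℂ) ^ w z * k z t :=
      funext fun z => hk2 z t
    rw [h2, aeval_eq_eval, map_sum] at h1
    have h3 : (t : ℂ) ^ d * F t = 0 := by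
      rw [← h1, Finset.mul_sum]
      refine Finset.sum_congr rfl fun n _ => ?_
      rw [(hg (d + n)).eval_pow_mul, pow_add, mul_assoc]
    exact (mul_eq_zero.1 h3).resolve_left (pow_ne_zero _ (by exact_mod_cast ht))
  have hF0 : F 0 = 0 := by
    have h1 : Set.EqOn F 0 {0}ᶜ := fun t ht => hF t ht
    exact congrFun (hFc.ext_on (dense_compl_singleton (0 : ℝ)) continuous_zero h1) 0
  have h2 : F 0 = eval (fun z => k z 0) (g d) := by
    simp only [F]
    rw [Finset.sum_eq_single_of_mem 0 (Finset.mem_range.2 hN)]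
    · simp
    · intro n _ hn
      simp [hn]
  rw [h2] at hF0
  rw [← hF0, show (fun z => k z 0) = fun z => eval (parameterPoint L ω)
    (G.shortestTrekMonomial z) from funext hk3]
  induction g d using MvPolynomial.induction_on with
  | C a => simp
  | add p q hp hq => rw [map_add, map_add, map_add, hp, hq]
  | mul_X p z hp => rw [map_mul, map_mul, map_mul, hp, shortestTrekMap_X, eval_X]

/-- The lowest component of an element of the vanishing ideal lies in the shortest trek ideal. By
`h` it may be subtracted without leaving the vanishing ideal, so all components follow in turn. -/
theorem vanishingIdeal_le_shortestTrekIdeal (hG : G.HasUniqueShortestTreks)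
    (h : G.shortestTrekIdeal ≤ G.vanishingIdeal) : G.vanishingIdeal ≤ G.shortestTrekIdeal := by
  obtain ⟨w, hw⟩ := exists_length hG
  intro f hf
  obtain ⟨N, hN⟩ := exists_sum_weightedHomogeneousComponent w f
  set g : ℕ → MvPolynomial (Sym2 V) ℂ := fun n => weightedHomogeneousComponent w n f
  have hg : ∀ n, (g n).IsWeightedHomogeneous w n := fun n =>
    weightedHomogeneousComponent_isWeightedHomogeneous n f
  have key : ∀ d < N, g d ∈ G.shortestTrekIdeal := by
    intro d
    induction d using Nat.strong_induction_on with
    | _ d ih =>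
    intro hd
    refine component_mem_shortestTrekIdeal hG hw (N := N - d) hg ?_ (by omega)
    have h1 : f = ∑ n ∈ Finset.range d, g n + ∑ n ∈ Finset.range (N - d), g (d + n) := by
      rw [← Finset.sum_range_add, Nat.add_sub_cancel' hd.le]
      exact hN
    rw [eq_sub_iff_add_eq'.2 h1.symm]
    refine sub_mem hf (sum_mem fun n hn => ?_)
    have hn := Finset.mem_range.1 hn
    exact h (ih n hn (hn.trans hd))
  rw [hN]
  exact sum_mem fun n hn => key n (Finset.mem_range.1 hn)

end DAG
end
noncomputable section

namespace DAG

variable {V : Type*} {G : DAG V}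

/-! ### Shortest treks through a choke point -/

/-- There is at most one shortest trek between `i` and `j`. -/
def UniqueShortest (G : DAG V) (i j : V) : Prop :=
  ∀ T T' : G.Trek i j, T.IsShortest → T'.IsShortest → T = T'

theorem UniqueShortest.symm {i j : V} (h : G.UniqueShortest i j) : G.UniqueShortest j i :=
  fun T T' hT hT' => by
    have := h T.symm T'.symm hT.symm hT'.symm
    exact congrArg Trek.symm this

theorem hasUniqueShortestTreks_iff :
    G.HasUniqueShortestTreks ↔ ∀ i j, G.UniqueShortest i j := by
  refine ⟨fun h i j T T' hT hT' => (h i j ⟨T⟩).unique hT hT', fun h i j ht => ?_⟩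
  obtain ⟨T, hT⟩ := exists_isShortest (nonempty_trek_iff.1 ht)
  exact ⟨T, hT, fun T' hT' => h i j T' T hT' hT⟩

theorem Trek.IsShortest.le_of_isDPath {i j t : V} {l r : List V} {T : G.Trek i j}
    (hT : T.IsShortest) (hl : G.IsDPath t l i) (hr : G.IsDPath t r j) :
    T.length ≤ l.length + r.length := by
  obtain ⟨T', h, -⟩ := exists_trek_of_isDPath hl hr
  exact (hT T').trans h

theorem UniqueShortest.eq_of_isDPath {i j t : V} (h : G.UniqueShortest i j)
    {l r : List V} (hl : G.IsDPath t l i) (hr : G.IsDPath t r j) {T : G.Trek i j}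
    (hT : T.IsShortest) (hle : l.length + r.length ≤ T.length) :
    T.top = t ∧ T.left = l ∧ T.right = r := by
  obtain ⟨T', h₁, h₂⟩ := exists_trek_of_isDPath hl hr
  have hT' : T'.IsShortest := fun T'' => (h₁.trans hle).trans (hT T'')
  rw [h T T' hT hT']
  exact h₂ (hle.trans (hT T'))

theorem Trek.eq_top_of_mem {i j x : V} {T : G.Trek i j} (hl : x ∈ T.leftSide)
    (hr : x ∈ T.rightSide) : x = T.top := by
  rcases List.mem_cons.1 hl with h | h
  · exact h
  rcases List.mem_cons.1 hr with h' | h'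
  · exact h'
  · exact absurd h' (List.disjoint_of_nodup_append (List.nodup_cons.1 T.nodup).2 h)

theorem Trek.end_mem_rightSide {i j : V} (T : G.Trek i j) : j ∈ T.rightSide :=
  T.isDPath_right.end_mem

/-- `c` is on the `I`-side of all treks from `I` to `J`. -/
def OnLeftSide (G : DAG V) (c : V) (I J : Set V) : Prop :=
  ∀ i ∈ I, ∀ j ∈ J, ∀ T : G.Trek i j, c ∈ T.leftSide

namespace OnLeftSide

variable {I J : Set V} {c i j : V}

/-- Being the right end and on the left side, `c` is on both sides and hence the top. So vertices of
`I` joined to `c` are its descendants. -/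
theorem top_eq (h : G.OnLeftSide c I J) (hc : c ∈ J) (hi : i ∈ I) (T : G.Trek i c) :
    T.top = c ∧ T.right = [] := by
  have h1 := (Trek.eq_top_of_mem (h i hi c hc T) T.end_mem_rightSide).symm
  have h2 := T.isDPath_right
  rw [h1] at h2
  exact ⟨h1, h2.eq_nil⟩

theorem reflTransGen (h : G.OnLeftSide c I J) (hc : c ∈ J) (hi : i ∈ I)
    (ht : G.CommonAncestor i c) : Relation.ReflTransGen G.edge c i := by
  obtain ⟨T⟩ := nonempty_trek_iff.2 ht
  have := T.isDPath_left.reflTransGen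
  rwa [(h.top_eq hc hi T).1] at this

theorem commonAncestor_iff (h : G.OnLeftSide c I J) (hc : c ∈ J) (hi : i ∈ I) (hj : j ∈ J) :
    G.CommonAncestor i j ↔ G.CommonAncestor i c ∧ G.CommonAncestor c j := by
  constructor
  · intro ht
    obtain ⟨T⟩ := nonempty_trek_iff.2 ht
    obtain ⟨l₁, l₂, -, h1, h2⟩ := T.isDPath_left.mem_split (h i hi j hj T)
    exact ⟨⟨c, h2.reflTransGen, .refl⟩, ⟨_, h1.reflTransGen, T.isDPath_right.reflTransGen⟩⟩
  · rintro ⟨h1, h2⟩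
    exact (h2.symm.trans_right (h.reflTransGen hc hi h1)).symm

/-- A shortest trek splits at `c` into a directed path from `c` to `i` and a trek from `c` to `j`.
Conversely the shortest ones concatenate, so comparison of lengths shows that both pieces are
shortest. -/
theorem eq_append (h : G.OnLeftSide c I J) (hc : c ∈ J) (hi : i ∈ I) (hj : j ∈ J)
    (h1 : G.UniqueShortest i c) (h2 : G.UniqueShortest c j) {T : G.Trek i j} (hT : T.IsShortest)
    {Ti : G.Trek i c} (hTi : Ti.IsShortest) {Tc : G.Trek c j} (hTc : Tc.IsShortest) :
    T.top = Tc.top ∧ T.left = Tc.left ++ Ti.left ∧ T.right = Tc.right := by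
  obtain ⟨l₁, l₂, hl, hl₁, hl₂⟩ := T.isDPath_left.mem_split (h i hi j hj T)
  have h3 := hTi.le_of_isDPath hl₂ (r := []) rfl
  have h4 := hTc.le_of_isDPath hl₁ T.isDPath_right
  have h5 := h.top_eq hc hi Ti
  have h6 := Ti.isDPath_left
  rw [h5.1] at h6
  have h7 := hT.le_of_isDPath (Tc.isDPath_left.append h6) Tc.isDPath_right
  have h8 : Ti.length = Ti.left.length := by rw [Trek.length, h5.2]; rfl
  simp only [Trek.length, hl, List.length_append, List.length_nil] at h3 h4 h7 h8
  obtain ⟨h9, h10, h11⟩ := h2.eq_of_isDPath hl₁ T.isDPath_right hTc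
    (by simp only [Trek.length]; omega)
  obtain ⟨-, h12, -⟩ := h1.eq_of_isDPath hl₂ (r := []) rfl hTi
    (by simp only [Trek.length, List.length_nil]; omega)
  rw [h9, h10, h11, h12]
  exact ⟨rfl, hl, rfl⟩

theorem uniqueShortest (h : G.OnLeftSide c I J) (hc : c ∈ J) (hi : i ∈ I) (hj : j ∈ J)
    (h1 : G.UniqueShortest i c) (h2 : G.UniqueShortest c j) : G.UniqueShortest i j := by
  intro T T' hT hT'
  obtain ⟨h3, h4⟩ := (h.commonAncestor_iff hc hi hj).1 (nonempty_trek_iff.1 ⟨T⟩)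
  obtain ⟨Ti, hTi⟩ := exists_isShortest h3
  obtain ⟨Tc, hTc⟩ := exists_isShortest h4
  obtain ⟨h5, h6, h7⟩ := h.eq_append hc hi hj h1 h2 hT hTi hTc
  obtain ⟨h8, h9, h10⟩ := h.eq_append hc hi hj h1 h2 hT' hTi hTc
  exact Trek.ext (h5.trans h8.symm) (h6.trans h9.symm) (h7.trans h10.symm)

theorem shortestTrekMonomial_mul (h : G.OnLeftSide c I J) (hG : G.HasUniqueShortestTreks)
    (hc : c ∈ J) (hi : i ∈ I) (hj : j ∈ J) :
    G.shortestTrekMonomial s(i, j) * X (Sum.inl c) =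
      G.shortestTrekMonomial s(i, c) * G.shortestTrekMonomial s(c, j) := by
  have hu := hasUniqueShortestTreks_iff.1 hG
  by_cases ht : G.CommonAncestor i j
  · obtain ⟨h3, h4⟩ := (h.commonAncestor_iff hc hi hj).1 ht
    obtain ⟨T, hT⟩ := exists_isShortest ht
    obtain ⟨Ti, hTi⟩ := exists_isShortest h3
    obtain ⟨Tc, hTc⟩ := exists_isShortest h4
    obtain ⟨h5, h6, h7⟩ := h.eq_append hc hi hj (hu _ _) (hu _ _) hT hTi hTc
    obtain ⟨h8, h9⟩ := h.top_eq hc hi Ti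
    rw [shortestTrekMonomial_of_isShortest hG T hT, shortestTrekMonomial_of_isShortest hG Ti hTi,
      shortestTrekMonomial_of_isShortest hG Tc hTc, Trek.monomial_eq, Trek.monomial_eq,
      Trek.monomial_eq, X, monomial_mul, monomial_mul]
    congr 1
    simp only [Trek.exp, Trek.leftSide, Trek.rightSide, h5, h6, h7, h8, h9,
      edgeExp_append Tc.isDPath_left, edgeExp_singleton]
    abel_nf
  · rw [shortestTrekMonomial_of_not ht, zero_mul, eq_comm, mul_eq_zero]
    by_contra! hne
    exact ht ((h.commonAncestor_iff hc hi hj).2 ⟨hG.shortestTrekMonomial_ne_zero.1 hne.1,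
      hG.shortestTrekMonomial_ne_zero.1 hne.2⟩)

end OnLeftSide

/-! ### Treks in clique sums -/

variable {V₁ V₂ : Type*} {G₁ : DAG V₁} {G₂ : DAG V₂} {f₁ : V₁ ↪ V} {f₂ : V₂ ↪ V}

namespace IsCliqueSum

theorem symm (h : IsCliqueSum G₁ G₂ G f₁ f₂) : IsCliqueSum G₂ G₁ G f₂ f₁ where
  cover := by rw [Set.union_comm]; exact h.cover
  edge_iff x y := (h.edge_iff x y).trans or_comm
  same a b a' b' ha hb := (h.same a' b' a b ha.symm hb.symm).symm
  complete x hx y hy := h.complete x hx.symm y hy.symm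

theorem edge_map_iff (h : IsCliqueSum G₁ G₂ G f₁ f₂) {a b : V₁} :
    G.edge (f₁ a) (f₁ b) ↔ G₁.edge a b := by
  rw [h.edge_iff]
  constructor
  · rintro (⟨a', b', ha, hb, e⟩ | ⟨a', b', ha, hb, e⟩)
    · rwa [← f₁.injective ha, ← f₁.injective hb]
    · exact (h.same a b a' b' ha.symm hb.symm).2 e
  · exact fun e => Or.inl ⟨a, b, rfl, rfl, e⟩

theorem mem_of_edge (h : IsCliqueSum G₁ G₂ G f₁ f₂) {x y : V} (e : G.edge x y) :
    (x ∈ Set.range f₁ ∧ y ∈ Set.range f₁) ∨ (x ∈ Set.range f₂ ∧ y ∈ Set.range f₂) := by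
  rcases (h.edge_iff x y).1 e with ⟨a, b, rfl, rfl, -⟩ | ⟨a, b, rfl, rfl, -⟩
  exacts [Or.inl ⟨⟨a, rfl⟩, b, rfl⟩, Or.inr ⟨⟨a, rfl⟩, b, rfl⟩]

theorem mem_of_notMem (h : IsCliqueSum G₁ G₂ G f₁ f₂) {x : V} (hx : x ∉ Set.range f₁) :
    x ∈ Set.range f₂ :=
  (Set.mem_union _ _ _).1 (h.cover ▸ Set.mem_univ x : x ∈ Set.range f₁ ∪ Set.range f₂)
    |>.resolve_left hx

theorem mem_inter_of_edge (h : IsCliqueSum G₁ G₂ G f₁ f₂) {x y : V}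
    (e : G.edge x y ∨ G.edge y x) (hx : x ∈ Set.range f₁) (hy : y ∉ Set.range f₁) :
    x ∈ Set.range f₁ ∩ Set.range f₂ := by
  rcases e with e | e
  · rcases h.mem_of_edge e with h' | h'
    exacts [absurd h'.2 hy, ⟨hx, h'.1⟩]
  · rcases h.mem_of_edge e with h' | h'
    exacts [absurd h'.1 hy, ⟨hx, h'.2⟩]

/-- A directed path that enters `G₁` does so at a common vertex. -/
theorem exists_entry (h : IsCliqueSum G₁ G₂ G f₁ f₂) {t b : V} {l : List V}
    (hl : G.IsDPath t l b) (ht : t ∉ Set.range f₁) (hb : b ∈ Set.range f₁) :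
    ∃ x l₁ l₂, x ∈ Set.range f₁ ∩ Set.range f₂ ∧ l₁ ≠ [] ∧ l = l₁ ++ l₂ ∧ G.IsDPath t l₁ x ∧
      G.IsDPath x l₂ b := by
  induction l generalizing t with
  | nil =>
    obtain rfl := isDPath_nil.1 hl
    exact absurd hb ht
  | cons y l ih =>
    by_cases hy : y ∈ Set.range f₁
    · exact ⟨y, [y], l, h.mem_inter_of_edge (Or.inr hl.1) hy ht, by simp, rfl, ⟨hl.1, rfl⟩, hl.2⟩
    · obtain ⟨x, l₁, l₂, hx, -, rfl, h1, h2⟩ := ih hl.2 hy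
      exact ⟨x, y :: l₁, l₂, hx, by simp, rfl, ⟨hl.1, h1⟩, h2⟩

/-- Shortcuts of directed paths. -/
theorem exists_isDPath_range (h : IsCliqueSum G₁ G₂ G f₁ f₂) {a b : V} {l : List V}
    (hl : G.IsDPath a l b) (ha : a ∈ Set.range f₁) (hb : b ∈ Set.range f₁) :
    ∃ l', G.IsDPath a l' b ∧ (∀ x ∈ l', x ∈ Set.range f₁) ∧ (l' = l ∨ l'.length < l.length) := by
  induction hn : l.length using Nat.strong_induction_on generalizing a l with
  | _ n ih =>
  cases l with
  | nil => exact ⟨[], hl, by simp, Or.inl rfl⟩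
  | cons y l =>
    simp only [List.length_cons] at hn
    by_cases hy : y ∈ Set.range f₁
    · obtain ⟨l', h1, h2, h3⟩ := ih l.length (by omega) hl.2 hy rfl
      refine ⟨y :: l', ⟨hl.1, h1⟩, by simpa using ⟨by simpa using hy, by simpa using h2⟩, ?_⟩
      rcases h3 with rfl | h3
      exacts [Or.inl rfl, Or.inr (by simp only [List.length_cons]; omega)]
    -- The path leaves `G₁` at one vertex of the clique and returns at another. The edge between
    -- these, oriented by acyclicity, replaces the excursion of at least two edges.
    · have haC := h.mem_inter_of_edge (Or.inl hl.1) ha hy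
      obtain ⟨z, l₁, l₂, hz, hne, rfl, h1, h2⟩ := h.exists_entry hl.2 hy hb
      have haz : Relation.TransGen G.edge a z := .head' hl.1 h1.reflTransGen
      have e : G.edge a z := by
        refine (h.complete a haC z hz (ne_of_transGen haz)).resolve_right fun e => ?_
        exact G.acyclic a (haz.tail e)
      have hl₁ := List.length_pos_of_ne_nil hne
      simp only [List.length_append] at hn
      obtain ⟨l', h3, h4, h5⟩ := ih l₂.length (by omega) h2 hz.1 rfl
      refine ⟨z :: l', ⟨e, h3⟩, by simpa using ⟨by simpa using hz.1, by simpa using h4⟩, Or.inr ?_⟩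
      have h6 : l'.length ≤ l₂.length := by
        rcases h5 with rfl | h5
        exacts [le_rfl, h5.le]
      simp only [List.length_cons]
      omega

/-- Shortcuts of treks. -/
theorem exists_trek_range (h : IsCliqueSum G₁ G₂ G f₁ f₂) {t i j : V} {l r : List V}
    (hl : G.IsDPath t l i) (hr : G.IsDPath t r j) (hi : i ∈ Set.range f₁)
    (hj : j ∈ Set.range f₁) :
    ∃ t' l' r', G.IsDPath t' l' i ∧ G.IsDPath t' r' j ∧ t' ∈ Set.range f₁ ∧
      (∀ x ∈ l', x ∈ Set.range f₁) ∧ (∀ x ∈ r', x ∈ Set.range f₁) ∧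
      (t' = t ∧ l' = l ∧ r' = r ∨ l'.length + r'.length < l.length + r.length) := by
  by_cases ht : t ∈ Set.range f₁
  · obtain ⟨l', h1, h2, h3⟩ := h.exists_isDPath_range hl ht hi
    obtain ⟨r', h4, h5, h6⟩ := h.exists_isDPath_range hr ht hj
    refine ⟨t, l', r', h1, h4, ht, h2, h5, ?_⟩
    rcases h3 with rfl | h3 <;> rcases h6 with rfl | h6
    · exact Or.inl ⟨rfl, rfl, rfl⟩
    all_goals right; omega
  -- The top lies outside `G₁`, and both sides enter `G₁` at clique vertices `x` and `y`. Making `x`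
  -- the top drops two nonempty pieces at the cost of at most the edge `x → y`.
  · have key : ∀ {i j x y : V} {l₁ l₂ r₁ r₂ : List V}, i ∈ Set.range f₁ → j ∈ Set.range f₁ →
        x ∈ Set.range f₁ → y ∈ Set.range f₁ → l₁ ≠ [] → r₁ ≠ [] → G.IsDPath x l₂ i →
        G.IsDPath y r₂ j → (x = y ∨ G.edge x y) →
        ∃ t' l' r', G.IsDPath t' l' i ∧ G.IsDPath t' r' j ∧ t' ∈ Set.range f₁ ∧
        (∀ x ∈ l', x ∈ Set.range f₁) ∧ (∀ x ∈ r', x ∈ Set.range f₁) ∧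
        l'.length + r'.length < (l₁ ++ l₂).length + (r₁ ++ r₂).length := by
      intro i j x y l₁ l₂ r₁ r₂ hi hj hx hy hl₁ hr₁ hl₂ hr₂ hxy
      obtain ⟨l', h1, h2, h3⟩ := h.exists_isDPath_range hl₂ hx hi
      obtain ⟨r', h4, h5, h6⟩ := h.exists_isDPath_range hr₂ hy hj
      have h7 := List.length_pos_of_ne_nil hl₁
      have h8 := List.length_pos_of_ne_nil hr₁
      have h9 : l'.length ≤ l₂.length := by
        rcases h3 with rfl | h3
        exacts [le_rfl, h3.le]
      have h10 : r'.length ≤ r₂.length := by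
        rcases h6 with rfl | h6
        exacts [le_rfl, h6.le]
      rcases hxy with rfl | e
      · refine ⟨x, l', r', h1, h4, hx, h2, h5, ?_⟩
        simp only [List.length_append]
        omega
      · refine ⟨x, l', y :: r', h1, ⟨e, h4⟩, hx, h2, by simpa using ⟨by simpa using hy,
          by simpa using h5⟩, ?_⟩
        simp only [List.length_append, List.length_cons]
        omega
    obtain ⟨x, l₁, l₂, hx, hl₁, rfl, -, hl₂⟩ := h.exists_entry hl ht hi
    obtain ⟨y, r₁, r₂, hy, hr₁, rfl, -, hr₂⟩ := h.exists_entry hr ht hj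
    have hxy : (x = y ∨ G.edge x y) ∨ (y = x ∨ G.edge y x) := by
      by_cases hxy : x = y
      · exact Or.inl (Or.inl hxy)
      · exact (h.complete x hx y hy hxy).imp Or.inr Or.inr
    rcases hxy with hxy | hxy
    · obtain ⟨t', l', r', h1, h2, h3, h4, h5, h6⟩ := key hi hj hx.1 hy.1 hl₁ hr₁ hl₂ hr₂ hxy
      exact ⟨t', l', r', h1, h2, h3, h4, h5, Or.inr h6⟩
    · obtain ⟨t', r', l', h1, h2, h3, h4, h5, h6⟩ := key hj hi hy.1 hx.1 hr₁ hl₁ hr₂ hl₂ hxy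
      exact ⟨t', l', r', h2, h1, h3, h5, h4, Or.inr (by omega)⟩

theorem isDPath_map (h : IsCliqueSum G₁ G₂ G f₁ f₂) {a b : V₁} {l : List V₁}
    (hl : G₁.IsDPath a l b) : G.IsDPath (f₁ a) (l.map f₁) (f₁ b) := by
  induction l generalizing a with
  | nil => exact congrArg f₁ (isDPath_nil.1 hl)
  | cons x l ih => exact ⟨h.edge_map_iff.2 hl.1, ih hl.2⟩

theorem exists_isDPath_of_range (h : IsCliqueSum G₁ G₂ G f₁ f₂) {a b : V₁} {l : List V}
    (hl : G.IsDPath (f₁ a) l (f₁ b)) (hr : ∀ x ∈ l, x ∈ Set.range f₁) :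
    ∃ l₀, l = l₀.map f₁ ∧ G₁.IsDPath a l₀ b := by
  induction l generalizing a with
  | nil => exact ⟨[], rfl, f₁.injective hl⟩
  | cons x l ih =>
    obtain ⟨a', rfl⟩ := hr x (by simp)
    obtain ⟨l₀, rfl, h1⟩ := ih hl.2 fun x hx => hr x (by simp [hx])
    exact ⟨a' :: l₀, rfl, h.edge_map_iff.1 hl.1, h1⟩

theorem transGen_map (h : IsCliqueSum G₁ G₂ G f₁ f₂) {a b : V₁}
    (hab : Relation.TransGen G₁.edge a b) : Relation.TransGen G.edge (f₁ a) (f₁ b) :=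
  hab.lift f₁ fun _ _ => h.edge_map_iff.2

theorem exists_treks_of_map (h : IsCliqueSum G₁ G₂ G f₁ f₂) {a b : V₁} {t : V} {l r : List V}
    (hl : G.IsDPath t l (f₁ a)) (hr : G.IsDPath t r (f₁ b)) :
    ∃ t₀ l₀ r₀, G₁.IsDPath t₀ l₀ a ∧ G₁.IsDPath t₀ r₀ b ∧
      (f₁ t₀ = t ∧ l₀.map f₁ = l ∧ r₀.map f₁ = r ∨
        l₀.length + r₀.length < l.length + r.length) := by
  obtain ⟨t', l', r', h1, h2, ⟨t₀, rfl⟩, h3, h4, h5⟩ := h.exists_trek_range hl hr ⟨a, rfl⟩ ⟨b, rfl⟩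
  obtain ⟨l₀, rfl, h6⟩ := h.exists_isDPath_of_range h1 h3
  obtain ⟨r₀, rfl, h7⟩ := h.exists_isDPath_of_range h2 h4
  simp only [List.length_map] at h5
  exact ⟨t₀, l₀, r₀, h6, h7, h5⟩

theorem commonAncestor_map_iff (h : IsCliqueSum G₁ G₂ G f₁ f₂) {a b : V₁} :
    G.CommonAncestor (f₁ a) (f₁ b) ↔ G₁.CommonAncestor a b := by
  constructor
  · rintro ⟨t, h1, h2⟩
    obtain ⟨l, hl⟩ := exists_isDPath h1
    obtain ⟨r, hr⟩ := exists_isDPath h2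
    obtain ⟨t₀, l₀, r₀, h3, h4, -⟩ := h.exists_treks_of_map hl hr
    exact ⟨t₀, h3.reflTransGen, h4.reflTransGen⟩
  · rintro ⟨t, h1, h2⟩
    exact ⟨f₁ t, h1.lift f₁ fun _ _ => h.edge_map_iff.2, h2.lift f₁ fun _ _ => h.edge_map_iff.2⟩

/-- Shortest treks between vertices of `G₁` are shortest treks of `G₁`. -/
theorem eq_map_of_isShortest (h : IsCliqueSum G₁ G₂ G f₁ f₂) (h₁ : G₁.HasUniqueShortestTreks)
    {a b : V₁} {S : G₁.Trek a b} (hS : S.IsShortest) {T : G.Trek (f₁ a) (f₁ b)}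
    (hT : T.IsShortest) :
    T.top = f₁ S.top ∧ T.left = S.left.map f₁ ∧ T.right = S.right.map f₁ := by
  obtain ⟨t₀, l₀, r₀, hl, hr, h'⟩ := h.exists_treks_of_map T.isDPath_left T.isDPath_right
  have h1 := hT.le_of_isDPath (h.isDPath_map hl) (h.isDPath_map hr)
  have h2 := hT.le_of_isDPath (h.isDPath_map S.isDPath_left) (h.isDPath_map S.isDPath_right)
  simp only [List.length_map] at h1 h2
  rcases h' with ⟨h3, h4, h5⟩ | h'
  · obtain ⟨rfl, rfl, rfl⟩ := h₁.eq_of_isDPath hl hr hS (by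
      simpa only [Trek.length, ← h4, ← h5, List.length_map] using h2)
    exact ⟨h3.symm, h4.symm, h5.symm⟩
  · rw [Trek.length] at h1
    omega

theorem uniqueShortest_map (h : IsCliqueSum G₁ G₂ G f₁ f₂) (h₁ : G₁.HasUniqueShortestTreks)
    (a b : V₁) : G.UniqueShortest (f₁ a) (f₁ b) := by
  intro T T' hT hT'
  obtain ⟨S, hS⟩ := exists_isShortest (h.commonAncestor_map_iff.1 (nonempty_trek_iff.1 ⟨T⟩))
  obtain ⟨h1, h2, h3⟩ := h.eq_map_of_isShortest h₁ hS hT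
  obtain ⟨h4, h5, h6⟩ := h.eq_map_of_isShortest h₁ hS hT'
  exact Trek.ext (h1.trans h4.symm) (h2.trans h5.symm) (h3.trans h6.symm)

theorem _root_.DAG.rename_edgeMonomial (f : V₁ → V) (l : List V₁) :
    rename (Sum.map f (Prod.map f f)) (edgeMonomial l) = edgeMonomial (l.map f) := by
  induction l with
  | nil => simp [edgeMonomial]
  | cons a l ih =>
    cases l with
    | nil => simp
    | cons b l =>
      rw [edgeMonomial_cons_cons, map_mul, ih, rename_X]
      simp only [List.map_cons, edgeMonomial_cons_cons]
      rfl

theorem shortestTrekMonomial_map (h : IsCliqueSum G₁ G₂ G f₁ f₂)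
    (h₁ : G₁.HasUniqueShortestTreks) (hG : G.HasUniqueShortestTreks) (a b : V₁) :
    G.shortestTrekMonomial s(f₁ a, f₁ b) =
      rename (Sum.map f₁ (Prod.map f₁ f₁)) (G₁.shortestTrekMonomial s(a, b)) := by
  by_cases ht : G₁.CommonAncestor a b
  · obtain ⟨S, hS⟩ := exists_isShortest ht
    obtain ⟨T, hT⟩ := exists_isShortest (h.commonAncestor_map_iff.2 ht)
    obtain ⟨h1, h2, h3⟩ := h.eq_map_of_isShortest h₁ hS hT
    rw [shortestTrekMonomial_of_isShortest hG T hT, shortestTrekMonomial_of_isShortest h₁ S hS,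
      Trek.monomial, Trek.monomial, map_mul, map_mul, rename_edgeMonomial, rename_edgeMonomial,
      rename_X, Trek.leftSide, Trek.rightSide, h1, h2, h3]
    rfl
  · rw [shortestTrekMonomial_of_not ht, map_zero,
      shortestTrekMonomial_of_not (mt h.commonAncestor_map_iff.1 ht)]

end IsCliqueSum

end DAG
end
-- Safe gluings preserve unique shortest treks and the step property
noncomputable section

namespace DAG

variable {V V₁ V₂ : Type*} {G : DAG V} {G₁ : DAG V₁} {G₂ : DAG V₂} {f₁ : V₁ ↪ V} {f₂ : V₂ ↪ V}
  {c : V} {D : Set V}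

namespace IsSafeGluing

theorem symm (h : IsSafeGluing G₁ G₂ G f₁ f₂ c D) : IsSafeGluing G₂ G₁ G f₂ f₁ c D where
  cliqueSum := h.cliqueSum.symm
  clique_eq := by rw [Set.inter_comm]; exact h.clique_eq
  notMem := h.notMem
  safe := by
    refine h.safe.imp ?_ ?_
    · rintro ⟨⟨h1, h2⟩, h3⟩
      have hmem : ∀ {x i j} {T : G.Trek i j}, x ∈ T.symm.verts → x ∈ T.verts := by
        intro x i j T hx
        rw [Trek.mem_verts_iff] at hx ⊢
        exact hx.symm
      refine ⟨⟨fun i hi j hj T => hmem (h1 j hj i hi T.symm), h2.symm.imp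
        (fun h i hi j hj T => h j hj i hi T.symm) (fun h i hi j hj T => h j hj i hi T.symm)⟩,
        fun i hi j hj T d hd hdT => h3 j hj i hi T.symm d hd (hmem (T := T.symm) hdT)⟩
    · rintro ⟨h1, h2⟩
      exact ⟨h1, fun c₁ c₂ hc₁ hc₂ => (h2 c₂ c₁ hc₂ hc₁).symm⟩

variable (h : IsSafeGluing G₁ G₂ G f₁ f₂ c D)
include h

theorem mem_inter_iff {x : V} : x ∈ Set.range f₁ ∩ Set.range f₂ ↔ x = c ∨ x ∈ D := by
  rw [h.clique_eq]
  exact Set.mem_insert_iff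

theorem mem_left : c ∈ Set.range f₁ \ D := ⟨(h.mem_inter_iff.2 (Or.inl rfl)).1, h.notMem⟩

theorem mem_right : c ∈ Set.range f₂ \ D := h.symm.mem_left

theorem notMem_of {x : V} (hx : x ∉ Set.range f₁) : x ∈ Set.range f₂ \ D := by
  exact ⟨h.cliqueSum.mem_of_notMem hx, fun hd => hx (h.mem_inter_iff.2 (Or.inr hd)).1⟩

/-- Either `c` is on one fixed side of all treks between the parts, and these avoid `D`, or there
are no treks between the parts. -/
theorem side_or : ((G.OnLeftSide c (Set.range f₁ \ D) (Set.range f₂ \ D) ∨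
      G.OnLeftSide c (Set.range f₂ \ D) (Set.range f₁ \ D)) ∧
      ∀ i ∈ Set.range f₁ \ D, ∀ j ∈ Set.range f₂ \ D, ∀ T : G.Trek i j, ∀ d ∈ D, d ∉ T.verts) ∨
    (D = ∅ ∧ ∀ i j, i ∉ Set.range f₂ → j ∉ Set.range f₁ → ¬ G.CommonAncestor i j) := by
  refine h.safe.imp ?_ ?_
  · rintro ⟨⟨-, h1⟩, h2⟩
    exact ⟨h1.imp_right fun h i hi j hj T => h j hj i hi T.symm, h2⟩
  · rintro ⟨rfl, h1⟩
    refine ⟨rfl, ?_⟩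
    have hC : ∀ x, x ∈ Set.range f₁ → x ∈ Set.range f₂ → x = c := by
      intro x hx1 hx2
      simpa using h.mem_inter_iff.1 ⟨hx1, hx2⟩
    obtain ⟨c₁, hc₁⟩ := h.mem_left.1
    obtain ⟨c₂, hc₂⟩ := h.mem_right.1
    have hs := h1 c₁ c₂ hc₁ hc₂
    -- As the only common vertex is a sink of the whole graph, directed paths cannot cross from one
    -- part to the other.
    have hsink : ∀ v, ¬ G.edge c v := by
      intro v e
      rcases (h.cliqueSum.edge_iff c v).1 e with ⟨a, b, ha, rfl, e'⟩ | ⟨a, b, ha, rfl, e'⟩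
      · obtain rfl := f₁.injective (ha.trans hc₁.symm)
        exact hs.1 b e'
      · obtain rfl := f₂.injective (ha.trans hc₂.symm)
        exact hs.2 b e'
    have h2 : ∀ {t j}, Relation.ReflTransGen G.edge t j → t ∈ Set.range f₁ → j ∈ Set.range f₁ := by
      intro t j htj ht
      induction htj with
      | refl => exact ht
      | @tail x y _ e ih =>
        rcases h.cliqueSum.mem_of_edge e with h' | h'
        · exact h'.2
        · obtain rfl := hC x ih h'.1
          exact absurd e (hsink y)
    have h3 : ∀ {t j}, Relation.ReflTransGen G.edge t j → t ∈ Set.range f₂ → j ∈ Set.range f₂ := by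
      intro t j htj ht
      induction htj with
      | refl => exact ht
      | @tail x y _ e ih =>
        rcases h.cliqueSum.mem_of_edge e with h' | h'
        · obtain rfl := hC x h'.1 ih
          exact absurd e (hsink y)
        · exact h'.2
    rintro i j hi hj ⟨t, ht1, ht2⟩
    by_cases ht : t ∈ Set.range f₁
    · exact hj (h2 ht2 ht)
    · exact hi (h3 ht1 (h.cliqueSum.mem_of_notMem ht))

/-- Shortest treks of a safe gluing are unique. -/
theorem hasUniqueShortestTreks (h₁ : G₁.HasUniqueShortestTreks)
    (h₂ : G₂.HasUniqueShortestTreks) : G.HasUniqueShortestTreks := by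
  refine hasUniqueShortestTreks_iff.2 ?_
  have hu1 : ∀ {i j}, i ∈ Set.range f₁ → j ∈ Set.range f₁ → G.UniqueShortest i j := by
    rintro _ _ ⟨a, rfl⟩ ⟨b, rfl⟩
    exact h.cliqueSum.uniqueShortest_map h₁ a b
  have hu2 : ∀ {i j}, i ∈ Set.range f₂ → j ∈ Set.range f₂ → G.UniqueShortest i j := by
    rintro _ _ ⟨a, rfl⟩ ⟨b, rfl⟩
    exact h.cliqueSum.symm.uniqueShortest_map h₂ a b
  have hc1 := h.mem_left
  have hc2 := h.mem_right
  have hu : ∀ {i j}, i ∉ Set.range f₂ → j ∉ Set.range f₁ → G.UniqueShortest i j := by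
    intro i j hi hj
    have hi' := h.symm.notMem_of hi
    have hj' := h.notMem_of hj
    rcases h.side_or with ⟨hs | hs, -⟩ | ⟨-, hs⟩
    · exact hs.uniqueShortest hc2 hi' hj' (hu1 hi'.1 hc1.1) (hu2 hc2.1 hj'.1)
    · exact (hs.uniqueShortest hc1 hj' hi' (hu2 hj'.1 hc2.1) (hu1 hc1.1 hi'.1)).symm
    · exact fun T => absurd (nonempty_trek_iff.1 ⟨T⟩) (hs i j hi hj)
  intro i j
  by_cases hi : i ∈ Set.range f₁
  · by_cases hj : j ∈ Set.range f₁
    · exact hu1 hi hj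
    by_cases hi2 : i ∈ Set.range f₂
    · exact hu2 hi2 (h.notMem_of hj).1
    · exact hu hi2 hj
  · by_cases hj : j ∈ Set.range f₂
    · exact hu2 (h.notMem_of hi).1 hj
    · exact (hu hj hi).symm

omit h in
/-- The product formula for the shortest treks between the two parts. -/
theorem shortestTrekMonomial_mul (hG : G.HasUniqueShortestTreks) {I J : Set V} (hcI : c ∈ I)
    (hcJ : c ∈ J) (hs : G.OnLeftSide c I J ∨ G.OnLeftSide c J I) {i j : V} (hi : i ∈ I)
    (hj : j ∈ J) : G.shortestTrekMonomial s(i, j) * X (Sum.inl c) =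
      G.shortestTrekMonomial s(i, c) * G.shortestTrekMonomial s(c, j) := by
  rcases hs with hs | hs
  · exact hs.shortestTrekMonomial_mul hG hcJ hi hj
  · rw [shortestTrekMonomial_comm i j, hs.shortestTrekMonomial_mul hG hcI hj hi, mul_comm,
      shortestTrekMonomial_comm c i, shortestTrekMonomial_comm j c]

/-- If a vertex of the second part is an ancestor of `c`, then all vertices of the first part with
a trek to `c` are descendants of `c`. -/
theorem reflTransGen_of_side (hs : G.OnLeftSide c (Set.range f₁ \ D) (Set.range f₂ \ D) ∨
      G.OnLeftSide c (Set.range f₂ \ D) (Set.range f₁ \ D)) {i p : V} (hi : i ∈ Set.range f₁ \ D)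
    (hic : G.CommonAncestor i c) (hp : p ∈ Set.range f₂ \ D)
    (hpc : Relation.TransGen G.edge p c) : Relation.ReflTransGen G.edge c i := by
  rcases hs with hs | hs
  · exact hs.reflTransGen h.mem_right hi hic
  · have := hs.reflTransGen h.mem_left hp ⟨p, .refl, hpc.to_reflTransGen⟩
    exact absurd (hpc.trans_left this) (G.acyclic p)

omit h in
-- Otherwise `c ← d → x` or `c ← d ← x` is a trek between the parts that contains a vertex of `D`.
theorem not_edge_of_avoids {I J : Set V} (hc : c ∈ I)
    (ha : ∀ i ∈ I, ∀ j ∈ J, ∀ T : G.Trek i j, ∀ d ∈ D, d ∉ T.verts) {d x : V} (hd : d ∈ D)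
    (hx : x ∈ J) (hdc : G.edge d c) (hdx : G.edge d x ∨ G.edge x d)
    (hxc : x ≠ c) : False := by
  have hdc' := ne_of_edge hdc
  rcases hdx with e | e
  · refine ha c hc x hx ⟨d, [c], [x], by simpa using hdc, by simpa using e, rfl, rfl, ?_⟩ d hd ?_
    · simp [hdc', ne_of_edge e, hxc.symm]
    · simp [Trek.verts]
  · refine ha c hc x hx ⟨x, [d, c], [], by simpa using ⟨e, hdc⟩, by simp, rfl, rfl, ?_⟩ d hd ?_
    · simp [hdc', ne_of_edge e, hxc]
    · simp [Trek.verts]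

/-- The step property for two vertices in the same part. -/
theorem step_left (hG : G.HasUniqueShortestTreks) (h₁ : G₁.HasUniqueShortestTreks)
    (hS : G₁.StepProperty) {i j : V} (hi : i ∈ Set.range f₁) (hj : j ∈ Set.range f₁) (hij : i ≠ j)
    (hji : ¬ Relation.TransGen G.edge j i) (ht : G.CommonAncestor i j) : ∃ s, G.edge s j ∧
      G.shortestTrekMonomial s(i, j) = G.shortestTrekMonomial s(i, s) * X (Sum.inr (s, j)) ∧
      ∀ p, G.edge p j → G.shortestTrekMonomial s(i, p) * X (Sum.inl s) =
        G.shortestTrekMonomial s(i, s) * G.shortestTrekMonomial s(s, p) := by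
  by_cases hedge : G.edge i j
  · refine ⟨i, hedge, ?_, fun p _ => ?_⟩
    · rw [hG.shortestTrekMonomial_edge hedge, hG.shortestTrekMonomial_self]
    · rw [hG.shortestTrekMonomial_self, mul_comm]
  obtain ⟨a, rfl⟩ := hi
  obtain ⟨b, rfl⟩ := hj
  have hcs := h.cliqueSum
  obtain ⟨s, hs1, hs2, hs3⟩ := hS a b (fun h' => hij (congrArg f₁ h'))
    (fun h' => hji (hcs.transGen_map h')) (hcs.commonAncestor_map_iff.1 ht)
  have hψ := hcs.shortestTrekMonomial_map h₁ hG
  have hψp : ∀ q, G₁.edge q b → G.shortestTrekMonomial s(f₁ a, f₁ q) * X (Sum.inl (f₁ s)) =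
      G.shortestTrekMonomial s(f₁ a, f₁ s) * G.shortestTrekMonomial s(f₁ s, f₁ q) := by
    intro q hq
    have := congrArg (rename (Sum.map f₁ (Prod.map f₁ f₁))) (hs3 q hq)
    rw [map_mul, map_mul, rename_X] at this
    rw [hψ, hψ, hψ]
    exact this
  have hψs : G.shortestTrekMonomial s(f₁ a, f₁ b) =
      G.shortestTrekMonomial s(f₁ a, f₁ s) * X (Sum.inr (f₁ s, f₁ b)) := by
    rw [hψ, hψ, hs2, map_mul, rename_X]
    rfl
  have hsb : G.edge (f₁ s) (f₁ b) := hcs.edge_map_iff.2 hs1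
  refine ⟨f₁ s, hsb, hψs, fun p hp => ?_⟩
  by_cases hp1 : p ∈ Set.range f₁
  · obtain ⟨q, rfl⟩ := hp1
    exact hψp q (hcs.edge_map_iff.1 hp)
  -- A parent of `j` outside `G₁` remains. Then `j` is in the clique, and `i` is not, since it is
  -- not adjacent to `j`.
  have hbC := hcs.mem_inter_of_edge (Or.inr hp) ⟨b, rfl⟩ hp1
  have hp2 := h.notMem_of hp1
  have ha2 : f₁ a ∉ Set.range f₂ := fun ha =>
    (hcs.complete _ ⟨⟨a, rfl⟩, ha⟩ _ hbC hij).elim hedge fun e => hji (.single e)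
  have ha1 := h.symm.notMem_of ha2
  rcases h.side_or with ⟨hs, hD⟩ | ⟨rfl, hs⟩
  · have hcross := fun {i j} => shortestTrekMonomial_mul (i := i) (j := j) hG h.mem_left
      h.mem_right hs
    -- For `j = c` the parent `p` would be an ancestor of `c` in the second part, which makes `i` a
    -- descendant of `j`.
    have hbc : f₁ b ≠ c := by
      intro hbc
      have := h.reflTransGen_of_side hs ha1 (hbc ▸ ht) hp2 (hbc ▸ .single hp)
      rcases Relation.reflTransGen_iff_eq_or_transGen.1 this with h' | h'
      · exact hij (h'.trans hbc.symm)
      · exact hji (hbc ▸ h')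
    have hbD : f₁ b ∈ D := (h.mem_inter_iff.1 hbC).resolve_left hbc
    have hpc : p ≠ c := fun h' => hp1 (h' ▸ h.mem_left.1)
    -- So `j` is in `D`, and the avoidance of `D` forces `c → j`. Now `c` is a parent of `j` within
    -- `G₁`, and the known relation for this parent is transported to `p` by the product formula at
    -- `c`.
    have hcb : G.edge c (f₁ b) := by
      refine (hcs.complete _ hbC c ⟨h.mem_left.1, h.mem_right.1⟩ hbc).resolve_left fun e => ?_
      exact not_edge_of_avoids h.mem_left hD hbD hp2 e (Or.inr hp) hpc
    obtain ⟨c₁, hc₁⟩ := h.mem_left.1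
    have hsc : G.shortestTrekMonomial s(f₁ a, c) * X (Sum.inl (f₁ s)) =
        G.shortestTrekMonomial s(f₁ a, f₁ s) * G.shortestTrekMonomial s(f₁ s, c) := by
      have := hψp c₁ (hcs.edge_map_iff.1 (hc₁ ▸ hcb))
      rwa [hc₁] at this
    have hne : G.shortestTrekMonomial s(f₁ a, f₁ s) ≠ 0 := by
      intro h0
      rw [h0, zero_mul] at hψs
      exact hG.shortestTrekMonomial_ne_zero.2 ht hψs
    -- If `s` were in `D`, it would be adjacent to `c`, and the variable of this edge would divide
    -- `ψ(i,c) * a_s`. The shortest trek from `i` to `c` would then contain `s`.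
    have hsD : f₁ s ∉ D := by
      intro hsD
      have hsC := h.mem_inter_iff.2 (Or.inr hsD)
      have hsc' : f₁ s ≠ c := fun h' => h.notMem (h' ▸ hsD)
      have key : ∀ e : V × V, (e.1 = f₁ s ∨ e.2 = f₁ s) → ∀ y : MvPolynomial (V ⊕ V × V) ℂ,
          G.shortestTrekMonomial s(f₁ s, c) = y * X (Sum.inr e) → False := by
        intro e he y hy
        have hac : G.CommonAncestor (f₁ a) c := by
          rw [← hG.shortestTrekMonomial_ne_zero]
          intro h0
          rw [h0, zero_mul, eq_comm, mul_eq_zero] at hsc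
          have hsc'' : G.CommonAncestor (f₁ s) c :=
            (hcs.complete _ hsC c ⟨h.mem_left.1, h.mem_right.1⟩ hsc').elim commonAncestor_of_edge
              fun e => (commonAncestor_of_edge e).symm
          exact hsc.elim hne (hG.shortestTrekMonomial_ne_zero.2 hsc'')
        obtain ⟨T, hT⟩ := exists_isShortest hac
        have hdvd : (X (Sum.inr e) : MvPolynomial (V ⊕ V × V) ℂ) ∣
            monomial (T.exp + Finsupp.single (Sum.inl (f₁ s)) 1) 1 := by
          refine ⟨G.shortestTrekMonomial s(f₁ a, f₁ s) * y, ?_⟩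
          rw [shortestTrekMonomial_of_isShortest hG T hT, hy, T.monomial_eq, X, monomial_mul,
            mul_one] at hsc
          rw [hsc]
          ring
        rw [X_dvd_monomial] at hdvd
        have hexp : T.exp (Sum.inr e) ≠ 0 := by
          simpa using hdvd
        have hmem : f₁ s ∈ T.verts := by
          rw [Trek.mem_verts_iff]
          rcases he with he | he <;> rw [← he] <;>
            rcases Trek.mem_of_exp_ne_zero (k := e.1) (m := e.2) hexp with h' | h'
          exacts [Or.inl h'.1, Or.inr h'.1, Or.inl (List.mem_cons_of_mem _ h'.2),
            Or.inr (List.mem_cons_of_mem _ h'.2)]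
        exact hD _ ha1 _ h.mem_right T _ hsD hmem
      rcases hcs.complete _ hsC c ⟨h.mem_left.1, h.mem_right.1⟩ hsc' with e | e
      · exact key (f₁ s, c) (Or.inl rfl) (X (Sum.inl (f₁ s))) (hG.shortestTrekMonomial_edge e)
      · refine key (c, f₁ s) (Or.inr rfl) (X (Sum.inl c)) ?_
        rw [shortestTrekMonomial_comm]
        exact hG.shortestTrekMonomial_edge e
    have hcne : (X (Sum.inl c) : MvPolynomial (V ⊕ V × V) ℂ) ≠ 0 := X_ne_zero _
    have h1 := hcross ha1 hp2
    have h2 := hcross (i := f₁ s) (j := p) ⟨⟨s, rfl⟩, hsD⟩ hp2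
    refine mul_right_cancel₀ hcne ?_
    linear_combination X (Sum.inl (f₁ s)) * h1 - G.shortestTrekMonomial s(f₁ a, f₁ s) * h2 +
      G.shortestTrekMonomial s(c, p) * hsc
  · have hs2 : f₁ s ∉ Set.range f₂ := by
      intro hs2
      have h1 : f₁ s ∈ ({c} : Set V) := by
        simpa using h.mem_inter_iff.1 ⟨⟨s, rfl⟩, hs2⟩
      have h2 : f₁ b ∈ ({c} : Set V) := by
        simpa using h.mem_inter_iff.1 hbC
      exact ne_of_edge hsb (h1.trans h2.symm)
    rw [shortestTrekMonomial_of_not (hs _ _ ha2 hp1), shortestTrekMonomial_of_not (hs _ _ hs2 hp1),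
      zero_mul, mul_zero]

/-- The step property for vertices in different parts. -/
theorem step_cross (hG : G.HasUniqueShortestTreks) (h₂ : G₂.HasUniqueShortestTreks)
    (hS : G₂.StepProperty) {i j : V} (hi : i ∉ Set.range f₂) (hj : j ∉ Set.range f₁)
    (hji : ¬ Relation.TransGen G.edge j i) (ht : G.CommonAncestor i j) : ∃ s, G.edge s j ∧
      G.shortestTrekMonomial s(i, j) = G.shortestTrekMonomial s(i, s) * X (Sum.inr (s, j)) ∧
      ∀ p, G.edge p j → G.shortestTrekMonomial s(i, p) * X (Sum.inl s) =
        G.shortestTrekMonomial s(i, s) * G.shortestTrekMonomial s(s, p) := by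
  rcases h.side_or with ⟨hs, hD⟩ | ⟨-, hs⟩
  swap
  · exact absurd ht (hs i j hi hj)
  have hcross := fun {i j} => shortestTrekMonomial_mul (i := i) (j := j) hG h.mem_left
    h.mem_right hs
  have hi1 := h.symm.notMem_of hi
  have hj2 := h.notMem_of hj
  have hcne : (X (Sum.inl c) : MvPolynomial (V ⊕ V × V) ℂ) ≠ 0 := X_ne_zero _
  have h1 := hcross hi1 hj2
  have hjc : j ≠ c := fun h' => hj (h' ▸ h.mem_left.1)
  have hne : G.shortestTrekMonomial s(i, c) ≠ 0 ∧ G.shortestTrekMonomial s(c, j) ≠ 0 := by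
    rw [← mul_ne_zero_iff, ← h1]
    exact mul_ne_zero (hG.shortestTrekMonomial_ne_zero.2 ht) hcne
  rw [hG.shortestTrekMonomial_ne_zero, hG.shortestTrekMonomial_ne_zero] at hne
  -- The step is taken from `c` instead of `i`, inside `G₂`. The product formula at `c` carries it
  -- back to `i`, once all parents of `j` are known to lie in the second part outside `D`.
  obtain ⟨s, hsj, hs1, hs2⟩ := h.symm.step_left hG h₂ hS h.mem_right.1 hj2.1 hjc.symm
    (fun e => hji (e.trans_left (h.reflTransGen_of_side hs hi1 hne.1 hj2 e))) hne.2
  have hpar : ∀ p, G.edge p j → p ∈ Set.range f₂ \ D := by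
    intro p hp
    refine ⟨?_, fun hpD => ?_⟩
    · rcases h.cliqueSum.mem_of_edge hp with h' | h'
      exacts [absurd h'.2 hj, h'.1]
    · have hpC : p ∈ Set.range f₁ ∩ Set.range f₂ := by
        rw [h.clique_eq]
        exact Set.mem_insert_of_mem c hpD
      have hpc : p ≠ c := fun h' => h.notMem (h' ▸ hpD)
      rcases h.cliqueSum.complete p hpC c ⟨h.mem_left.1, h.mem_right.1⟩ hpc with e | e
      · exact not_edge_of_avoids h.mem_left hD hpD hj2 e (Or.inl hp) hjc
      · refine hD c h.mem_left j hj2 ⟨c, [], [p, j], by simp, by simpa using ⟨e, hp⟩, rfl, rfl, ?_⟩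
          p hpD ?_
        · simp [hpc.symm, hjc.symm, ne_of_edge hp]
        · simp [Trek.verts]
  have hsis := hcross hi1 (hpar s hsj)
  refine ⟨s, hsj, mul_right_cancel₀ hcne ?_, fun p hp => mul_right_cancel₀ hcne ?_⟩
  · linear_combination h1 + G.shortestTrekMonomial s(i, c) * hs1 - X (Sum.inr (s, j)) * hsis
  · have h3 := hcross hi1 (hpar p hp)
    linear_combination X (Sum.inl s) * h3 + G.shortestTrekMonomial s(i, c) * hs2 p hp -
      G.shortestTrekMonomial s(s, p) * hsis

/-- Safe gluings preserve the step property. -/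
theorem stepProperty (h₁ : G₁.HasUniqueShortestTreks) (h₂ : G₂.HasUniqueShortestTreks)
    (hS₁ : G₁.StepProperty) (hS₂ : G₂.StepProperty) : G.StepProperty := by
  have hG := h.hasUniqueShortestTreks h₁ h₂
  intro i j hij hji ht
  by_cases hi : i ∈ Set.range f₁
  · by_cases hj : j ∈ Set.range f₁
    · exact h.step_left hG h₁ hS₁ hi hj hij hji ht
    by_cases hi2 : i ∈ Set.range f₂
    · exact h.symm.step_left hG h₂ hS₂ hi2 (h.notMem_of hj).1 hij hji ht
    · exact h.step_cross hG h₂ hS₂ hi2 hj hji ht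
  · by_cases hj : j ∈ Set.range f₂
    · exact h.symm.step_left hG h₂ hS₂ (h.notMem_of hi).1 hj hij hji ht
    · exact h.symm.step_cross hG h₁ hS₁ hi hj hji ht

end IsSafeGluing

end DAG
end
-- Toricity and the main theorem
noncomputable section

namespace DAG

variable {V : Type*} {G : DAG V}

/-- The exponent vectors of ordinary monomials among those of Laurent monomials. -/
def laurentExponent {σ : Type*} {d : ℕ} (e : Fin d → σ) : (σ →₀ ℕ) →+ (Fin d → ℤ) where
  toFun m k := m (e k)
  map_zero' := rfl
  map_add' m n := funext fun k => by simp

theorem laurentExponent_injective {σ : Type*} {d : ℕ} {e : Fin d → σ}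
    (he : Function.Surjective e) : Function.Injective (laurentExponent e) := by
  intro m n h
  ext x
  obtain ⟨k, rfl⟩ := he x
  exact Nat.cast_injective (R := ℤ) (congrFun h k)

/-- The shortest trek ideal is toric. -/
theorem isToricIdeal_shortestTrekIdeal [Finite V] (hG : G.HasUniqueShortestTreks) :
    IsToricIdeal G.shortestTrekIdeal := by
  classical
  cases nonempty_fintype V
  let e := (Fintype.equivFin (V ⊕ V × V)).symm
  let Φ : MvPolynomial (V ⊕ V × V) ℂ →ₐ[ℂ] AddMonoidAlgebra ℂ (Fin _ → ℤ) :=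
    AddMonoidAlgebra.mapDomainAlgHom ℂ ℂ (laurentExponent e)
  -- The polynomial ring embeds in the Laurent ring, so passing to Laurent monomials does not change
  -- the kernel.
  have hΦ : Function.Injective Φ :=
    AddMonoidAlgebra.mapDomain_injective (laurentExponent_injective e.surjective)
  have hA : ∀ z, ∃ a : Option (Fin _ → ℤ), Φ (G.shortestTrekMonomial z) =
      a.elim 0 fun a => AddMonoidAlgebra.single a 1 := by
    intro z
    induction z using Sym2.ind with
    | _ i j =>
    by_cases h : G.CommonAncestor i j
    · obtain ⟨T, hT⟩ := exists_isShortest h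
      refine ⟨some (laurentExponent e T.exp), ?_⟩
      rw [shortestTrekMonomial_of_isShortest hG T hT, T.monomial_eq]
      exact AddMonoidAlgebra.mapDomain_single
    · exact ⟨none, by rw [shortestTrekMonomial_of_not h, map_zero]; rfl⟩
  choose A hA using hA
  refine ⟨_, A, ?_⟩
  have hcomp : (aeval (R := ℂ) fun z => (A z).elim (0 : AddMonoidAlgebra ℂ (Fin _ → ℤ))
      fun a => AddMonoidAlgebra.single a 1) = Φ.comp G.shortestTrekMap := by
    refine MvPolynomial.algHom_ext fun z => ?_
    rw [aeval_X, AlgHom.comp_apply, shortestTrekMap_X, hA]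
  ext f
  rw [hcomp, shortestTrekIdeal, RingHom.mem_ker, RingHom.mem_ker, AlgHom.comp_apply,
    map_eq_zero_iff Φ hΦ]

end DAG
end

theorem mainTheorem1 {V₁ V₂ V : Type*} [Fintype V₁] [DecidableEq V₁] [Fintype V₂] [DecidableEq V₂]
    [Fintype V] [DecidableEq V] (G₁ : DAG V₁) (G₂ : DAG V₂) (G : DAG V)
    (h₁ : G₁.HasUniqueShortestTreks) (h₂ : G₂.HasUniqueShortestTreks)
    (hCI₁ : G₁.shortestTrekIdeal = G₁.ciIdeal) (hCI₂ : G₂.shortestTrekIdeal = G₂.ciIdeal)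
    (f₁ : V₁ ↪ V) (f₂ : V₂ ↪ V) (c : V) (D : Set V)
    (hG : DAG.IsSafeGluing G₁ G₂ G f₁ f₂ c D) :
    G.HasUniqueShortestTreks ∧
      G.shortestTrekIdeal = G.ciIdeal ∧
      G.shortestTrekIdeal = G.vanishingIdeal ∧
      IsToricIdeal G.vanishingIdeal ∧
      G.vanishingIdeal = Ideal.span (G.noTrekVariables ∪ G.singleVertexMinors) := by
  have hU := hG.hasUniqueShortestTreks h₁ h₂
  have hS := hG.stepProperty h₁ h₂ (DAG.stepProperty_of_ciIdeal_le h₁ hCI₁.ge)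
    (DAG.stepProperty_of_ciIdeal_le h₂ hCI₂.ge)
  obtain ⟨E, hE⟩ := DAG.exists_trekExponents hU hS
  have hST := DAG.TrekExponents.shortestTrekIdeal_le hE
  have hQ : G.quadraticIdeal ≤ G.ciIdeal := DAG.quadraticIdeal_le_ciIdeal
  have hCI : G.ciIdeal ≤ G.vanishingIdeal := DAG.ciIdeal_le_vanishingIdeal
  -- This closes the cycle of inclusions, using ST ⊆ I from its other three members.
  have hI := DAG.vanishingIdeal_le_shortestTrekIdeal hU (hST.trans (hQ.trans hCI))
  have hIST := le_antisymm (hST.trans (hQ.trans hCI)) hI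
  refine ⟨hU, le_antisymm (hST.trans hQ) (hCI.trans hI), hIST, ?_, ?_⟩
  · rw [← hIST]
    exact DAG.isToricIdeal_shortestTrekIdeal hU
  · exact le_antisymm (hI.trans hST) (hQ.trans hCI)
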